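/- **Theorem.** Let $0<y<1$. There are constants $\delta,c,C,c'>0$, depending only on $y$, such that the following holds for all integers $n,p\ge 1$ with $|p/n-y|\le\delta$ (in particular, along every sequence with $p,n\to\infty$ and $p/n\to y$, for all large $n$). Let $\boldsymbol T_p\in\mathbb R^{p\times p}$ be positive definite, let $g_p:[0,\infty)\to[0,\infty)$ be measurable with $0<\int_{\mathbb R^p} g_p(\|\boldsymbol x\|^2)\,d\boldsymbol x<\infty$, and let $\boldsymbol x_1,\dots,\boldsymbol x_n$ be i.i.d. samples from the elliptical distribution on $\mathbb R^p$ with density $$\mu_p(\boldsymbol x)=C(g_p)\det(\boldsymbol T_p)^{-1/2}g_p(\boldsymbol x^T\boldsymbol T_p^{-1}\boldsymbol x),\qquad C(g_p)=\Big(\int_{\mathbb R^p} g_p(\|\boldsymbol x\|^2)\,d\boldsymbol x\Big)^{-1}.$$ Put $\boldsymbol y_i=\boldsymbol T_p^{-1/2}\boldsymbol x_i/\|\boldsymbol T_p^{-1/2}\boldsymbol x_i\|$. Then each $\boldsymbol y_i$ is uniformly distributed on the unit sphere of $\mathbb R^p$, and for every $0<\varepsilon<c'$, with probability at least $1-C\,n\,e^{-c\varepsilon^2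 n}$, Tyler's M-estimator of $\boldsymbol x_1,\dots,\boldsymbol x_n$, that is, the unique positive definite matrix $\hat\Sigma$ with $$\hat\Sigma=\frac pn\sum_{i=1}^n\frac{\boldsymbol x_i\boldsymbol x_i^T}{\boldsymbol x_i^T\hat\Sigma^{-1}\boldsymbol x_i},\qquad \operatorname{tr}(\hat\Sigma)=1,$$ exists, is unique, and satisfies, in operator norm, $$\left\|\frac{p\,\boldsymbol T_p^{-1/2}\hat\Sigma\,\boldsymbol T_p^{-1/2}}{\operatorname{tr}\big(\boldsymbol T_p^{-1/2}\hat\Sigma\,\boldsymbol T_p^{-1/2}\big)}-\frac pn\sum_{i=1}^n\boldsymbol y_i\boldsymbol y_i^T\right\|\le\varepsilon .$$ -/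

import Mathlib

open MeasureTheory ProbabilityTheory

noncomputable section

/-- The positive definite matrix `T^{-1/2}`, for a positive definite real matrix `T`. -/
def invSqrt {p : ℕ} (T : Matrix (Fin p) (Fin p) ℝ) : Matrix (Fin p) (Fin p) ℝ :=
  open scoped MatrixOrder in CFC.sqrt T⁻¹

/-- The operator (spectral) norm of a square matrix, acting on Euclidean space. -/
def opNorm {p : ℕ} (A : Matrix (Fin p) (Fin p) ℝ) : ℝ :=
  ‖Matrix.toEuclideanCLM (n := Fin p) (𝕜 := ℝ) A‖

/-- The rank-one matrix `x xᵀ`. -/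
def outer {p : ℕ} (x : EuclideanSpace ℝ (Fin p)) : Matrix (Fin p) (Fin p) ℝ :=
  Matrix.vecMulVec x.ofLp x.ofLp

/-- The quadratic form `xᵀ A x`. -/
def quadForm {p : ℕ} (A : Matrix (Fin p) (Fin p) ℝ) (x : EuclideanSpace ℝ (Fin p)) : ℝ :=
  x.ofLp ⬝ᵥ Matrix.mulVec A x.ofLp

/-- `g : [0, ∞) → [0, ∞)` (only the values on `[0, ∞)` matter) is a radial profile in dimension
`p`: the function `x ↦ g (‖x‖²)` on `ℝ^p` is integrable and not almost everywhere zero, so that it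
can be normalized to a probability density. -/
structure IsRadialProfile (p : ℕ) (g : ℝ → ℝ) : Prop where
  measurable : Measurable g
  nonneg : ∀ t, 0 ≤ t → 0 ≤ g t
  integrable : Integrable (fun x : EuclideanSpace ℝ (Fin p) => g (‖x‖ ^ 2)) volume
  pos : 0 < ∫ x : EuclideanSpace ℝ (Fin p), g (‖x‖ ^ 2)

/-- The normalizing constant `C(g)`, which depends only on `g` and the dimension. -/
def profileConst (p : ℕ) (g : ℝ → ℝ) : ℝ :=
  (∫ x : EuclideanSpace ℝ (Fin p), g (‖x‖ ^ 2))⁻¹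

/-- The (centred) elliptical distribution on `ℝ^p` with shape matrix `T` and radial profile `g`,
that is, with Lebesgue density `C(g) det(T)^{-1/2} g(xᵀ T⁻¹ x)`. -/
def ellipticalMeasure {p : ℕ} (T : Matrix (Fin p) (Fin p) ℝ) (g : ℝ → ℝ) :
    Measure (EuclideanSpace ℝ (Fin p)) :=
  volume.withDensity fun x =>
    ENNReal.ofReal (profileConst p g * (Real.sqrt T.det)⁻¹ * g (quadForm T⁻¹ x))

/-- The uniform probability distribution on the unit sphere of `ℝ^p` (for `1 ≤ p`), as a measure
on `ℝ^p`: the normalized surface measure. -/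
def uniformSphere (p : ℕ) : Measure (EuclideanSpace ℝ (Fin p)) :=
  let σ := (volume : Measure (EuclideanSpace ℝ (Fin p))).toSphere
  ((σ Set.univ)⁻¹ • σ).map Subtype.val

/-- `T^{-1/2} x / ‖T^{-1/2} x‖`. -/
def whitenedDirection {p : ℕ} (T : Matrix (Fin p) (Fin p) ℝ) (x : EuclideanSpace ℝ (Fin p)) :
    EuclideanSpace ℝ (Fin p) :=
  let v : EuclideanSpace ℝ (Fin p) := WithLp.toLp 2 (Matrix.mulVec (invSqrt T) x.ofLp)
  ‖v‖⁻¹ • v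

/-- The equations of Tyler's M-estimator of the sample `x₁, …, xₙ ∈ ℝ^p`: `S` is positive definite,
`S = (p / n) ∑ᵢ xᵢ xᵢᵀ / (xᵢᵀ S⁻¹ xᵢ)`, and `tr S = 1`. -/
structure SolvesTyler {n p : ℕ} (x : Fin n → EuclideanSpace ℝ (Fin p))
    (S : Matrix (Fin p) (Fin p) ℝ) : Prop where
  posDef : S.PosDef
  fixed : S = ((p : ℝ) / n) • ∑ i, (quadForm S⁻¹ (x i))⁻¹ • outer (x i)
  trace_eq : S.trace = 1

/-- `S` is Tyler's M-estimator of the sample `x`: the one and only solution of its equations. -/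
def IsTylerEstimator {n p : ℕ} (x : Fin n → EuclideanSpace ℝ (Fin p))
    (S : Matrix (Fin p) (Fin p) ℝ) : Prop :=
  SolvesTyler x S ∧ ∀ S', SolvesTyler x S' → S' = S

/-- `p T^{-1/2} S T^{-1/2} / tr (T^{-1/2} S T^{-1/2})`. -/
def whitenedNormalized {p : ℕ} (T S : Matrix (Fin p) (Fin p) ℝ) : Matrix (Fin p) (Fin p) ℝ :=
  ((p : ℝ) / (invSqrt T * S * invSqrt T).trace) • (invSqrt T * S * invSqrt T)

end

/-! ### The inverse square root of the shape matrix. -/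

section InvSqrt

open Matrix

variable {p : ℕ} {T : Matrix (Fin p) (Fin p) ℝ}

/-! Tyler's equation is equivariant under linear maps and blind to the lengths of the samples
(`TylerFixed.conj`), so whitening and projecting to the sphere removes both `T` and `g`: the points
y_i may be taken i.i.d. uniform on the sphere. Put γ = p/n, S(w) = γ ∑ w_j y_j y_jᵀ and K(w)_ij =
y_i · S(w)⁻¹ y_j. Solutions are the S(w) with w_i K(w)_ii = 1, that is, w is a fixed point of F(w)_i
= 1/K(w)_ii. If all w_i are within ρ of 1, then S(w) is within a constant times ρ of S(1) in
operator norm.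

By Cauchy–Schwarz, F(w')_i/F(w)_i = K(w)_ii/K(w')_ii is at most the average of w'_j/w_j under the
probability weights γ w_j K(w)_ij²/K(w)_ii. So F does not expand Hilbert's projective metric, and if
these weights give mass at least c to every half of the indices (`Coupled`), the oscillation
contracts strictly (`GramSystem.ratio_mul_ratio_le`). When F(1) oscillates little, F preserves, up
to scaling, a small box near 1. A minimizer there of the oscillation of w/F(w) must have no
oscillation at all (`GramSystem.exists_fixed`). Uniqueness up to a scalar is a maximum principle
(`GramSystem.eq_smul_of_fixed`).

The inputs at w = 1 come from leaving one point out. Sherman–Morrison gives K(1)_ii = q/(1+γq) with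
q = y_i · S_i⁻¹ y_i and S_i independent of y_i. Here q concentrates around tr S_i⁻¹/p, which hardly
depends on i, and the average of K(1)_ii is exactly 1 because tr(S⁻¹S) = p. For the coupling,
∑_{j∈J} (y_i · S_i⁻¹ y_j)² is not small for any J of at least n/3 indices, with failure probability
e^{-2n}, which survives the union over 2^n sets J. Net arguments bound S_i above and below. Tails of
quadratic forms on the sphere reduce to one Gaussian computation: the sign of xᵀQx is scale
invariant, so P(xᵀQx ≥ 0) ≤ det(1-2Q)^{-1/2} (`uniformSphere_quadForm_nonneg_le`). -/

lemma invSqrt_posSemidef : (invSqrt T).PosSemidef := by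
  open scoped MatrixOrder in
  exact (CFC.sqrt_nonneg (T⁻¹)).posSemidef

lemma invSqrt_isHermitian : (invSqrt T).IsHermitian := invSqrt_posSemidef.isHermitian

lemma invSqrt_transpose : (invSqrt T)ᵀ = invSqrt T := by
  have := invSqrt_isHermitian (T := T)
  rwa [Matrix.IsHermitian, conjTranspose_eq_transpose_of_trivial] at this

lemma invSqrt_mul_self (hT : T.PosDef) : invSqrt T * invSqrt T = T⁻¹ := by
  open scoped MatrixOrder in
  exact CFC.sqrt_mul_sqrt_self (T⁻¹) hT.inv.posSemidef.nonneg

lemma invSqrt_det_pos (hT : T.PosDef) : 0 < (invSqrt T).det := by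
  have h0 : 0 ≤ (invSqrt T).det := invSqrt_posSemidef.det_nonneg
  have h1 : (invSqrt T).det * (invSqrt T).det = (T⁻¹).det := by
    rw [← det_mul, invSqrt_mul_self hT]
  have h2 : 0 < (T⁻¹).det := hT.inv.det_pos
  rcases h0.eq_or_lt with h | h
  · rw [← h, zero_mul] at h1; exact absurd h1.symm h2.ne'
  · exact h

lemma abs_inv_invSqrt_det (hT : T.PosDef) : |((invSqrt T).det)⁻¹| = Real.sqrt T.det := by
  have h := invSqrt_det_pos hT
  have h1 : (invSqrt T).det * (invSqrt T).det = (T⁻¹).det := by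
    rw [← det_mul, invSqrt_mul_self hT]
  rw [abs_of_pos (inv_pos.2 h), eq_comm, Real.sqrt_eq_iff_mul_self_eq_of_pos (inv_pos.2 h),
    ← mul_inv, h1, det_nonsing_inv, Ring.inverse_eq_inv', inv_inv]

lemma quadForm_inv_eq_norm_sq (hT : T.PosDef) (x : EuclideanSpace ℝ (Fin p)) :
    quadForm T⁻¹ x = ‖(WithLp.toLp 2 (invSqrt T *ᵥ x.ofLp) : EuclideanSpace ℝ (Fin p))‖ ^ 2 := by
  rw [quadForm, ← invSqrt_mul_self hT, ← mulVec_mulVec, dotProduct_mulVec, ← mulVec_transpose,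
    invSqrt_transpose, EuclideanSpace.real_norm_sq_eq]
  simp [dotProduct, sq]

end InvSqrt

/-! ### Linear change of variables from elliptical to spherical densities. -/

section ChangeOfVariables

variable {p : ℕ}

lemma lintegral_comp_toLp_mulVec {A : Matrix (Fin p) (Fin p) ℝ} (hA : A.det ≠ 0)
    {f : EuclideanSpace ℝ (Fin p) → ENNReal} (hf : Measurable f) :
    ∫⁻ x : EuclideanSpace ℝ (Fin p), f (WithLp.toLp 2 (A.mulVec x.ofLp)) =
      ENNReal.ofReal |A.det⁻¹| * ∫⁻ x, f x := by
  have hdet : LinearMap.det (Matrix.toEuclideanLin A) = A.det := by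
    rw [show Matrix.toEuclideanLin A = Matrix.toLin (PiLp.basisFun 2 ℝ (Fin p))
      (PiLp.basisFun 2 ℝ (Fin p)) A from congrArg (· A) (Matrix.toLpLin_eq_toLin 2 2),
      LinearMap.det_toLin]
  have h := Measure.map_linearMap_addHaar_eq_smul_addHaar
    (volume : Measure (EuclideanSpace ℝ (Fin p))) (f := Matrix.toEuclideanLin A) (by rwa [hdet])
  rw [hdet] at h
  have hm : Measurable (Matrix.toEuclideanLin A) :=
    (LinearMap.continuous_of_finiteDimensional _).measurable
  calc _ = ∫⁻ x, f (Matrix.toEuclideanLin A x) := rfl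
    _ = ∫⁻ x, f x ∂(Measure.map (Matrix.toEuclideanLin A) volume) := (lintegral_map hf hm).symm
    _ = _ := by rw [h, lintegral_smul_measure]; rfl

lemma measurable_toLp_mulVec (A : Matrix (Fin p) (Fin p) ℝ) :
    Measurable fun x : EuclideanSpace ℝ (Fin p) =>
      (WithLp.toLp 2 (A.mulVec x.ofLp) : EuclideanSpace ℝ (Fin p)) :=
  (LinearMap.continuous_of_finiteDimensional (Matrix.toEuclideanLin A)).measurable

/-- The Jacobian of `invSqrt T` cancels the factor det(T)^{-1/2} of the density, so the whitened
vector has the spherical density with the same profile. -/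
lemma lintegral_ellipticalMeasure {T : Matrix (Fin p) (Fin p) ℝ} (hT : T.PosDef) {g : ℝ → ℝ}
    (hg : IsRadialProfile p g) {f : EuclideanSpace ℝ (Fin p) → ENNReal} (hf : Measurable f) :
    ∫⁻ x, f (WithLp.toLp 2 ((invSqrt T).mulVec x.ofLp)) ∂(ellipticalMeasure T g) =
      ∫⁻ x, f x * ENNReal.ofReal (profileConst p g * g (‖x‖ ^ 2)) := by
  have hgm := hg.measurable
  have hA := measurable_toLp_mulVec (invSqrt T)
  have hd : 0 < T.det := hT.det_pos
  have hc : 0 ≤ profileConst p g := inv_nonneg.2 hg.pos.le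
  set G : EuclideanSpace ℝ (Fin p) → ENNReal :=
    fun x => f x * ENNReal.ofReal (profileConst p g * g (‖x‖ ^ 2)) with hG
  have hGm : Measurable G := by fun_prop
  have h1 : ∀ x : EuclideanSpace ℝ (Fin p),
      ENNReal.ofReal (profileConst p g * (Real.sqrt T.det)⁻¹ * g (quadForm T⁻¹ x)) *
        f (WithLp.toLp 2 ((invSqrt T).mulVec x.ofLp)) =
      ENNReal.ofReal (Real.sqrt T.det)⁻¹ * G (WithLp.toLp 2 ((invSqrt T).mulVec x.ofLp)) := by
    intro x
    rw [hG, quadForm_inv_eq_norm_sq hT, mul_right_comm, mul_comm _ (Real.sqrt T.det)⁻¹,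
      ENNReal.ofReal_mul (by positivity)]
    ring
  have hm : Measurable fun x : EuclideanSpace ℝ (Fin p) =>
      ENNReal.ofReal (profileConst p g * (Real.sqrt T.det)⁻¹ * g (quadForm T⁻¹ x)) := by
    simp_rw [quadForm_inv_eq_norm_sq hT]
    fun_prop
  have h2 := lintegral_withDensity_eq_lintegral_mul volume hm (hf.comp hA)
  simp only [Pi.mul_apply, Function.comp_apply, h1] at h2
  refine h2.trans ?_
  rw [lintegral_const_mul (f := fun x : EuclideanSpace ℝ (Fin p) =>
    G (WithLp.toLp 2 ((invSqrt T).mulVec x.ofLp))) _ (hGm.comp hA),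
    lintegral_comp_toLp_mulVec (invSqrt_det_pos hT).ne' hGm,
    abs_inv_invSqrt_det hT, ← mul_assoc, ← ENNReal.ofReal_mul (by positivity), inv_mul_cancel₀
    (by positivity), ENNReal.ofReal_one, one_mul]

end ChangeOfVariables

/-! ### Polar coordinates and uniformity of the directions. -/

section Radial

variable {p : ℕ}

/-- In polar coordinates Lebesgue measure is a product, so the direction is independent of the norm
under any radial density. -/
lemma lintegral_direction_mul_norm (hp : 1 ≤ p) {f : EuclideanSpace ℝ (Fin p) → ENNReal}
    (hf : Measurable f) {h : ℝ → ENNReal} (hh : Measurable h) :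
    ∫⁻ x : EuclideanSpace ℝ (Fin p), f (‖x‖⁻¹ • x) * h ‖x‖ =
      (∫⁻ x, f x ∂(uniformSphere p)) * ∫⁻ x : EuclideanSpace ℝ (Fin p), h ‖x‖ := by
  have : Nonempty (Fin p) := ⟨⟨0, hp⟩⟩
  set σ := (volume : Measure (EuclideanSpace ℝ (Fin p))).toSphere with hσ
  have key : ∀ f : EuclideanSpace ℝ (Fin p) → ENNReal, Measurable f →
      ∫⁻ x : EuclideanSpace ℝ (Fin p), f (‖x‖⁻¹ • x) * h ‖x‖ = (∫⁻ θ, f θ.1 ∂σ) *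
        ∫⁻ r, h r.1 ∂(Measure.volumeIoiPow (Module.finrank ℝ (EuclideanSpace ℝ (Fin p)) - 1)) := by
    intro f hf
    have hmp := (volume : Measure (EuclideanSpace ℝ (Fin p))).measurePreserving_homeomorphUnitSphereProd
    rw [← lintegral_prod_mul (by fun_prop) (by fun_prop), ← hmp.lintegral_comp (by fun_prop)]
    -- The polar homeomorphism lives on the complement of the origin, a set of full measure.
    have h0 : (volume : Measure (EuclideanSpace ℝ (Fin p))).restrict {0}ᶜ = volume := restrict_compl_singleton 0
    conv_lhs => rw [← h0]
    rw [← lintegral_subtype_comap (measurableSet_singleton (0 : EuclideanSpace ℝ (Fin p))).compl]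
    refine lintegral_congr fun x => ?_
    simp
  have hpos : σ Set.univ ≠ 0 := by
    rw [Measure.measure_univ_ne_zero]; exact Measure.toSphere_ne_zero _
  have hfin : σ Set.univ ≠ ⊤ := measure_ne_top _ _
  -- The case f = 1 expresses the radial integral through the total mass of σ, so it never has to be
  -- computed.
  have h1 := key (fun _ => 1) measurable_const
  simp only [one_mul, lintegral_const] at h1
  rw [key f hf, h1, uniformSphere, lintegral_map hf measurable_subtype_coe,
    lintegral_smul_measure, ← hσ]
  simp only [smul_eq_mul]
  rw [mul_comm (σ Set.univ)⁻¹, mul_assoc, ← mul_assoc (σ Set.univ)⁻¹,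
    ENNReal.inv_mul_cancel hpos hfin, one_mul]

lemma isProbabilityMeasure_uniformSphere (hp : 1 ≤ p) :
    IsProbabilityMeasure (uniformSphere p) := by
  have : Nonempty (Fin p) := ⟨⟨0, hp⟩⟩
  constructor
  set σ := (volume : Measure (EuclideanSpace ℝ (Fin p))).toSphere with hσ
  have hpos : σ Set.univ ≠ 0 := by
    rw [Measure.measure_univ_ne_zero]; exact Measure.toSphere_ne_zero _
  have hfin : σ Set.univ ≠ ⊤ := measure_ne_top _ _
  rw [uniformSphere, ← hσ, Measure.map_apply measurable_subtype_coe MeasurableSet.univ,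
    Set.preimage_univ, Measure.smul_apply, smul_eq_mul, ENNReal.inv_mul_cancel hpos hfin]

lemma ae_norm_eq_one_uniformSphere : ∀ᵐ x ∂(uniformSphere p), ‖x‖ = 1 := by
  rw [uniformSphere, ae_map_iff measurable_subtype_coe.aemeasurable
    (measurableSet_eq_fun measurable_norm measurable_const)]
  exact Filter.Eventually.of_forall fun x => norm_eq_of_mem_sphere x

lemma lintegral_profile_eq_one {g : ℝ → ℝ} (hg : IsRadialProfile p g) :
    ∫⁻ x : EuclideanSpace ℝ (Fin p), ENNReal.ofReal (profileConst p g * g (‖x‖ ^ 2)) = 1 := by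
  rw [← ofReal_integral_eq_lintegral_ofReal (hg.integrable.const_mul _), integral_const_mul,
    profileConst, inv_mul_cancel₀ hg.pos.ne', ENNReal.ofReal_one]
  exact Filter.Eventually.of_forall fun x =>
    mul_nonneg (inv_nonneg.2 hg.pos.le) (hg.nonneg _ (by positivity))

lemma lintegral_direction_profile (hp : 1 ≤ p) {g : ℝ → ℝ} (hg : IsRadialProfile p g)
    {f : EuclideanSpace ℝ (Fin p) → ENNReal} (hf : Measurable f) :
    ∫⁻ x : EuclideanSpace ℝ (Fin p),
        f (‖x‖⁻¹ • x) * ENNReal.ofReal (profileConst p g * g (‖x‖ ^ 2)) =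
      ∫⁻ x, f x ∂(uniformSphere p) := by
  have hgm := hg.measurable
  rw [lintegral_direction_mul_norm hp hf
    (h := fun r => ENNReal.ofReal (profileConst p g * g (r ^ 2))) (by fun_prop),
    lintegral_profile_eq_one hg, mul_one]

lemma measurable_whitenedDirection (T : Matrix (Fin p) (Fin p) ℝ) :
    Measurable (whitenedDirection T) := by
  have hA := measurable_toLp_mulVec (invSqrt T)
  unfold whitenedDirection
  exact (hA.norm.inv).smul hA

lemma hasLaw_whitenedDirection (hp : 1 ≤ p) {T : Matrix (Fin p) (Fin p) ℝ} (hT : T.PosDef)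
    {g : ℝ → ℝ} (hg : IsRadialProfile p g) :
    HasLaw (whitenedDirection T) (uniformSphere p) (ellipticalMeasure T g) := by
  refine ⟨(measurable_whitenedDirection T).aemeasurable, ?_⟩
  ext s hs
  rw [← lintegral_indicator_one hs, ← lintegral_indicator_one hs,
    lintegral_map (measurable_one.indicator hs) (measurable_whitenedDirection T),
    ← lintegral_direction_profile hp hg (measurable_one.indicator hs),
    ← lintegral_ellipticalMeasure hT hg (f := fun x => s.indicator 1 (‖x‖⁻¹ • x))]
  · rfl
  · exact (measurable_one.indicator hs).comp (measurable_norm.inv.smul measurable_id)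

end Radial

/-! ### Lower bounds on determinants through the trace. -/

section DetBounds

open Matrix

variable {p : ℕ} {K : Matrix (Fin p) (Fin p) ℝ}

lemma exists_dotProduct_mulVec_eq_eigenvalue (hK : K.IsHermitian) (i : Fin p) :
    ∃ v : Fin p → ℝ, v ⬝ᵥ v = 1 ∧ v ⬝ᵥ K *ᵥ v = hK.eigenvalues i := by
  refine ⟨(hK.eigenvectorBasis i).ofLp, ?_, ?_⟩
  · have h : ‖hK.eigenvectorBasis i‖ ^ 2 = 1 := by
      rw [hK.eigenvectorBasis.orthonormal.1 i, one_pow]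
    rw [EuclideanSpace.real_norm_sq_eq] at h
    simpa [dotProduct, sq] using h
  · have := hK.eigenvalues_eq i
    simpa using this.symm

lemma posDef_of_dotProduct_ge (hK : K.IsHermitian) {a : ℝ} (ha : 0 < a)
    (h : ∀ v : Fin p → ℝ, a * (v ⬝ᵥ v) ≤ v ⬝ᵥ K *ᵥ v) : K.PosDef := by
  refine PosDef.of_dotProduct_mulVec_pos hK fun {v} hv => ?_
  have h1 : 0 < v ⬝ᵥ v := by
    have := (dotProduct_star_self_pos_iff (v := v)).2 hv
    simpa using this
  exact lt_of_lt_of_le (by positivity) (h v)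

/-- Used with f an affine minorant of the logarithm on the spectrum: the sum then depends only on
the trace. -/
lemma exp_sum_le_det (hK : K.IsHermitian) {f : ℝ → ℝ}
    (hf : ∀ i, Real.exp (f (hK.eigenvalues i)) ≤ hK.eigenvalues i) :
    Real.exp (∑ i, f (hK.eigenvalues i)) ≤ K.det := by
  rw [hK.det_eq_prod_eigenvalues, Real.exp_sum]
  exact Finset.prod_le_prod (fun _ _ => (Real.exp_pos _).le) fun i _ => hf i

lemma sum_eigenvalues (hK : K.IsHermitian) : ∑ i, hK.eigenvalues i = K.trace := by
  rw [hK.trace_eq_sum_eigenvalues]; rfl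

/-- For |x - 1| ≤ β ≤ 1/2 one has log x ≥ 1 - 1/x ≥ x - 1 - 2β²; sum over the eigenvalues. -/
lemma exp_le_det_of_near_one (hK : K.IsHermitian) {β : ℝ} (hβ : β ≤ 1 / 2)
    (h : ∀ v : Fin p → ℝ, |v ⬝ᵥ K *ᵥ v - v ⬝ᵥ v| ≤ β * (v ⬝ᵥ v)) :
    Real.exp (K.trace - p - 2 * p * β ^ 2) ≤ K.det := by
  have hev : ∀ i, |hK.eigenvalues i - 1| ≤ β := fun i => by
    obtain ⟨v, hv, hv'⟩ := exists_dotProduct_mulVec_eq_eigenvalue hK i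
    simpa [hv, hv'] using h v
  refine le_trans (Real.exp_le_exp.2 ?_) (exp_sum_le_det hK (f := fun x => x - 1 - 2 * β ^ 2) ?_)
  · rw [Finset.sum_sub_distrib, Finset.sum_sub_distrib, sum_eigenvalues]
    simp
    apply le_of_eq; ring
  · intro i
    set x := hK.eigenvalues i
    have hx := abs_le.1 (hev i)
    have hx0 : 0 < x := by linarith
    rw [← Real.le_log_iff_exp_le hx0]
    refine le_trans ?_ (Real.one_sub_inv_le_log_of_pos hx0)
    have h2 : 1 - x⁻¹ = x - 1 - (x - 1) ^ 2 * x⁻¹ := by field_simp; ring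
    have h3 : x⁻¹ ≤ 2 := by
      rw [inv_le_comm₀ hx0 (by norm_num)]; linarith
    have h4 : (x - 1) ^ 2 ≤ β ^ 2 := sq_le_sq' hx.1 hx.2
    have h5 : (x - 1) ^ 2 * x⁻¹ ≤ β ^ 2 * 2 :=
      mul_le_mul h4 h3 (inv_pos.2 hx0).le (sq_nonneg _)
    rw [h2]; linarith

/-- By concavity, log lies above its chord on [1/2, 1/2 + l]. Unlike the quadratic bound near 1,
this stays useful for large l. -/
lemma exp_le_det_of_ge_half (hK : K.IsHermitian) {l : ℝ} (hl : 0 < l)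
    (h : ∀ v : Fin p → ℝ, 1 / 2 * (v ⬝ᵥ v) ≤ v ⬝ᵥ K *ᵥ v)
    (h' : ∀ v : Fin p → ℝ, v ⬝ᵥ K *ᵥ v ≤ (1 / 2 + l) * (v ⬝ᵥ v)) :
    Real.exp (- p * Real.log 2 + (K.trace - p / 2) / l * Real.log (1 + 2 * l)) ≤ K.det := by
  refine le_trans (Real.exp_le_exp.2 ?_) (exp_sum_le_det hK
    (f := fun x => - Real.log 2 + (x - 1 / 2) / l * Real.log (1 + 2 * l)) ?_)
  · rw [Finset.sum_add_distrib, ← Finset.sum_mul, ← Finset.sum_div, Finset.sum_sub_distrib,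
      sum_eigenvalues]
    simp
    apply le_of_eq; ring
  · intro i
    obtain ⟨v, hv, hv'⟩ := exists_dotProduct_mulVec_eq_eigenvalue hK i
    have h1 := h v
    have h2 := h' v
    rw [hv, hv'] at h1 h2
    set x := hK.eigenvalues i
    -- Bernoulli's inequality with exponent (x - 1/2)/l in [0, 1] is the chord bound in exponential
    -- form.
    have hb := rpow_one_add_le_one_add_mul_self (s := 2 * l) (by linarith)
      (p := (x - 1 / 2) / l) (div_nonneg (by linarith) hl.le) (by rw [div_le_one hl]; linarith)
    rw [Real.rpow_def_of_pos (by linarith)] at hb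
    have h3 : 1 + (x - 1 / 2) / l * (2 * l) = 2 * x := by field_simp; ring
    rw [h3] at hb
    rw [Real.exp_add, Real.exp_neg, Real.exp_log (by norm_num), mul_comm ((x - 1 / 2) / l)]
    linarith

lemma det_one_add_smul_vecMulVec (c : ℝ) (u : Fin p → ℝ) :
    (1 + c • vecMulVec u u).det = 1 + c * (u ⬝ᵥ u) := by
  have := det_one_add_replicateCol_mul_replicateRow (ι := Unit) (c • u) u
  rw [← vecMulVec_eq, smul_vecMulVec, dotProduct_smul, smul_eq_mul] at this
  exact this

end DetBounds

/-! ### Gaussian exponential moments and their transfer to the sphere. -/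

section GaussianProfile

open Matrix

variable {p : ℕ}

lemma isRadialProfile_gaussian (p : ℕ) : IsRadialProfile p fun t => Real.exp (-t / 2) := by
  have hint : Integrable (fun x : EuclideanSpace ℝ (Fin p) => Real.exp (-‖x‖ ^ 2 / 2)) := by
    have h := (GaussianFourier.integrable_cexp_neg_mul_sq_norm_add (V := EuclideanSpace ℝ (Fin p))
      (b := 1 / 2) (by norm_num) 0 0).re
    refine h.congr (Filter.Eventually.of_forall fun x => ?_)
    have : (-(1 / 2 : ℂ) * (‖x‖ : ℂ) ^ 2 + 0 * ((inner ℝ (0 : EuclideanSpace ℝ (Fin p)) x : ℝ) : ℂ))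
      = ((-‖x‖ ^ 2 / 2 : ℝ) : ℂ) := by push_cast; ring
    simp only [this]
    exact Complex.exp_ofReal_re _
  exact ⟨by fun_prop, fun _ _ => (Real.exp_pos _).le, hint, integral_exp_pos hint⟩

/-- The density of the standard Gaussian distribution on `ℝ^p`. -/
noncomputable def gaussDensity (p : ℕ) (x : EuclideanSpace ℝ (Fin p)) : ENNReal :=
  ENNReal.ofReal (profileConst p (fun t => Real.exp (-t / 2)) * Real.exp (-‖x‖ ^ 2 / 2))

lemma measurable_gaussDensity : Measurable (gaussDensity p) := by
  unfold gaussDensity; fun_prop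

lemma norm_sq_eq_dotProduct (x : EuclideanSpace ℝ (Fin p)) : ‖x‖ ^ 2 = x.ofLp ⬝ᵥ x.ofLp := by
  rw [EuclideanSpace.real_norm_sq_eq]; simp [dotProduct, sq]

lemma lintegral_uniformSphere_eq_gaussian (hp : 1 ≤ p) {f : EuclideanSpace ℝ (Fin p) → ENNReal}
    (hf : Measurable f) :
    ∫⁻ x, f x ∂(uniformSphere p) =
      ∫⁻ x : EuclideanSpace ℝ (Fin p), f (‖x‖⁻¹ • x) * gaussDensity p x :=
  (lintegral_direction_profile hp (isRadialProfile_gaussian p) hf).symm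

/-- The weighted density is an unnormalized Gaussian with precision matrix K = 1 - 2Q; the change of
variables by K^{1/2}, written `invSqrt K⁻¹`, makes it standard. -/
lemma lintegral_exp_quadForm_gaussian {Q : Matrix (Fin p) (Fin p) ℝ}
    (hQ : (1 - (2 : ℝ) • Q).PosDef) :
    ∫⁻ x : EuclideanSpace ℝ (Fin p), ENNReal.ofReal (Real.exp (quadForm Q x)) * gaussDensity p x =
      ENNReal.ofReal (Real.sqrt (1 - (2 : ℝ) • Q).det)⁻¹ := by
  set K := 1 - (2 : ℝ) • Q with hK
  have hKi : (K⁻¹)⁻¹ = K := nonsing_inv_nonsing_inv _ (isUnit_iff_ne_zero.2 hQ.det_pos.ne')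
  have hT : (K⁻¹).PosDef := hQ.inv
  have h1 : ∀ x : EuclideanSpace ℝ (Fin p),
      ENNReal.ofReal (Real.exp (quadForm Q x)) * gaussDensity p x =
        gaussDensity p (WithLp.toLp 2 ((invSqrt K⁻¹).mulVec x.ofLp)) := by
    intro x
    have h2 := quadForm_inv_eq_norm_sq hT x
    rw [hKi] at h2
    rw [gaussDensity, gaussDensity, ← ENNReal.ofReal_mul (Real.exp_pos _).le, ← h2,
      mul_left_comm, ← Real.exp_add]
    congr 3
    rw [norm_sq_eq_dotProduct, quadForm, quadForm, hK, sub_mulVec, dotProduct_sub, one_mulVec,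
      smul_mulVec, dotProduct_smul, smul_eq_mul]
    ring
  simp_rw [h1]
  rw [lintegral_comp_toLp_mulVec (invSqrt_det_pos hT).ne' measurable_gaussDensity,
    abs_inv_invSqrt_det hT]
  have : ∫⁻ x, gaussDensity p x = 1 := lintegral_profile_eq_one (isRadialProfile_gaussian p)
  rw [this, mul_one, det_nonsing_inv, Ring.inverse_eq_inv', Real.sqrt_inv]

lemma measurable_quadForm (Q : Matrix (Fin p) (Fin p) ℝ) : Measurable (quadForm Q) := by
  have h := measurable_toLp_mulVec Q
  unfold quadForm dotProduct mulVec dotProduct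
  fun_prop

lemma quadForm_smul_vec (Q : Matrix (Fin p) (Fin p) ℝ) (c : ℝ) (x : EuclideanSpace ℝ (Fin p)) :
    quadForm Q (c • x) = c ^ 2 * quadForm Q x := by
  simp [quadForm, mulVec_smul]; ring

/-- The event is invariant under scaling, so a standard Gaussian vector can replace the uniform
direction; then the indicator of xᵀQx ≥ 0 is at most exp(xᵀQx). -/
lemma uniformSphere_quadForm_nonneg_le (hp : 1 ≤ p) {Q : Matrix (Fin p) (Fin p) ℝ}
    (hQ : (1 - (2 : ℝ) • Q).PosDef) :
    uniformSphere p {x | 0 ≤ quadForm Q x} ≤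
      ENNReal.ofReal (Real.sqrt (1 - (2 : ℝ) • Q).det)⁻¹ := by
  have hm : MeasurableSet {x | 0 ≤ quadForm Q x} :=
    measurableSet_le measurable_const (measurable_quadForm Q)
  rw [← lintegral_indicator_one hm,
    lintegral_uniformSphere_eq_gaussian hp (measurable_one.indicator hm),
    ← lintegral_exp_quadForm_gaussian hQ]
  refine lintegral_mono_ae ?_
  have h0 : ∀ᵐ x : EuclideanSpace ℝ (Fin p), x ≠ 0 := by
    have : Nonempty (Fin p) := ⟨⟨0, hp⟩⟩
    exact Measure.ae_ne volume 0
  filter_upwards [h0] with x hx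
  gcongr
  by_cases h : ‖x‖⁻¹ • x ∈ {x | 0 ≤ quadForm Q x}
  · rw [Set.indicator_of_mem h]
    have h3 : 0 ≤ quadForm Q x := by
      rw [Set.mem_ofPred_eq, quadForm_smul_vec] at h
      have : 0 < ‖x‖⁻¹ ^ 2 := by have := norm_pos_iff.2 hx; positivity
      exact nonneg_of_mul_nonneg_right h this
    simpa using h3
  · rw [Set.indicator_of_notMem h]; exact zero_le

end GaussianProfile

/-! ### Tail bounds and exponential moments on the sphere. -/

section SphereTails

open Matrix

variable {p : ℕ}

/-- On the unit sphere the constant τ equals τ xᵀx, so the event is a sign condition on Q = s(A -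
τ), and a Chernoff bound with parameter s follows. -/
lemma uniformSphere_quadForm_ge_le (hp : 1 ≤ p) {A : Matrix (Fin p) (Fin p) ℝ}
    (hA : A.IsHermitian) {C ε : ℝ} (hC : 0 < C) (hε : 0 < ε) (hεC : ε ≤ C)
    (h : ∀ v : Fin p → ℝ, |v ⬝ᵥ A *ᵥ v| ≤ C * (v ⬝ᵥ v)) :
    uniformSphere p {x | A.trace / p + ε ≤ quadForm A x} ≤
      ENNReal.ofReal (Real.exp (-(ε ^ 2 * p / (144 * C ^ 2)))) := by
  have hp0 : (0 : ℝ) < p := by exact_mod_cast hp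
  set τ := A.trace / p + ε with hτ
  -- With β = 6sC the exponent of the determinant is p(2sε - 2β²) = p(2sε - 72 s²C²), maximal at
  -- this s.
  set s := ε / (72 * C ^ 2) with hs
  have hs0 : 0 < s := by positivity
  set Q : Matrix (Fin p) (Fin p) ℝ := s • (A - τ • 1) with hQ
  set K := 1 - (2 : ℝ) • Q with hK
  have hvv : ∀ v : Fin p → ℝ, 0 ≤ v ⬝ᵥ v := fun v => by
    have := dotProduct_star_self_nonneg v; simpa using this
  have htr : |A.trace / p| ≤ C := by
    rw [abs_div, abs_of_pos hp0, div_le_iff₀ hp0, ← sum_eigenvalues hA]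
    refine (Finset.abs_sum_le_sum_abs _ _).trans ?_
    calc _ ≤ ∑ i : Fin p, C := Finset.sum_le_sum fun i _ => by
            obtain ⟨v, hv, hv'⟩ := exists_dotProduct_mulVec_eq_eigenvalue hA i
            simpa [hv, hv'] using h v
      _ = _ := by simp [mul_comm]
  have hτC : |τ| ≤ 2 * C := (abs_add_le _ _).trans (by rw [abs_of_pos hε]; linarith)
  have hKf : ∀ v : Fin p → ℝ, v ⬝ᵥ K *ᵥ v - v ⬝ᵥ v =
      -(2 * s) * (v ⬝ᵥ A *ᵥ v - τ * (v ⬝ᵥ v)) := by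
    intro v
    simp only [hK, hQ, sub_mulVec, dotProduct_sub, one_mulVec, smul_mulVec, dotProduct_smul,
      smul_eq_mul]
    ring
  have hKb : ∀ v : Fin p → ℝ, |v ⬝ᵥ K *ᵥ v - v ⬝ᵥ v| ≤ (6 * s * C) * (v ⬝ᵥ v) := by
    intro v
    rw [hKf, abs_mul, abs_neg, abs_of_pos (by positivity : 0 < 2 * s)]
    have h1 : |v ⬝ᵥ A *ᵥ v - τ * (v ⬝ᵥ v)| ≤ 3 * C * (v ⬝ᵥ v) := by
      refine (abs_sub _ _).trans ?_
      rw [abs_mul, abs_of_nonneg (hvv v)]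
      nlinarith [h v, hvv v, mul_le_mul_of_nonneg_right hτC (hvv v)]
    nlinarith
  have hβ : 6 * s * C ≤ 1 / 2 := by
    rw [hs]
    have : 6 * (ε / (72 * C ^ 2)) * C = ε / C / 12 := by field_simp; norm_num
    rw [this]
    have : ε / C ≤ 1 := (div_le_one hC).2 hεC
    linarith
  have hKH : K.IsHermitian := by
    refine isHermitian_one.sub ?_
    have h1 : (A - τ • 1).IsHermitian :=
      hA.sub (by simp [IsHermitian])
    simp only [IsHermitian, hQ, conjTranspose_smul, h1.eq]
    simp
  have hKP : K.PosDef := posDef_of_dotProduct_ge hKH (a := 1 / 2) (by norm_num) fun v => by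
    have h1 := (abs_le.1 (hKb v)).1
    nlinarith [hvv v, mul_le_mul_of_nonneg_right hβ (hvv v)]
  have hdet := exp_le_det_of_near_one hKH hβ hKb
  have htrK : K.trace - p - 2 * p * (6 * s * C) ^ 2 = 2 * (ε ^ 2 * p / (144 * C ^ 2)) := by
    have h1 : K.trace = p + 2 * s * ε * p := by
      simp only [hK, hQ, trace_sub, trace_smul, trace_one, smul_eq_mul, Fintype.card_fin, hτ]
      field_simp
      ring
    rw [h1, hs]; field_simp; ring
  rw [htrK] at hdet
  have hsub : {x : EuclideanSpace ℝ (Fin p) | τ ≤ quadForm A x} =ᵐ[uniformSphere p]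
      {x | 0 ≤ quadForm Q x} := by
    filter_upwards [ae_norm_eq_one_uniformSphere (p := p)] with x hx
    have h1 : quadForm Q x = s * (quadForm A x - τ) := by
      have h2 : x.ofLp ⬝ᵥ x.ofLp = 1 := by rw [← norm_sq_eq_dotProduct, hx, one_pow]
      simp only [quadForm, hQ, sub_mulVec, dotProduct_sub, one_mulVec, smul_mulVec,
        dotProduct_smul, smul_eq_mul, h2, mul_one]
    refine propext ?_
    change τ ≤ quadForm A x ↔ 0 ≤ quadForm Q x
    rw [h1, mul_nonneg_iff_of_pos_left hs0, sub_nonneg]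
  rw [measure_congr hsub]
  refine (uniformSphere_quadForm_nonneg_le hp hKP).trans (ENNReal.ofReal_le_ofReal ?_)
  rw [Real.exp_neg]
  refine inv_anti₀ (Real.exp_pos _) (Real.le_sqrt_of_sq_le ?_)
  rwa [sq, ← Real.exp_add, ← two_mul]

lemma uniformSphere_abs_quadForm_sub_ge_le (hp : 1 ≤ p) {A : Matrix (Fin p) (Fin p) ℝ}
    (hA : A.IsHermitian) {C ε : ℝ} (hC : 0 < C) (hε : 0 < ε) (hεC : ε ≤ C)
    (h : ∀ v : Fin p → ℝ, |v ⬝ᵥ A *ᵥ v| ≤ C * (v ⬝ᵥ v)) :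
    uniformSphere p {x | ε ≤ |quadForm A x - A.trace / p|} ≤
      2 * ENNReal.ofReal (Real.exp (-(ε ^ 2 * p / (144 * C ^ 2)))) := by
  have h1 := uniformSphere_quadForm_ge_le hp hA hC hε hεC h
  have h2 := uniformSphere_quadForm_ge_le hp hA.neg hC hε hεC (fun v => by
    simpa [neg_mulVec] using h v)
  refine (measure_mono ?_).trans ((measure_union_le _ _).trans
    ((add_le_add h1 h2).trans_eq (two_mul _).symm))
  intro x hx
  have hx' : ε ≤ |quadForm A x - A.trace / p| := hx
  rcases le_abs.1 hx' with h3 | h3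
  · left
    change A.trace / p + ε ≤ quadForm A x
    linarith
  · right
    have h4 : quadForm (-A) x = - quadForm A x := by simp [quadForm, neg_mulVec]
    change (-A).trace / p + ε ≤ quadForm (-A) x
    rw [h4, trace_neg, neg_div]
    linarith

/-- A small-ball estimate: as t tends to 0 the logarithm makes the rate as large as desired (for b >
0), which later pays for a union over all subsets of indices. -/
lemma uniformSphere_quadForm_le_le (hp : 1 ≤ p) {B : Matrix (Fin p) (Fin p) ℝ}
    (hB : B.IsHermitian) {C b t : ℝ} (hC : 0 < C) (ht : 0 < t)
    (h0 : ∀ v : Fin p → ℝ, 0 ≤ v ⬝ᵥ B *ᵥ v)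
    (h : ∀ v : Fin p → ℝ, v ⬝ᵥ B *ᵥ v ≤ C * (v ⬝ᵥ v)) (hb : b * p ≤ B.trace) :
    uniformSphere p {x | quadForm B x ≤ t} ≤
      ENNReal.ofReal (Real.exp (-(p / 2 * (b / C * Real.log (1 + C / t) - Real.log 2)))) := by
  have hp0 : (0 : ℝ) < p := by exact_mod_cast hp
  -- This makes K = 1/2 + 2sB, bounded below by 1/2 however small t is.
  set s := 1 / (4 * t) with hs
  have hs0 : 0 < s := by positivity
  set Q : Matrix (Fin p) (Fin p) ℝ := s • (t • 1 - B) with hQ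
  set K := 1 - (2 : ℝ) • Q with hK
  have hst : s * t = 1 / 4 := by rw [hs]; field_simp
  have hKf : ∀ v : Fin p → ℝ, v ⬝ᵥ K *ᵥ v = 1 / 2 * (v ⬝ᵥ v) + 2 * s * (v ⬝ᵥ B *ᵥ v) := by
    intro v
    simp only [hK, hQ, sub_mulVec, dotProduct_sub, one_mulVec, smul_mulVec, dotProduct_smul,
      smul_eq_mul]
    linear_combination (-2 * (v ⬝ᵥ v)) * hst
  have hKH : K.IsHermitian := by
    refine isHermitian_one.sub ?_
    have h1 : (t • 1 - B).IsHermitian :=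
      IsHermitian.sub (by simp [IsHermitian]) hB
    simp only [IsHermitian, hQ, conjTranspose_smul, h1.eq]
    simp
  have hlow : ∀ v : Fin p → ℝ, 1 / 2 * (v ⬝ᵥ v) ≤ v ⬝ᵥ K *ᵥ v := fun v => by
    rw [hKf]
    have := mul_nonneg (mul_nonneg zero_le_two hs0.le) (h0 v)
    linarith
  have hKP : K.PosDef := posDef_of_dotProduct_ge hKH (a := 1 / 2) (by norm_num) hlow
  have hdet := exp_le_det_of_ge_half hKH (l := 2 * s * C) (by positivity) hlow fun v => by
    rw [hKf]
    have := mul_le_mul_of_nonneg_left (h v) (by positivity : 0 ≤ 2 * s)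
    linarith
  have htrK : K.trace = p / 2 + 2 * s * B.trace := by
    simp only [hK, hQ, trace_sub, trace_smul, trace_one, smul_eq_mul, Fintype.card_fin]
    linear_combination (-2 * (p : ℝ)) * hst
  have hl : 1 + 2 * (2 * s * C) = 1 + C / t := by rw [hs]; field_simp; ring
  have hlog : 0 ≤ Real.log (1 + C / t) := Real.log_nonneg (by
    have : 0 < C / t := by positivity
    linarith)
  have hexp : p * (b / C * Real.log (1 + C / t) - Real.log 2) ≤
      - p * Real.log 2 + (K.trace - p / 2) / (2 * s * C) * Real.log (1 + 2 * (2 * s * C)) := by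
    rw [hl, htrK]
    have h1 : (p / 2 + 2 * s * B.trace - p / 2) / (2 * s * C) = B.trace / C := by
      field_simp; ring
    rw [h1]
    have h2 : b * p / C * Real.log (1 + C / t) ≤ B.trace / C * Real.log (1 + C / t) := by gcongr
    have h3 : b * p / C = p * (b / C) := by ring
    rw [h3] at h2
    linarith
  have hdet' := (Real.exp_le_exp.2 hexp).trans hdet
  have hsub : {x : EuclideanSpace ℝ (Fin p) | quadForm B x ≤ t} =ᵐ[uniformSphere p]
      {x | 0 ≤ quadForm Q x} := by
    filter_upwards [ae_norm_eq_one_uniformSphere (p := p)] with x hx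
    have h1 : quadForm Q x = s * (t - quadForm B x) := by
      have h2 : x.ofLp ⬝ᵥ x.ofLp = 1 := by rw [← norm_sq_eq_dotProduct, hx, one_pow]
      simp only [quadForm, hQ, sub_mulVec, dotProduct_sub, one_mulVec, smul_mulVec,
        dotProduct_smul, smul_eq_mul, h2, mul_one]
    refine propext ?_
    change quadForm B x ≤ t ↔ 0 ≤ quadForm Q x
    rw [h1, mul_nonneg_iff_of_pos_left hs0, sub_nonneg]
  rw [measure_congr hsub]
  refine (uniformSphere_quadForm_nonneg_le hp hKP).trans (ENNReal.ofReal_le_ofReal ?_)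
  rw [Real.exp_neg]
  refine inv_anti₀ (Real.exp_pos _) (Real.le_sqrt_of_sq_le ?_)
  rw [sq, ← Real.exp_add]
  refine le_trans (le_of_eq ?_) hdet'
  ring_nf

lemma dotProduct_self_nonneg' {ι : Type*} [Fintype ι] (v : ι → ℝ) : 0 ≤ v ⬝ᵥ v := by
  have := dotProduct_star_self_nonneg v; simpa using this

lemma quadForm_smul_vecMulVec (c : ℝ) (u : Fin p → ℝ) (x : EuclideanSpace ℝ (Fin p)) :
    quadForm (c • vecMulVec u u) x = c * (u ⬝ᵥ x.ofLp) ^ 2 := by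
  simp only [quadForm, smul_mulVec, vecMulVec_mulVec, dotProduct_smul, smul_eq_mul]
  rw [op_smul_eq_smul, dotProduct_comm x.ofLp u, smul_eq_mul]
  ring

lemma quadForm_smul_one (c : ℝ) (x : EuclideanSpace ℝ (Fin p)) :
    quadForm (c • (1 : Matrix (Fin p) (Fin p) ℝ)) x = c * ‖x‖ ^ 2 := by
  simp [quadForm, smul_mulVec, norm_sq_eq_dotProduct]

lemma lintegral_exp_sq_dotProduct_gaussian {u : Fin p → ℝ} (hu : u ⬝ᵥ u = 1) {c : ℝ}
    (hc : 2 * c < 1) :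
    ∫⁻ x : EuclideanSpace ℝ (Fin p), ENNReal.ofReal (Real.exp (c * (u ⬝ᵥ x.ofLp) ^ 2)) *
      gaussDensity p x = ENNReal.ofReal (Real.sqrt (1 - 2 * c))⁻¹ := by
  have hK : 1 - (2 : ℝ) • (c • vecMulVec u u) = 1 + (-(2 * c)) • vecMulVec u u := by
    rw [smul_smul, neg_smul, sub_eq_add_neg]
  have hdet : (1 - (2 : ℝ) • (c • vecMulVec u u)).det = 1 - 2 * c := by
    rw [hK, det_one_add_smul_vecMulVec, hu]; ring
  have hH : (1 - (2 : ℝ) • (c • vecMulVec u u)).IsHermitian := by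
    rw [hK]
    refine isHermitian_one.add ?_
    simp [IsHermitian]
  have hpd : (1 - (2 : ℝ) • (c • vecMulVec u u)).PosDef := by
    refine posDef_of_dotProduct_ge hH (a := min 1 (1 - 2 * c)) (by
      exact lt_min one_pos (by linarith)) fun v => ?_
    have h1 : v ⬝ᵥ (1 - (2 : ℝ) • (c • vecMulVec u u)) *ᵥ v = v ⬝ᵥ v - 2 * c * (u ⬝ᵥ v) ^ 2 := by
      have := quadForm_smul_vecMulVec c u (WithLp.toLp 2 v)
      simp only [quadForm] at this
      rw [sub_mulVec, dotProduct_sub, one_mulVec, smul_mulVec (2 : ℝ), dotProduct_smul, this,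
        smul_eq_mul]
      ring
    have hvv := dotProduct_self_nonneg' v
    have hcs : (u ⬝ᵥ v) ^ 2 ≤ v ⬝ᵥ v := by
      have := Finset.sum_mul_sq_le_sq_mul_sq Finset.univ u v
      simp only [dotProduct] at hu ⊢
      simp only [← sq] at hu ⊢
      rwa [hu, one_mul] at this
    rw [h1]
    rcases le_or_gt c 0 with h | h
    · rw [min_eq_left (by linarith)]
      nlinarith [sq_nonneg (u ⬝ᵥ v)]
    · rw [min_eq_right (by linarith)]
      nlinarith
  have := lintegral_exp_quadForm_gaussian hpd
  simp_rw [quadForm_smul_vecMulVec] at this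
  rw [this, hdet]

lemma lintegral_exp_norm_sq_gaussian {c : ℝ} (hc : 2 * c < 1) :
    ∫⁻ x : EuclideanSpace ℝ (Fin p), ENNReal.ofReal (Real.exp (c * ‖x‖ ^ 2)) *
      gaussDensity p x = ENNReal.ofReal (Real.sqrt ((1 - 2 * c) ^ p))⁻¹ := by
  have hK : 1 - (2 : ℝ) • (c • (1 : Matrix (Fin p) (Fin p) ℝ)) = (1 - 2 * c) • 1 := by
    rw [smul_smul, sub_smul, one_smul]
  have hpd : (1 - (2 : ℝ) • (c • (1 : Matrix (Fin p) (Fin p) ℝ))).PosDef := by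
    rw [hK]; exact PosDef.one.smul (by linarith)
  have := lintegral_exp_quadForm_gaussian hpd
  simp_rw [quadForm_smul_one] at this
  rw [this, hK, det_smul, det_one, mul_one, Fintype.card_fin]

lemma inv_sqrt_half_pow_le (p : ℕ) :
    (Real.sqrt ((1 - 2 * (1 / 4 : ℝ)) ^ p))⁻¹ ≤ Real.exp (2 / 5 * p) := by
  rw [inv_le_comm₀ (by positivity) (Real.exp_pos _), ← Real.exp_neg]
  refine Real.le_sqrt_of_sq_le ?_
  rw [← Real.exp_nat_mul, mul_comm, show (-(2 / 5 * (p : ℝ))) * (2 : ℕ) = p * (-(4 / 5)) by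
    push_cast; ring, Real.exp_nat_mul]
  refine pow_le_pow_left₀ (Real.exp_pos _).le ?_ p
  rw [← Real.le_log_iff_exp_le (by norm_num)]
  have : Real.log (1 - 2 * (1 / 4)) = - Real.log 2 := by
    rw [← Real.log_inv]; norm_num
  rw [this]
  linarith [Real.log_two_lt_d9]

lemma measurable_dotProduct_ofLp (u : Fin p → ℝ) :
    Measurable fun x : EuclideanSpace ℝ (Fin p) => u ⬝ᵥ x.ofLp := by
  unfold dotProduct; fun_prop

lemma dotProduct_direction (u : Fin p → ℝ) (x : EuclideanSpace ℝ (Fin p)) :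
    ‖x‖ ^ 2 * (u ⬝ᵥ (‖x‖⁻¹ • x).ofLp) ^ 2 = (u ⬝ᵥ x.ofLp) ^ 2 := by
  rcases eq_or_ne x 0 with rfl | hx
  · simp
  · have : ‖x‖ ≠ 0 := norm_ne_zero_iff.2 hx
    simp only [WithLp.ofLp_smul, dotProduct_smul, smul_eq_mul]
    field_simp

/-- Compare with a Gaussian x. If ‖x‖² ≤ 2p, then p(u·x/‖x‖)² ≥ (u·x)²/2. Otherwise exp(‖x‖²/4 -
p/2) ≥ 1, and its Gaussian mean 2^{p/2} e^{-p/2} is at most e^{-p/10}. -/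
lemma lintegral_exp_neg_sq_dotProduct_le (hp : 1 ≤ p) {u : Fin p → ℝ} (hu : u ⬝ᵥ u = 1) {s : ℝ}
    (hs : 0 ≤ s) :
    ∫⁻ x, ENNReal.ofReal (Real.exp (-s * (p * (u ⬝ᵥ x.ofLp) ^ 2))) ∂(uniformSphere p) ≤
      ENNReal.ofReal ((Real.sqrt (1 + s))⁻¹ + Real.exp (-p / 10)) := by
  have hu' := measurable_dotProduct_ofLp u
  have hg := measurable_gaussDensity (p := p)
  rw [lintegral_uniformSphere_eq_gaussian hp (by fun_prop)]
  have hpt : ∀ x : EuclideanSpace ℝ (Fin p),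
      ENNReal.ofReal (Real.exp (-s * (p * (u ⬝ᵥ (‖x‖⁻¹ • x).ofLp) ^ 2))) * gaussDensity p x ≤
      ENNReal.ofReal (Real.exp (-(s / 2) * (u ⬝ᵥ x.ofLp) ^ 2)) * gaussDensity p x +
      ENNReal.ofReal (Real.exp (-p / 2)) *
        (ENNReal.ofReal (Real.exp (1 / 4 * ‖x‖ ^ 2)) * gaussDensity p x) := by
    intro x
    rw [← mul_assoc (ENNReal.ofReal _), ← add_mul, ← ENNReal.ofReal_mul (Real.exp_pos _).le, ← Real.exp_add,
      ← ENNReal.ofReal_add (Real.exp_pos _).le (Real.exp_pos _).le]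
    gcongr
    have h1 := dotProduct_direction u x
    have h2 := sq_nonneg (u ⬝ᵥ (‖x‖⁻¹ • x).ofLp)
    rcases le_or_gt (‖x‖ ^ 2) (2 * p) with h | h
    · refine le_add_of_le_of_nonneg (Real.exp_le_exp.2 ?_) (Real.exp_pos _).le
      rw [← h1]
      nlinarith [mul_nonneg hs (mul_nonneg (sub_nonneg.2 h) h2)]
    · refine le_add_of_nonneg_of_le (Real.exp_pos _).le (Real.exp_le_exp.2 ?_)
      have : 0 ≤ s * (p * (u ⬝ᵥ (‖x‖⁻¹ • x).ofLp) ^ 2) := by positivity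
      linarith
  refine (lintegral_mono hpt).trans ?_
  rw [lintegral_add_left (by fun_prop), lintegral_const_mul _ (by fun_prop),
    lintegral_exp_sq_dotProduct_gaussian hu (by linarith),
    lintegral_exp_norm_sq_gaussian (by norm_num), ← ENNReal.ofReal_mul (Real.exp_pos _).le,
    ← ENNReal.ofReal_add (by positivity) (by positivity)]
  refine ENNReal.ofReal_le_ofReal (add_le_add (le_of_eq (by ring_nf)) ?_)
  refine (mul_le_mul_of_nonneg_left (inv_sqrt_half_pow_le p) (Real.exp_pos _).le).trans ?_
  rw [← Real.exp_add]
  exact Real.exp_le_exp.2 (le_of_eq (by ring))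

lemma sq_dotProduct_le {u v : Fin p → ℝ} (hu : u ⬝ᵥ u = 1) : (u ⬝ᵥ v) ^ 2 ≤ v ⬝ᵥ v := by
  have := Finset.sum_mul_sq_le_sq_mul_sq Finset.univ u v
  simp only [dotProduct] at hu ⊢
  simp only [← sq] at hu ⊢
  rwa [hu, one_mul] at this

/-- If ‖x‖² ≥ p/2, then p(u·x/‖x‖)² ≤ 2(u·x)². Otherwise the left exponent is at most p/20 ≤ 3p/10 -
‖x‖²/2. The two Gaussian means are at most 2 and 1. -/
lemma lintegral_exp_sq_dotProduct_le (hp : 1 ≤ p) {u : Fin p → ℝ} (hu : u ⬝ᵥ u = 1) :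
    ∫⁻ x, ENNReal.ofReal (Real.exp (1 / 20 * (p * (u ⬝ᵥ x.ofLp) ^ 2))) ∂(uniformSphere p) ≤
      ENNReal.ofReal 3 := by
  have hu' := measurable_dotProduct_ofLp u
  have hg := measurable_gaussDensity (p := p)
  rw [lintegral_uniformSphere_eq_gaussian hp (by fun_prop)]
  have hpt : ∀ x : EuclideanSpace ℝ (Fin p),
      ENNReal.ofReal (Real.exp (1 / 20 * (p * (u ⬝ᵥ (‖x‖⁻¹ • x).ofLp) ^ 2))) * gaussDensity p x ≤
      ENNReal.ofReal (Real.exp (1 / 10 * (u ⬝ᵥ x.ofLp) ^ 2)) * gaussDensity p x +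
      ENNReal.ofReal (Real.exp (3 / 10 * p)) *
        (ENNReal.ofReal (Real.exp (-(1 / 2) * ‖x‖ ^ 2)) * gaussDensity p x) := by
    intro x
    rw [← mul_assoc (ENNReal.ofReal _), ← add_mul, ← ENNReal.ofReal_mul (Real.exp_pos _).le, ← Real.exp_add,
      ← ENNReal.ofReal_add (Real.exp_pos _).le (Real.exp_pos _).le]
    gcongr
    have h1 := dotProduct_direction u x
    have h2 := sq_nonneg (u ⬝ᵥ (‖x‖⁻¹ • x).ofLp)
    rcases le_or_gt ((p : ℝ) / 2) (‖x‖ ^ 2) with h | h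
    · refine le_add_of_le_of_nonneg (Real.exp_le_exp.2 ?_) (Real.exp_pos _).le
      rw [← h1]
      nlinarith [mul_nonneg (sub_nonneg.2 h) h2]
    · refine le_add_of_nonneg_of_le (Real.exp_pos _).le (Real.exp_le_exp.2 ?_)
      have h3 : (u ⬝ᵥ (‖x‖⁻¹ • x).ofLp) ^ 2 ≤ 1 := by
        refine (sq_dotProduct_le hu).trans ?_
        rw [← norm_sq_eq_dotProduct, norm_smul, norm_inv, norm_norm]
        refine pow_le_one₀ (by positivity) ?_
        exact inv_mul_le_one_of_le₀ le_rfl (norm_nonneg _)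
      have h4 : (p : ℝ) * (u ⬝ᵥ (‖x‖⁻¹ • x).ofLp) ^ 2 ≤ p * 1 := by gcongr
      linarith
  refine (lintegral_mono hpt).trans ?_
  rw [lintegral_add_left (by fun_prop), lintegral_const_mul _ (by fun_prop),
    lintegral_exp_sq_dotProduct_gaussian hu (by norm_num),
    lintegral_exp_norm_sq_gaussian (by norm_num), ← ENNReal.ofReal_mul (Real.exp_pos _).le,
    ← ENNReal.ofReal_add (by positivity) (by positivity)]
  refine ENNReal.ofReal_le_ofReal ?_
  have ha : (Real.sqrt (1 - 2 * (1 / 10)))⁻¹ ≤ 2 := by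
    rw [inv_le_comm₀ (by positivity) (by norm_num)]
    exact Real.le_sqrt_of_sq_le (by norm_num)
  have hb : Real.exp (3 / 10 * p) ≤ Real.sqrt ((1 - 2 * (-(1 / 2))) ^ p) := by
    refine Real.le_sqrt_of_sq_le ?_
    rw [← Real.exp_nat_mul, show ((2 : ℕ) : ℝ) * (3 / 10 * (p : ℝ)) = p * (3 / 5) by
      push_cast; ring, Real.exp_nat_mul]
    refine pow_le_pow_left₀ (Real.exp_pos _).le ?_ p
    rw [← Real.le_log_iff_exp_le (by norm_num)]
    norm_num
    linarith [Real.log_two_gt_d9]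
  have hc : Real.exp (3 / 10 * p) * (Real.sqrt ((1 - 2 * (-(1 / 2))) ^ p))⁻¹ ≤ 1 := by
    rw [← div_eq_mul_inv]
    exact div_le_one_of_le₀ hb (Real.sqrt_nonneg _)
  linarith

end SphereTails

/-! ### Nets of the unit sphere. -/

section Nets

/-- Balls of radius η/2 around the points are disjoint and lie in the ball of radius 1 + η/2;
compare volumes. -/
lemma card_le_of_separated_unit {E : Type*} [NormedAddCommGroup E] [NormedSpace ℝ E]
    [FiniteDimensional ℝ E] (s : Finset E) {η : ℝ} (hη : 0 < η) (hη1 : η ≤ 1)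
    (hs : ∀ c ∈ s, ‖c‖ = 1) (h : ∀ c ∈ s, ∀ d ∈ s, c ≠ d → η ≤ ‖c - d‖) :
    (s.card : ℝ) ≤ (3 / η) ^ Module.finrank ℝ E := by
  borelize E
  let μ : Measure E := Measure.addHaar
  have hd : 0 < η / 2 := by positivity
  have hr : 0 < 1 + η / 2 := by positivity
  set A := ⋃ c ∈ s, Metric.ball (c : E) (η / 2) with hA
  have D : Set.Pairwise (s : Set E) (Function.onFun Disjoint fun c => Metric.ball (c : E) (η / 2)) := by
    rintro c hc d hd hcd
    apply Metric.ball_disjoint_ball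
    rw [dist_eq_norm, add_halves]
    exact h c hc d hd hcd
  have A_subset : A ⊆ Metric.ball (0 : E) (1 + η / 2) := by
    refine Set.iUnion₂_subset fun x hx => ?_
    apply Metric.ball_subset_ball'
    rw [dist_zero_right, hs x hx, add_comm]
  have I : (s.card : ENNReal) * ENNReal.ofReal ((η / 2) ^ Module.finrank ℝ E) *
        μ (Metric.ball 0 1) ≤
      ENNReal.ofReal ((1 + η / 2) ^ Module.finrank ℝ E) * μ (Metric.ball 0 1) :=
    calc
      _ = μ A := by
        rw [hA, measure_biUnion_finset D fun c _ => measurableSet_ball]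
        simp only [μ.addHaar_ball_of_pos _ hd]
        simp only [Finset.sum_const, nsmul_eq_mul, mul_assoc]
      _ ≤ μ (Metric.ball (0 : E) (1 + η / 2)) := measure_mono A_subset
      _ = _ := by simp only [μ.addHaar_ball_of_pos _ hr]
  have J := (ENNReal.mul_le_mul_iff_left (Metric.measure_ball_pos _ _ zero_lt_one).ne'
    measure_ball_lt_top.ne).1 I
  have K := ENNReal.toReal_le_of_le_ofReal (pow_nonneg hr.le _) J
  rw [ENNReal.toReal_mul, ENNReal.toReal_natCast, ENNReal.toReal_ofReal (by positivity),
    ← le_div_iff₀ (by positivity), ← div_pow] at K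
  refine K.trans (pow_le_pow_left₀ (by positivity) ?_ _)
  rw [div_le_div_iff₀ hd hη]
  nlinarith

/-- A separated set of largest cardinality is a net, since a point far from it could be added. -/
lemma exists_net_unit_sphere (E : Type*) [NormedAddCommGroup E] [NormedSpace ℝ E]
    [FiniteDimensional ℝ E] {η : ℝ} (hη : 0 < η) (hη1 : η ≤ 1) :
    ∃ s : Finset E, (∀ v ∈ s, ‖v‖ = 1) ∧ (s.card : ℝ) ≤ (3 / η) ^ Module.finrank ℝ E ∧
      ∀ u : E, ‖u‖ = 1 → ∃ v ∈ s, ‖u - v‖ ≤ η := by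
  classical
  let P : ℕ → Prop := fun k => ∃ s : Finset E, s.card = k ∧ (∀ v ∈ s, ‖v‖ = 1) ∧
    ∀ c ∈ s, ∀ d ∈ s, c ≠ d → η ≤ ‖c - d‖
  obtain ⟨N, hN⟩ := exists_nat_ge ((3 / η) ^ Module.finrank ℝ E)
  have hP0 : P 0 := ⟨∅, by simp⟩
  obtain ⟨s, hsc, hs1, hs2⟩ : P (Nat.findGreatest P N) :=
    Nat.findGreatest_spec (m := 0) (Nat.zero_le _) hP0
  refine ⟨s, hs1, card_le_of_separated_unit s hη hη1 hs1 hs2, fun u hu => ?_⟩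
  by_contra! hcon
  have hus : u ∉ s := fun hmem => by
    have := hcon u hmem; simp at this; linarith
  have hPins : P (s.card + 1) := by
    refine ⟨insert u s, Finset.card_insert_of_notMem hus, ?_, ?_⟩
    · intro v hv
      rcases Finset.mem_insert.1 hv with rfl | hv
      · exact hu
      · exact hs1 v hv
    · intro c hc d hd hcd
      rcases Finset.mem_insert.1 hc with hc' | hc' <;> rcases Finset.mem_insert.1 hd with hd' | hd'
      · exact absurd (hc'.trans hd'.symm) hcd
      · rw [hc']; exact (hcon d hd').le
      · rw [hd', norm_sub_rev]; exact (hcon c hc').le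
      · exact hs2 c hc' d hd' hcd
  obtain ⟨t, htc, ht1, ht2⟩ := hPins
  have hle : s.card + 1 ≤ N := by
    have := (card_le_of_separated_unit t hη hη1 ht1 ht2).trans hN
    rw [htc] at this
    exact_mod_cast this
  have := Nat.le_findGreatest (P := P) hle ⟨t, htc, ht1, ht2⟩
  omega

variable {E : Type*} [NormedAddCommGroup E] [NormedSpace ℝ E]

lemma opNorm_le_of_net {F : Type*} [NormedAddCommGroup F] [NormedSpace ℝ F] (L : E →L[ℝ] F)
    {s : Finset E} {B : ℝ} (hB : 0 ≤ B) (hs : ∀ u : E, ‖u‖ = 1 → ∃ v ∈ s, ‖u - v‖ ≤ 1 / 2)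
    (h : ∀ v ∈ s, ‖L v‖ ≤ B) : ‖L‖ ≤ 2 * B := by
  have h1 : ‖L‖ ≤ B + ‖L‖ * (1 / 2) := by
    refine L.opNorm_le_of_unit_norm (by positivity) fun u hu => ?_
    obtain ⟨v, hv, huv⟩ := hs u hu
    have h2 : L u = L v + L (u - v) := by simp
    rw [h2]
    refine (norm_add_le _ _).trans (add_le_add (h v hv) ((L.le_opNorm _).trans ?_))
    gcongr
  linarith

lemma le_norm_of_net {F : Type*} [NormedAddCommGroup F] [NormedSpace ℝ F] (L : E →L[ℝ] F)
    {s : Finset E} {B η : ℝ} (hs : ∀ u : E, ‖u‖ = 1 → ∃ v ∈ s, ‖u - v‖ ≤ η)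
    (h : ∀ v ∈ s, B ≤ ‖L v‖) (hL : ‖L‖ * η ≤ B / 2) {u : E} (hu : ‖u‖ = 1) : B / 2 ≤ ‖L u‖ := by
  obtain ⟨v, hv, huv⟩ := hs u hu
  have h2 : L v = L u - L (u - v) := by simp
  have h3 : ‖L (u - v)‖ ≤ ‖L‖ * η := (L.le_opNorm _).trans (by gcongr)
  have h4 := h v hv
  rw [h2] at h4
  have := norm_sub_le (L u) (L (u - v))
  linarith

end Nets

/-! ### Chernoff bounds for independent directions and the upper bound on the scatter matrix. -/

section Product

variable {n p : ℕ}

lemma lintegral_pi_finset_prod {α : Type*} [MeasurableSpace α] (μ : Measure α)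
    [IsProbabilityMeasure μ] (s : Finset (Fin n)) {f : α → ENNReal} (hf : Measurable f) :
    ∫⁻ Y, ∏ j ∈ s, f (Y j) ∂(Measure.pi fun _ : Fin n => μ) = (∫⁻ x, f x ∂μ) ^ s.card := by
  have hind : iIndepFun (fun (j : Fin n) (Y : Fin n → α) => f (Y j))
      (Measure.pi fun _ : Fin n => μ) :=
    iIndepFun_pi (X := fun _ => f) fun _ => hf.aemeasurable
  refine (lintegral_prod_eq_prod_lintegral_of_indepFun s
    (fun j (Y : Fin n → α) => f (Y j)) hind
    (fun j => hf.comp (measurable_pi_apply j))).trans ?_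
  have : ∀ j : Fin n, ∫⁻ Y, f (Y j) ∂(Measure.pi fun _ : Fin n => μ) = ∫⁻ x, f x ∂μ := fun j =>
    (measurePreserving_eval (fun _ : Fin n => μ) j).lintegral_comp hf
  simp [this]

lemma pi_sum_ge_le {α : Type*} [MeasurableSpace α] (μ : Measure α)
    [IsProbabilityMeasure μ] (s : Finset (Fin n)) {X : α → ℝ} (hX : Measurable X) (a : ℝ) :
    (Measure.pi fun _ : Fin n => μ) {Y | a ≤ ∑ j ∈ s, X (Y j)} ≤
      ENNReal.ofReal (Real.exp (-a)) * (∫⁻ x, ENNReal.ofReal (Real.exp (X x)) ∂μ) ^ s.card := by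
  rw [← lintegral_pi_finset_prod μ s (f := fun x => ENNReal.ofReal (Real.exp (X x))) (by fun_prop),
    ← lintegral_const_mul _ (by fun_prop)]
  have hm : MeasurableSet {Y : Fin n → α | a ≤ ∑ j ∈ s, X (Y j)} :=
    measurableSet_le measurable_const (by fun_prop)
  rw [← lintegral_indicator_one hm]
  refine lintegral_mono fun Y => ?_
  by_cases hY : Y ∈ {Y : Fin n → α | a ≤ ∑ j ∈ s, X (Y j)}
  · rw [Set.indicator_of_mem hY, ← ENNReal.ofReal_prod_of_nonneg (fun _ _ => (Real.exp_pos _).le),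
      ← Real.exp_sum, ← ENNReal.ofReal_mul (Real.exp_pos _).le, ← Real.exp_add, Pi.one_apply,
      ENNReal.one_le_ofReal, Real.one_le_exp_iff]
    have : a ≤ ∑ j ∈ s, X (Y j) := hY
    linarith
  · rw [Set.indicator_of_notMem hY]; exact zero_le

/-- The `n × p` design matrix with rows `y_j`, the rows outside `s` being replaced by `0`, as a
continuous linear map. -/
noncomputable def designMap (Y : Fin n → EuclideanSpace ℝ (Fin p)) (s : Finset (Fin n)) :
    EuclideanSpace ℝ (Fin p) →L[ℝ] EuclideanSpace ℝ (Fin n) :=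
  LinearMap.toContinuousLinearMap
    { toFun := fun u => WithLp.toLp 2 fun j => if j ∈ s then u.ofLp ⬝ᵥ (Y j).ofLp else 0
      map_add' := fun u v => by
        ext j; by_cases h : j ∈ s <;> simp [h]
      map_smul' := fun c u => by
        ext j; by_cases h : j ∈ s <;> simp [h] }

lemma norm_designMap_sq (Y : Fin n → EuclideanSpace ℝ (Fin p)) (s : Finset (Fin n))
    (u : EuclideanSpace ℝ (Fin p)) :
    ‖designMap Y s u‖ ^ 2 = ∑ j ∈ s, (u.ofLp ⬝ᵥ (Y j).ofLp) ^ 2 := by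
  rw [EuclideanSpace.real_norm_sq_eq]
  simp [designMap, Finset.sum_ite_mem]

/-- The `n`-fold product of the uniform distribution on the sphere. -/
noncomputable def spherePi (n p : ℕ) : Measure (Fin n → EuclideanSpace ℝ (Fin p)) :=
  Measure.pi fun _ => uniformSphere p

lemma ofLp_dotProduct_self_eq_one {u : EuclideanSpace ℝ (Fin p)} (hu : ‖u‖ = 1) :
    u.ofLp ⬝ᵥ u.ofLp = 1 := by
  rw [← norm_sq_eq_dotProduct, hu, one_pow]

lemma spherePi_sum_sq_ge_le (hp : 1 ≤ p) {u : EuclideanSpace ℝ (Fin p)} (hu : ‖u‖ = 1) :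
    spherePi n p {Y | 80 * n ≤ p * ∑ j, (u.ofLp ⬝ᵥ (Y j).ofLp) ^ 2} ≤
      ENNReal.ofReal ((Real.exp (-4) * 3) ^ n) := by
  have := isProbabilityMeasure_uniformSphere hp
  have hm := measurable_dotProduct_ofLp u.ofLp
  have h := pi_sum_ge_le (n := n) (uniformSphere p) Finset.univ
    -- The threshold 80n becomes 4n in units of 1/20; each factor then contributes 3e^{-4}, small
    -- enough to beat a net of 6^n points.
    (X := fun x => 1 / 20 * (p * (u.ofLp ⬝ᵥ x.ofLp) ^ 2)) (by fun_prop) (4 * n)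
  refine (measure_mono ?_).trans (h.trans ?_)
  · intro Y (hY : 80 * (n : ℝ) ≤ p * ∑ j, (u.ofLp ⬝ᵥ (Y j).ofLp) ^ 2)
    change 4 * (n : ℝ) ≤ ∑ j, 1 / 20 * (p * (u.ofLp ⬝ᵥ (Y j).ofLp) ^ 2)
    rw [← Finset.mul_sum, ← Finset.mul_sum]
    linarith
  · refine (mul_le_mul_right (pow_le_pow_left₀ zero_le
      (lintegral_exp_sq_dotProduct_le hp (ofLp_dotProduct_self_eq_one hu)) _) _).trans ?_
    rw [Finset.card_univ, Fintype.card_fin, ← ENNReal.ofReal_pow (by norm_num),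
      ← ENNReal.ofReal_mul (Real.exp_pos _).le, mul_pow, ← Real.exp_nat_mul]
    exact ENNReal.ofReal_le_ofReal (le_of_eq (by ring_nf))

lemma spherePi_sum_sq_le_le (hp : 1 ≤ p) {u : EuclideanSpace ℝ (Fin p)} (hu : ‖u‖ = 1)
    (s : Finset (Fin n)) {S : ℝ} (hS : 0 < S) :
    spherePi n p {Y | S * (p * ∑ j ∈ s, (u.ofLp ⬝ᵥ (Y j).ofLp) ^ 2) ≤ n} ≤
      ENNReal.ofReal (Real.exp n * ((Real.sqrt (1 + S))⁻¹ + Real.exp (-p / 10)) ^ s.card) := by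
  have := isProbabilityMeasure_uniformSphere hp
  have hm := measurable_dotProduct_ofLp u.ofLp
  have h := pi_sum_ge_le (n := n) (uniformSphere p) s
    (X := fun x => -S * (p * (u.ofLp ⬝ᵥ x.ofLp) ^ 2)) (by fun_prop) (-n)
  refine (measure_mono ?_).trans (h.trans ?_)
  · intro Y (hY : S * (p * ∑ j ∈ s, (u.ofLp ⬝ᵥ (Y j).ofLp) ^ 2) ≤ n)
    change -(n : ℝ) ≤ ∑ j ∈ s, -S * (p * (u.ofLp ⬝ᵥ (Y j).ofLp) ^ 2)
    rw [← Finset.mul_sum, ← Finset.mul_sum]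
    linarith
  · refine (mul_le_mul_right (pow_le_pow_left₀ zero_le
      (lintegral_exp_neg_sq_dotProduct_le hp (ofLp_dotProduct_self_eq_one hu) hS.le) _) _).trans ?_
    rw [neg_neg, ← ENNReal.ofReal_pow (by positivity), ← ENNReal.ofReal_mul (Real.exp_pos _).le]

/-- The event that the sample second moment matrix has bounded norm. -/
def scatterBounded (Y : Fin n → EuclideanSpace ℝ (Fin p)) : Prop :=
  ∀ u : EuclideanSpace ℝ (Fin p), p * ∑ j, (u.ofLp ⬝ᵥ (Y j).ofLp) ^ 2 ≤ 320 * n * ‖u‖ ^ 2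

/-- A net of mesh 1/2 loses a factor 2 in norm, hence 320 = 4 · 80. It has at most 6^p ≤ 6^n points,
and 6 · 3e^{-4} ≤ e^{-1}. -/
lemma spherePi_not_scatterBounded_le (hp : 1 ≤ p) (hpn : p ≤ n) :
    spherePi n p {Y | ¬ scatterBounded Y} ≤ ENNReal.ofReal (Real.exp (-n)) := by
  have hp0 : (0 : ℝ) < p := by exact_mod_cast hp
  obtain ⟨s, hs1, hs2, hs3⟩ := exists_net_unit_sphere (EuclideanSpace ℝ (Fin p)) (η := 1 / 2)
    (by norm_num) (by norm_num)
  rw [finrank_euclideanSpace_fin] at hs2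
  have hsub : {Y : Fin n → EuclideanSpace ℝ (Fin p) | ¬ scatterBounded Y} ⊆
      ⋃ v ∈ s, {Y | 80 * n ≤ p * ∑ j, (v.ofLp ⬝ᵥ (Y j).ofLp) ^ 2} := by
    intro Y hY
    by_contra hcon
    refine hY fun u => ?_
    simp only [Set.mem_iUnion, not_exists] at hcon
    have hB : (0 : ℝ) ≤ Real.sqrt (80 * n / p) := Real.sqrt_nonneg _
    have hop := opNorm_le_of_net (designMap Y Finset.univ) hB hs3 fun v hv => by
      refine Real.le_sqrt_of_sq_le ?_
      have h1 : ¬ (80 * (n : ℝ) ≤ p * ∑ j, (v.ofLp ⬝ᵥ (Y j).ofLp) ^ 2) := hcon v hv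
      rw [norm_designMap_sq, le_div_iff₀ hp0]
      linarith
    have h2 : ‖designMap Y Finset.univ u‖ ^ 2 ≤ (2 * Real.sqrt (80 * n / p) * ‖u‖) ^ 2 := by
      refine pow_le_pow_left₀ (norm_nonneg _) (((designMap Y Finset.univ).le_opNorm u).trans ?_) 2
      gcongr
    rw [norm_designMap_sq, mul_pow, mul_pow, Real.sq_sqrt (by positivity)] at h2
    calc _ ≤ (p : ℝ) * (2 ^ 2 * (80 * n / p) * ‖u‖ ^ 2) := by gcongr
      _ = _ := by field_simp; ring
  refine (measure_mono hsub).trans ((measure_biUnion_finset_le _ _).trans ?_)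
  refine (Finset.sum_le_sum fun v hv => spherePi_sum_sq_ge_le hp (hs1 v hv)).trans ?_
  rw [Finset.sum_const, nsmul_eq_mul, ← ENNReal.ofReal_natCast, ← ENNReal.ofReal_mul (by positivity)]
  refine ENNReal.ofReal_le_ofReal ?_
  have h6 : (s.card : ℝ) ≤ 6 ^ n := hs2.trans (by
    norm_num
    exact pow_le_pow_right₀ (by norm_num) hpn)
  refine (mul_le_mul_of_nonneg_right h6 (by positivity)).trans ?_
  rw [← mul_pow, show -(n : ℝ) = n * (-1) by ring, Real.exp_nat_mul]
  refine pow_le_pow_left₀ (by positivity) ?_ _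
  have h3 : Real.exp (-4) = Real.exp (-1) * (Real.exp (-1)) ^ 3 := by
    rw [← Real.exp_nat_mul, ← Real.exp_add]; norm_num
  have h4 := Real.exp_neg_one_lt_d9
  have h5 := Real.exp_pos (-1)
  have h7 : (Real.exp (-1)) ^ 3 ≤ 0.3678794412 ^ 3 := pow_le_pow_left₀ h5.le h4.le 3
  rw [h3]
  nlinarith

end Product

/-! ### Lower bound on the scatter matrix of all points but one. -/

section LowerBound

variable {n p : ℕ}

/-- On the event that the design map L has ‖L‖ ≤ √(320n/p), the mesh η makes ‖L‖η half of the lower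
bound B = √(n/(Sp)) at the net points. The bound B/2 then holds on the whole sphere, hence the
factor 1/4 in the square. -/
lemma spherePi_exists_sum_sq_lt_le_aux (hp : 1 ≤ p) (s : Finset (Fin n)) {S η : ℝ} (hS : 1 ≤ S)
    (hη : η = 1 / (2 * Real.sqrt (320 * S))) :
    spherePi n p {Y | scatterBounded Y ∧
        ∃ u : EuclideanSpace ℝ (Fin p),
          p * ∑ j ∈ s, (u.ofLp ⬝ᵥ (Y j).ofLp) ^ 2 < 1 / (4 * S) * n * ‖u‖ ^ 2} ≤
      ENNReal.ofReal ((3 / η) ^ p *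
        (Real.exp n * ((Real.sqrt (1 + S))⁻¹ + Real.exp (-p / 10)) ^ s.card)) := by
  have hp0 : (0 : ℝ) < p := by exact_mod_cast hp
  have hS0 : 0 < S := by linarith
  have hsq : 1 ≤ Real.sqrt (320 * S) := Real.le_sqrt_of_sq_le (by linarith)
  have hη0 : 0 < η := by rw [hη]; positivity
  have hη1 : η ≤ 1 := by
    rw [hη, div_le_one (by positivity)]; linarith
  obtain ⟨t, ht1, ht2, ht3⟩ := exists_net_unit_sphere (EuclideanSpace ℝ (Fin p)) hη0 hη1
  rw [finrank_euclideanSpace_fin] at ht2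
  have hsub : {Y : Fin n → EuclideanSpace ℝ (Fin p) | scatterBounded Y ∧
        ∃ u : EuclideanSpace ℝ (Fin p),
          p * ∑ j ∈ s, (u.ofLp ⬝ᵥ (Y j).ofLp) ^ 2 < 1 / (4 * S) * n * ‖u‖ ^ 2} ⊆
      ⋃ v ∈ t, {Y | S * (p * ∑ j ∈ s, (v.ofLp ⬝ᵥ (Y j).ofLp) ^ 2) ≤ n} := by
    rintro Y ⟨hYb, u, hu⟩
    by_contra hcon
    simp only [Set.mem_iUnion, not_exists] at hcon
    have hu0 : u ≠ 0 := by
      rintro rfl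
      simp at hu
    have hun : 0 < ‖u‖ := norm_pos_iff.2 hu0
    set B := Real.sqrt (n / (S * p)) with hB
    have hBn : ∀ v ∈ t, B ≤ ‖designMap Y s v‖ := fun v hv => by
      have h1 : ¬ (S * (p * ∑ j ∈ s, (v.ofLp ⬝ᵥ (Y j).ofLp) ^ 2) ≤ n) := hcon v hv
      rw [hB, Real.sqrt_le_left (norm_nonneg _), norm_designMap_sq, div_le_iff₀ (by positivity)]
      linarith
    have hop : ‖designMap Y s‖ * η ≤ B / 2 := by
      have h1 : ‖designMap Y s‖ ≤ Real.sqrt (320 * n / p) := by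
        refine ContinuousLinearMap.opNorm_le_of_unit_norm (Real.sqrt_nonneg _) fun v hv => ?_
        refine Real.le_sqrt_of_sq_le ?_
        rw [norm_designMap_sq, le_div_iff₀ hp0]
        have h2 := hYb v
        rw [hv] at h2
        have h3 : ∑ j ∈ s, (v.ofLp ⬝ᵥ (Y j).ofLp) ^ 2 ≤ ∑ j, (v.ofLp ⬝ᵥ (Y j).ofLp) ^ 2 :=
          Finset.sum_le_univ_sum_of_nonneg fun _ => sq_nonneg _
        have h4 := mul_le_mul_of_nonneg_left h3 hp0.le
        linarith
      have h2 : Real.sqrt (320 * n / p) = Real.sqrt (320 * S) * B := by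
        rw [hB, ← Real.sqrt_mul (by positivity)]
        congr 1; field_simp
      calc _ ≤ Real.sqrt (320 * n / p) * η := by gcongr
        _ = B / 2 := by rw [h2, hη]; field_simp
    have h5 := le_norm_of_net (designMap Y s) ht3 hBn hop (u := ‖u‖⁻¹ • u) (by
      rw [norm_smul, norm_inv, norm_norm, inv_mul_cancel₀ hun.ne'])
    have h6 : (B / 2) ^ 2 ≤ (‖u‖⁻¹) ^ 2 * ∑ j ∈ s, (u.ofLp ⬝ᵥ (Y j).ofLp) ^ 2 := by
      have h7 := pow_le_pow_left₀ (by positivity) h5 2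
      rwa [map_smul, norm_smul, mul_pow, norm_designMap_sq, norm_inv, norm_norm] at h7
    rw [div_pow, hB, Real.sq_sqrt (by positivity)] at h6
    have h8 : p * ∑ j ∈ s, (u.ofLp ⬝ᵥ (Y j).ofLp) ^ 2 =
        (‖u‖⁻¹ ^ 2 * ∑ j ∈ s, (u.ofLp ⬝ᵥ (Y j).ofLp) ^ 2) * (p * ‖u‖ ^ 2) := by
      field_simp
    have h9 : 1 / (4 * S) * n * ‖u‖ ^ 2 = n / (S * p) / 2 ^ 2 * (p * ‖u‖ ^ 2) := by
      field_simp; ring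
    rw [h8, h9] at hu
    exact absurd hu (not_lt.2 (mul_le_mul_of_nonneg_right h6 (by positivity)))
  refine (measure_mono hsub).trans ((measure_biUnion_finset_le _ _).trans ?_)
  refine (Finset.sum_le_sum fun v hv => spherePi_sum_sq_le_le hp (ht1 v hv) s hS0).trans ?_
  rw [Finset.sum_const, nsmul_eq_mul, ← ENNReal.ofReal_natCast, ← ENNReal.ofReal_mul (by positivity)]
  refine ENNReal.ofReal_le_ofReal ?_
  gcongr

/-- With S = e^{2r} the net costs about e^{rp} while the rows in s gain about e^{-r|s|}. As |s| ≥ n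
- 1 exceeds p by at least κn, a large r wins. -/
lemma spherePi_exists_sum_sq_lt_le {κ : ℝ} (hκ : 0 < κ) :
    ∃ c > (0 : ℝ), ∃ p₀ : ℕ, ∀ n p : ℕ, 1 ≤ p → p₀ ≤ p → (p : ℝ) + 1 + κ * n ≤ n →
      ∀ s : Finset (Fin n), n ≤ s.card + 1 →
      spherePi n p {Y | scatterBounded Y ∧ ∃ u : EuclideanSpace ℝ (Fin p),
          p * ∑ j ∈ s, (u.ofLp ⬝ᵥ (Y j).ofLp) ^ 2 < c * n * ‖u‖ ^ 2} ≤
        ENNReal.ofReal (Real.exp (-n)) := by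
  -- The terms without r total at most 5p + n + |s| ≤ 7n, so rκ = 8 leaves -n.
  set r : ℝ := 8 / κ with hr
  have hr0 : 0 < r := by positivity
  have hS1 : 1 ≤ Real.exp r ^ 2 := one_le_pow₀ (Real.one_le_exp hr0.le)
  -- Ensures e^{-p/10} ≤ e^{-r}, so the remainder from large Gaussian norms is harmless.
  obtain ⟨p₀, hp₀⟩ := exists_nat_ge (10 * r)
  refine ⟨1 / (4 * Real.exp r ^ 2), by positivity, p₀, fun n p hp hpp hpn s hs => ?_⟩
  refine (spherePi_exists_sum_sq_lt_le_aux hp s hS1 rfl).trans (ENNReal.ofReal_le_ofReal ?_)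
  have hcard : (s.card : ℝ) ≤ n := by
    have := Finset.card_le_univ s
    rw [Fintype.card_fin] at this
    exact_mod_cast this
  have hs' : (n : ℝ) ≤ s.card + 1 := by exact_mod_cast hs
  have hpp' : 10 * r ≤ p := hp₀.trans (by exact_mod_cast hpp)
  have h1 : 3 / (1 / (2 * Real.sqrt (320 * Real.exp r ^ 2))) ≤ Real.exp (5 + r) := by
    rw [Real.sqrt_mul (by norm_num), Real.sqrt_sq (Real.exp_pos r).le, Real.exp_add]
    have h2 : Real.sqrt 320 ≤ 18 := Real.sqrt_le_iff.2 ⟨by norm_num, by norm_num⟩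
    have h3 : (108 : ℝ) ≤ Real.exp 5 := by
      have h4 : (2.7 : ℝ) ^ 5 ≤ Real.exp 1 ^ 5 :=
        pow_le_pow_left₀ (by norm_num) (by linarith [Real.exp_one_gt_d9]) 5
      rw [← Real.exp_nat_mul] at h4
      norm_num at h4 ⊢
      linarith
    have h5 : 3 / (1 / (2 * (Real.sqrt 320 * Real.exp r))) = 6 * Real.sqrt 320 * Real.exp r := by
      field_simp; ring
    rw [h5]
    gcongr
    linarith
  have h2 : (Real.sqrt (1 + Real.exp r ^ 2))⁻¹ + Real.exp (-p / 10) ≤ Real.exp (1 - r) := by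
    have h3 : (Real.sqrt (1 + Real.exp r ^ 2))⁻¹ ≤ Real.exp (-r) := by
      rw [Real.exp_neg]
      exact inv_anti₀ (Real.exp_pos r) (Real.le_sqrt_of_sq_le (by linarith))
    have h4 : Real.exp (-p / 10) ≤ Real.exp (-r) := Real.exp_le_exp.2 (by linarith)
    have h5 : Real.exp (1 - r) = Real.exp 1 * Real.exp (-r) := by rw [← Real.exp_add]; rfl
    rw [h5]
    nlinarith [Real.exp_one_gt_d9, Real.exp_pos (-r)]
  calc _ ≤ Real.exp (5 + r) ^ p * (Real.exp n * Real.exp (1 - r) ^ s.card) := by gcongr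
    _ = Real.exp (p * (5 + r) + (n + s.card * (1 - r))) := by
      rw [← Real.exp_nat_mul, ← Real.exp_nat_mul, ← Real.exp_add, ← Real.exp_add]
    _ ≤ Real.exp (-n) := by
      refine Real.exp_le_exp.2 ?_
      have h6 : r * κ = 8 := by rw [hr]; field_simp
      have h7 : r * ((p : ℝ) - s.card + κ * n) ≤ 0 :=
        mul_nonpos_of_nonneg_of_nonpos hr0.le (by linarith)
      have h8 : r * (κ * n) = 8 * n := by rw [← mul_assoc, h6]
      have h9 : 0 ≤ κ * n := by positivity
      linarith

end LowerBound

/-! ### Projective contraction of the weight iteration. -/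

section GramSystem

variable {ι : Type*} [Fintype ι]

/-- The relations between the matrices `K w i j = yᵢ · S(w)⁻¹ yⱼ`, where
`S(w) = γ ∑ wⱼ yⱼ yⱼᵀ` is a weighted scatter matrix of size `d`. -/
structure GramSystem (γ d : ℝ) (K : (ι → ℝ) → ι → ι → ℝ) : Prop where
  gamma_pos : 0 < γ
  cross : ∀ w w' : ι → ℝ, (∀ i, 0 < w i) → (∀ i, 0 < w' i) → ∀ i k,
    K w' k i = γ * ∑ j, w j * (K w' k j * K w i j)
  diag_pos : ∀ w : ι → ℝ, (∀ i, 0 < w i) → ∀ i, 0 < K w i i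
  trace : ∀ w : ι → ℝ, (∀ i, 0 < w i) → γ * ∑ i, w i * K w i i = d
  cont : ∀ i, ContinuousOn (fun w => K w i i) {w | ∀ i, 0 < w i}

/-- Every row of the stochastic matrix `γ wⱼ Kᵢⱼ² / Kᵢᵢ` gives mass at least `c` to every set which
contains at least half of the indices. -/
def Coupled (γ c : ℝ) (K : ι → ι → ℝ) (w : ι → ℝ) : Prop :=
  ∀ i, ∀ J : Finset ι, Fintype.card ι ≤ 2 * J.card → c * K i i ≤ γ * ∑ j ∈ J, w j * K i j ^ 2

lemma sum_mul_le_of_sum_ge {P f : ι → ℝ} {J : Finset ι} {c M m : ℝ} (hP : ∀ j, 0 ≤ P j)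
    (hJ : c * ∑ j, P j ≤ ∑ j ∈ J, P j) (hM : ∀ j, f j ≤ M) (hm : ∀ j ∈ J, f j ≤ m) (hmM : m ≤ M) :
    ∑ j, P j * f j ≤ (M - c * (M - m)) * ∑ j, P j := by
  classical
  have h1 : ∑ j, P j * f j ≤ ∑ j, (P j * M - if j ∈ J then P j * (M - m) else 0) := by
    refine Finset.sum_le_sum fun j _ => ?_
    by_cases hj : j ∈ J
    · simp only [hj, if_true]
      nlinarith [mul_le_mul_of_nonneg_left (hm j hj) (hP j)]
    · simp only [hj, if_false, sub_zero]
      exact mul_le_mul_of_nonneg_left (hM j) (hP j)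
  rw [Finset.sum_sub_distrib, ← Finset.sum_mul, Finset.sum_ite_mem, Finset.univ_inter,
    ← Finset.sum_mul] at h1
  nlinarith [mul_le_mul_of_nonneg_right hJ (sub_nonneg.2 hmM)]

namespace GramSystem

variable {γ d : ℝ} {K : (ι → ℝ) → ι → ι → ℝ} {w w' : ι → ℝ}

lemma symm (hK : GramSystem γ d K) (hw : ∀ i, 0 < w i) (i k : ι) : K w i k = K w k i := by
  have h : ∑ j, w j * (K w i j * K w k j) = ∑ j, w j * (K w k j * K w i j) :=
    Finset.sum_congr rfl fun j _ => by ring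
  rw [hK.cross w w hw hw k i, hK.cross w w hw hw i k, h]

lemma smul (hK : GramSystem γ d K) (hw : ∀ i, 0 < w i) {t : ℝ} (ht : 0 < t) (i k : ι) :
    K (t • w) i k = t⁻¹ * K w i k := by
  have htw : ∀ i, 0 < (t • w) i := fun i => mul_pos ht (hw i)
  have h2 := hK.cross (t • w) w htw hw i k
  have h3 : K w k i = t * K (t • w) i k := by
    have h4 : ∑ j, (t • w) j * (K w k j * K (t • w) i j) =
        t * ∑ j, w j * (K (t • w) i j * K w k j) := by
      rw [Finset.mul_sum]
      refine Finset.sum_congr rfl fun j _ => ?_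
      simp only [Pi.smul_apply, smul_eq_mul]
      ring
    rw [h2, h4, hK.cross w (t • w) hw htw k i]
    ring
  rw [hK.symm hw i k, h3, inv_mul_cancel_left₀ ht.ne']

lemma diag_eq (hK : GramSystem γ d K) (hw : ∀ i, 0 < w i) (i : ι) :
    K w i i = γ * ∑ j, w j * K w i j ^ 2 := by
  conv_lhs => rw [hK.cross w w hw hw i i]
  simp only [sq]

/-- Cauchy–Schwarz, with weights w', on K(w)_ii = γ ∑ w'_j K(w)_ij K(w')_ij. This is the source of
every comparison between two weight vectors. -/
lemma diag_sq_le (hK : GramSystem γ d K) (hw : ∀ i, 0 < w i) (hw' : ∀ i, 0 < w' i) (i : ι) :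
    K w i i ^ 2 ≤ (γ * ∑ j, w' j * K w i j ^ 2) * K w' i i := by
  rw [hK.diag_eq hw' i, hK.cross w' w hw' hw i i, mul_pow, mul_mul_mul_comm, ← sq]
  refine mul_le_mul_of_nonneg_left ?_ (sq_nonneg _)
  refine Finset.sum_sq_le_sum_mul_sum_of_sq_le_mul _ (fun j _ => ?_) (fun j _ => ?_) fun j _ => ?_
  · have := hw' j; positivity
  · have := hw' j; positivity
  · exact le_of_eq (by ring)

/-- Dividing `diag_sq_le` by K(w)_ii K(w')_ii bounds the ratio by the mean of w'_j/w_j under a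
probability vector, which by coupling has mass at least c on J. -/
lemma ratio_le (hK : GramSystem γ d K) (hw : ∀ i, 0 < w i) (hw' : ∀ i, 0 < w' i) {M m c : ℝ}
    (hc : Coupled γ c (K w) w) (hM : ∀ j, w' j / w j ≤ M) (hmM : m ≤ M) {J : Finset ι}
    (hJ : Fintype.card ι ≤ 2 * J.card) (hm : ∀ j ∈ J, w' j / w j ≤ m) (i : ι) :
    K w i i / K w' i i ≤ M - c * (M - m) := by
  have hp := hK.diag_pos w hw i
  have hp' := hK.diag_pos w' hw' i
  have hd := hK.diag_eq hw i
  have h1 := sum_mul_le_of_sum_ge (P := fun j => γ * (w j * K w i j ^ 2)) (f := fun j => w' j / w j)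
    (J := J) (c := c) (fun j => by have := hw j; have := hK.gamma_pos; positivity)
    (by rw [← Finset.mul_sum, ← Finset.mul_sum, ← hd]; exact hc i J hJ) hM hm hmM
  rw [← Finset.mul_sum, ← hd] at h1
  have h2 : ∑ j, γ * (w j * K w i j ^ 2) * (w' j / w j) = γ * ∑ j, w' j * K w i j ^ 2 := by
    rw [Finset.mul_sum]
    refine Finset.sum_congr rfl fun j _ => ?_
    have := (hw j).ne'
    field_simp
  rw [h2] at h1
  have h3 := hK.diag_sq_le hw hw' i
  rw [div_le_iff₀ hp']
  have h4 := h3.trans (mul_le_mul_of_nonneg_right h1 hp'.le)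
  nlinarith

lemma ratio_le_of_le (hK : GramSystem γ d K) (hw : ∀ i, 0 < w i) (hw' : ∀ i, 0 < w' i) {M : ℝ}
    (hM : ∀ j, w' j / w j ≤ M) (i : ι) : K w i i / K w' i i ≤ M := by
  -- With c = 0 coupling is automatic, which leaves plain monotonicity.
  have h := hK.ratio_le hw hw' (c := 0) (J := Finset.univ) (M := M) (m := M)
    (fun i J _ => by
      rw [zero_mul]
      exact mul_nonneg hK.gamma_pos.le
        (Finset.sum_nonneg fun j _ => mul_nonneg (hw j).le (sq_nonneg _)))
    hM le_rfl (by rw [Finset.card_univ]; omega) (fun j _ => hM j) i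
  simpa using h

/-- Split w'/w at the midpoint of [a, aR]. Either at least half of the indices lie below, which
improves the first factor, or at least half lie above, which improves the second factor through
w/w'. -/
lemma ratio_mul_ratio_le (hK : GramSystem γ d K) (hw : ∀ i, 0 < w i) (hw' : ∀ i, 0 < w' i)
    {a R c : ℝ} (ha : 0 < a) (hR : 1 ≤ R) (hc0 : 0 < c) (hc : Coupled γ c (K w) w)
    (hc' : Coupled γ c (K w') w') (hlow : ∀ j, a ≤ w' j / w j) (hup : ∀ j, w' j / w j ≤ a * R)
    (i k : ι) :
    K w i i / K w' i i * (K w' k k / K w k k) ≤ R - c / 2 * (R - 1) := by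
  classical
  have hR0 : 0 < R := by linarith
  have hup' : ∀ j, w j / w' j ≤ a⁻¹ := fun j => by
    rw [← inv_div]; exact inv_anti₀ ha (hlow j)
  have h1 := hK.ratio_le_of_le hw hw' hup i
  have h2 := hK.ratio_le_of_le hw' hw hup' k
  have hn1 : 0 ≤ K w i i / K w' i i := (div_pos (hK.diag_pos w hw i) (hK.diag_pos w' hw' i)).le
  have hn2 : 0 ≤ K w' k k / K w k k := (div_pos (hK.diag_pos w' hw' k) (hK.diag_pos w hw k)).le
  set J : Finset ι := Finset.univ.filter fun j => w' j / w j ≤ a * ((1 + R) / 2) with hJdef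
  by_cases hJ : Fintype.card ι ≤ 2 * J.card
  · have h3 := hK.ratio_le hw hw' hc hup (m := a * ((1 + R) / 2)) (by nlinarith) hJ
      (fun j hj => (Finset.mem_filter.1 hj).2) i
    calc _ ≤ (a * R - c * (a * R - a * ((1 + R) / 2))) * a⁻¹ :=
          mul_le_mul h3 h2 hn2 (hn1.trans h3)
      _ = _ := by field_simp; ring
  · have hJ' : Fintype.card ι ≤ 2 * Jᶜ.card := by
      rw [Finset.card_compl]; omega
    have h3 := hK.ratio_le hw' hw hc' hup' (m := a⁻¹ * (2 / (1 + R)))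
      (mul_le_of_le_one_right (by positivity) (by rw [div_le_one (by linarith)]; linarith)) hJ'
      (fun j hj => by
        have h4 : ¬ w' j / w j ≤ a * ((1 + R) / 2) := fun h =>
          Finset.mem_compl.1 hj (Finset.mem_filter.2 ⟨Finset.mem_univ _, h⟩)
        rw [← inv_div, show a⁻¹ * (2 / (1 + R)) = (a * ((1 + R) / 2))⁻¹ by field_simp]
        exact inv_anti₀ (by positivity) (not_le.1 h4).le) k
    have h5 : c / 2 * (R - 1) ≤ c * (R - 1) * (R / (1 + R)) := by
      have : 1 / 2 ≤ R / (1 + R) := by rw [div_le_div_iff₀ two_pos (by linarith)]; linarith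
      nlinarith [mul_le_mul_of_nonneg_left this (mul_nonneg hc0.le (sub_nonneg.2 hR))]
    calc _ ≤ (a * R) * (a⁻¹ - c * (a⁻¹ - a⁻¹ * (2 / (1 + R)))) :=
          mul_le_mul h1 h3 hn2 (by positivity)
      _ = R - c * (R - 1) * (R / (1 + R)) := by field_simp; ring
      _ ≤ _ := by linarith

/-- Maximum principle: where w'/w attains its maximum b, equality in the averaging bound forces
K(w)_ij = 0 for every j with a smaller ratio. Coupling makes the maximal set at least half of the
indices, and then coupling at any index outside contradicts the vanishing. Only w has to be coupled,
so w' may be any fixed point. -/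
lemma eq_smul_of_fixed [Nonempty ι] (hK : GramSystem γ d K) (hw : ∀ i, 0 < w i)
    (hw' : ∀ i, 0 < w' i) {c : ℝ} (hc0 : 0 < c) (hc : Coupled γ c (K w) w)
    (hf : ∀ i, w i * K w i i = 1) (hf' : ∀ i, w' i * K w' i i = 1) :
    ∃ b > (0 : ℝ), w' = b • w := by
  classical
  obtain ⟨i₀, hi₀⟩ := Finite.exists_max fun j => w' j / w j
  set b := w' i₀ / w i₀ with hb
  have hb0 : 0 < b := div_pos (hw' i₀) (hw i₀)
  have hle : ∀ j, w' j ≤ b * w j := fun j => (div_le_iff₀ (hw j)).1 (hi₀ j)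
  have hzero : ∀ i, w' i = b * w i → ∀ j, w' j ≠ b * w j → K w i j = 0 := by
    intro i hi j hj
    have h1 := hK.diag_sq_le hw hw' i
    have h2 : K w i i = (w i)⁻¹ := eq_inv_of_mul_eq_one_right (hf i)
    have h3 : K w' i i = (b * w i)⁻¹ := by rw [← hi]; exact eq_inv_of_mul_eq_one_right (hf' i)
    have hwi := hw i
    have h4 : b * K w i i ≤ γ * ∑ j, w' j * K w i j ^ 2 := by
      rw [h3, ← div_eq_mul_inv, le_div_iff₀ (by positivity)] at h1
      rw [h2] at h1 ⊢
      refine le_trans (le_of_eq ?_) h1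
      field_simp
    rw [hK.diag_eq hw i, mul_left_comm, mul_le_mul_iff_right₀ hK.gamma_pos, Finset.mul_sum] at h4
    have h5 : ∀ j ∈ Finset.univ, 0 ≤ b * (w j * K w i j ^ 2) - w' j * K w i j ^ 2 := fun j _ => by
      have := mul_le_mul_of_nonneg_right (hle j) (sq_nonneg (K w i j))
      linarith
    have h6 : ∑ j, (b * (w j * K w i j ^ 2) - w' j * K w i j ^ 2) = 0 :=
      le_antisymm (by rw [Finset.sum_sub_distrib]; linarith) (Finset.sum_nonneg h5)
    have h7 := (Finset.sum_eq_zero_iff_of_nonneg h5).1 h6 j (Finset.mem_univ j)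
    have h8 : (b * w j - w' j) * K w i j ^ 2 = 0 := by linarith
    rcases mul_eq_zero.1 h8 with h9 | h9
    · exact absurd (sub_eq_zero.1 h9).symm hj
    · exact pow_eq_zero_iff (two_ne_zero) |>.1 h9
  set J : Finset ι := Finset.univ.filter fun j => w' j = b * w j with hJ
  have hi₀J : w' i₀ = b * w i₀ := by rw [hb, div_mul_cancel₀ _ (hw i₀).ne']
  have hcard : Fintype.card ι ≤ 2 * J.card := by
    by_contra hcon
    have h1 := hc i₀ Jᶜ (by rw [Finset.card_compl]; omega)
    have h2 : ∑ j ∈ Jᶜ, w j * K w i₀ j ^ 2 = 0 := Finset.sum_eq_zero fun j hj => by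
      rw [hzero i₀ hi₀J j fun h => Finset.mem_compl.1 hj (Finset.mem_filter.2 ⟨Finset.mem_univ _, h⟩)]
      simp
    rw [h2, mul_zero] at h1
    exact absurd h1 (not_le.2 (mul_pos hc0 (hK.diag_pos w hw i₀)))
  refine ⟨b, hb0, funext fun k => ?_⟩
  by_contra hk
  have h1 := hc k J hcard
  have h2 : ∑ j ∈ J, w j * K w k j ^ 2 = 0 := Finset.sum_eq_zero fun j hj => by
    rw [hK.symm hw, hzero j (Finset.mem_filter.1 hj).2 k hk]
    simp
  rw [h2, mul_zero] at h1
  exact absurd h1 (not_le.2 (mul_pos hc0 (hK.diag_pos w hw k)))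

/-- Minimize the oscillation φ of w/F(w) over a compact box. F maps the box into itself up to
scaling and contracts φ - 1 by the factor 1 - c/2, so the minimum is 1. -/
lemma exists_fixed [Nonempty ι] (hK : GramSystem γ d K) (hd : d = γ * Fintype.card ι) {c ρ η : ℝ}
    (hc0 : 0 < c) (hc2 : c ≤ 2) (hρ0 : 0 < ρ) (hρ1 : ρ ≤ 1) (hη : η ≤ c * ρ / 4)
    (hc : ∀ w : ι → ℝ, (∀ i, 0 < w i) → (∀ i k, w i ≤ (1 + ρ) * w k) → Coupled γ c (K w) w)
    (h1 : ∀ i k, K 1 i i ≤ (1 + η) * K 1 k k) :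
    ∃ w : ι → ℝ, (∀ i, 0 < w i) ∧ (∀ i k, w i ≤ (1 + ρ) * w k) ∧ ∀ i, w i * K w i i = 1 := by
  classical
  set B : Set (ι → ℝ) := Set.Icc (fun _ => 1) (fun _ => 1 + ρ) with hB
  have hBpos : ∀ w ∈ B, ∀ i, 0 < w i := fun w hw i => zero_lt_one.trans_le (hw.1 i)
  have hBrat : ∀ w ∈ B, ∀ i k, w i ≤ (1 + ρ) * w k := fun w hw i k => by
    have h2 : w i ≤ 1 + ρ := hw.2 i
    have h3 : 1 ≤ w k := hw.1 k
    nlinarith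
  -- the ratios `w / F(w)` and their oscillation
  set φ : (ι → ℝ) → ℝ := fun w => Finset.univ.sup' Finset.univ_nonempty
    fun q : ι × ι => (w q.1 * K w q.1 q.1) / (w q.2 * K w q.2 q.2) with hφ
  have hle : ∀ w i k, (w i * K w i i) / (w k * K w k k) ≤ φ w := fun w i k =>
    Finset.le_sup' (fun q : ι × ι => (w q.1 * K w q.1 q.1) / (w q.2 * K w q.2 q.2))
      (Finset.mem_univ (i, k))
  have hpos : ∀ w : ι → ℝ, (∀ i, 0 < w i) → ∀ i, 0 < w i * K w i i := fun w hw i =>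
    mul_pos (hw i) (hK.diag_pos w hw i)
  have hcont : ContinuousOn φ B := by
    refine ContinuousOn.finset_sup'_apply _ fun q _ => ?_
    have hK' : ∀ i, ContinuousOn (fun w => K w i i) B := fun i => (hK.cont i).mono hBpos
    refine ContinuousOn.div ?_ ?_ fun w hw => (hpos w (hBpos w hw) q.2).ne'
    · exact (continuous_apply _).continuousOn.mul (hK' _)
    · exact (continuous_apply _).continuousOn.mul (hK' _)
  obtain ⟨w, hwB, hmin⟩ := (isCompact_Icc : IsCompact B).exists_isMinOn
    ⟨fun _ => 1, fun _ => le_rfl, fun _ => by linarith⟩ hcont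
  have hw := hBpos w hwB
  have hrat := hBrat w hwB
  -- the image of the minimizer
  set F : ι → ℝ := fun i => (K w i i)⁻¹ with hF
  have hFpos : ∀ i, 0 < F i := fun i => inv_pos.2 (hK.diag_pos w hw i)
  have hone : ∀ i : ι, (0 : ℝ) < (1 : ι → ℝ) i := fun _ => one_pos
  have hcone : Coupled γ c (K 1) 1 := hc 1 hone fun i k => by simp; linarith
  have hcw := hc w hw hrat
  have hFrat : ∀ i k, F i ≤ (1 + ρ) * F k := by
    intro i k
    -- Comparison with the constant weights: the oscillation 1 + ρ shrinks to 1 + ρ - cρ/2, which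
    -- leaves room for the factor 1 + cρ/4 due to F(1).
    have h2 := hK.ratio_mul_ratio_le hone hw (a := 1) (R := 1 + ρ) one_pos (by linarith) hc0
      hcone hcw (fun j => by simpa using hwB.1 j) (fun j => by simpa using hwB.2 j) i k
    have hi := hK.diag_pos w hw i
    have hk := hK.diag_pos w hw k
    have hi1 := hK.diag_pos 1 hone i
    have hk1 := hK.diag_pos 1 hone k
    have h3 : K w k k / K w i i = (K 1 i i / K w i i * (K w k k / K 1 k k)) * (K 1 k k / K 1 i i) := by
      field_simp
    have h4 : K 1 k k / K 1 i i ≤ 1 + c * ρ / 4 := by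
      rw [div_le_iff₀ hi1]
      refine (h1 k i).trans ?_
      gcongr
    have h5 : K w k k / K w i i ≤ 1 + ρ := by
      rw [h3]
      refine (mul_le_mul h2 h4 (div_pos hk1 hi1).le ?_).trans ?_
      · nlinarith
      · nlinarith [mul_pos hc0 hρ0, mul_nonneg (mul_pos hc0 hρ0).le (sub_nonneg.2 hρ1)]
    rw [hF]
    simp only
    rw [← div_eq_mul_inv, inv_eq_one_div, div_le_div_iff₀ hi hk, one_mul]
    exact (div_le_iff₀ hi).1 h5
  obtain ⟨k₀, hk₀⟩ := Finite.exists_min F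
  have hF'B : (F k₀)⁻¹ • F ∈ B := by
    have h0 := hFpos k₀
    refine ⟨fun i => ?_, fun i => ?_⟩
    · change 1 ≤ (F k₀)⁻¹ * F i
      rw [inv_mul_eq_div, one_le_div h0]; exact hk₀ i
    · change (F k₀)⁻¹ * F i ≤ 1 + ρ
      rw [inv_mul_eq_div, div_le_iff₀ h0]; exact hFrat i k₀
  -- contraction
  obtain ⟨i₁, hi₁⟩ := Finite.exists_min fun i => F i / w i
  set a := F i₁ / w i₁ with ha
  have ha0 : 0 < a := div_pos (hFpos i₁) (hw i₁)
  have hFw : ∀ i, F i / w i = (w i * K w i i)⁻¹ := fun i => by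
    rw [mul_inv, mul_comm, div_eq_inv_mul, mul_comm]
  have hR1 : 1 ≤ φ w := by
    have := hle w i₁ i₁
    rwa [div_self (hpos w hw i₁).ne'] at this
  -- Contraction applied to the pair w, F(w), whose ratios oscillate by at most φ(w).
  have hcontr : ∀ i k, K w i i / K F i i * (K F k k / K w k k) ≤ φ w - c / 2 * (φ w - 1) :=
    hK.ratio_mul_ratio_le hw hFpos ha0 hR1 hc0 hcw (hc F hFpos hFrat) hi₁ fun j => by
      have h2 := hle w i₁ j
      rw [div_eq_mul_inv, ← hFw j, ← inv_inv (w i₁ * K w i₁ i₁), ← hFw i₁, ← ha,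
        inv_mul_le_iff₀ ha0] at h2
      exact h2
  have hφ' : φ ((F k₀)⁻¹ • F) ≤ φ w - c / 2 * (φ w - 1) := by
    refine Finset.sup'_le _ _ fun q _ => ?_
    have h0 := inv_pos.2 (hFpos k₀)
    rw [hK.smul hFpos h0, hK.smul hFpos h0]
    refine le_trans (le_of_eq ?_) (hcontr q.2 q.1)
    have h2 := hK.diag_pos F hFpos q.1
    have h3 := hK.diag_pos F hFpos q.2
    have h4 := hK.diag_pos w hw q.1
    have h5 := hK.diag_pos w hw q.2
    have h6 := hFpos k₀
    simp only [Pi.smul_apply, smul_eq_mul]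
    rw [show F q.1 = (K w q.1 q.1)⁻¹ from rfl, show F q.2 = (K w q.2 q.2)⁻¹ from rfl]
    field_simp
  have hφ1 : φ w ≤ 1 := by
    have h2 : φ w ≤ φ ((F k₀)⁻¹ • F) := hmin hF'B
    nlinarith
  have hconst : ∀ i k, w i * K w i i ≤ w k * K w k k := fun i k => by
    have := (hle w i k).trans hφ1
    rwa [div_le_one (hpos w hw k)] at this
  refine ⟨w, hw, hrat, fun i => ?_⟩
  -- So far w_i K(w)_ii is constant in i; the trace identity with d = γ|ι| makes the constant 1.
  have h2 := hK.trace w hw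
  rw [Finset.sum_congr rfl fun k _ => le_antisymm (hconst k i) (hconst i k), Finset.sum_const,
    Finset.card_univ, nsmul_eq_mul, hd] at h2
  have h3 : (Fintype.card ι : ℝ) ≠ 0 := by exact_mod_cast Fintype.card_ne_zero
  have h4 := mul_left_cancel₀ hK.gamma_pos.ne' h2
  exact mul_left_cancel₀ h3 (by rw [h4, mul_one])

end GramSystem

end GramSystem

/-! ### Stability of the coupling near equal weights. -/

namespace GramSystem

variable {ι : Type*} [Fintype ι] {γ d : ℝ} {K : (ι → ℝ) → ι → ι → ℝ} {w : ι → ℝ}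

lemma coupled_smul (hK : GramSystem γ d K) (hw : ∀ i, 0 < w i) {t c : ℝ} (ht : 0 < t)
    (hc : Coupled γ c (K (t • w)) (t • w)) : Coupled γ c (K w) w := by
  intro i J hJ
  have h := hc i J hJ
  have h2 : ∑ j ∈ J, (t • w) j * K (t • w) i j ^ 2 = t⁻¹ * ∑ j ∈ J, w j * K w i j ^ 2 := by
    rw [Finset.mul_sum]
    refine Finset.sum_congr rfl fun j _ => ?_
    rw [hK.smul hw ht, Pi.smul_apply, smul_eq_mul]
    field_simp
  rw [h2, hK.smul hw ht, mul_left_comm, mul_left_comm γ] at h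
  exact le_of_mul_le_mul_left h (inv_pos.2 ht)

/-- The row difference e = K(w)_i - K(1)_i satisfies an energy identity with source (1 - w)K(1), so
γ ∑ e² ≤ 8ρ². Hence the mass on J is at least c₀/4 - 4ρ² ≥ c₀/8, while K(w)_ii ≤ 4. -/
lemma coupled_of_near_one (hK : GramSystem γ d K) {ρ c₀ : ℝ} (hρ : ρ ≤ 1 / 2)
    (hρc : 32 * ρ ^ 2 ≤ c₀) (hw : ∀ i, |w i - 1| ≤ ρ) (hdiag : ∀ i, K 1 i i ≤ 2)
    (hc : ∀ i, ∀ J : Finset ι, Fintype.card ι ≤ 2 * J.card → c₀ ≤ γ * ∑ j ∈ J, K 1 i j ^ 2) :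
    Coupled γ (c₀ / 32) (K w) w := by
  have hw1 : ∀ i, 1 / 2 ≤ w i := fun i => by have := (abs_le.1 (hw i)).1; linarith
  have hw0 : ∀ i, 0 < w i := fun i => by linarith [hw1 i]
  have h1 : ∀ i : ι, (0 : ℝ) < (1 : ι → ℝ) i := fun _ => one_pos
  have hγ := hK.gamma_pos
  intro i J hJ
  have hρ0 : 0 ≤ ρ := (abs_nonneg _).trans (hw i)
  set e : ι → ℝ := fun j => K w i j - K 1 i j with he
  have hrel : γ * ∑ j, w j * e j ^ 2 = γ * ∑ j, (1 - w j) * (e j * K 1 i j) := by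
    have a1 := hK.diag_eq hw0 i
    have a2 := hK.cross w 1 hw0 h1 i i
    have a3 := hK.cross 1 w h1 hw0 i i
    have a4 := hK.diag_eq h1 i
    simp only [Pi.one_apply, one_mul] at a3 a4
    have h2 : ∑ j, w j * e j ^ 2 - ∑ j, (1 - w j) * (e j * K 1 i j) =
        ∑ j, w j * K w i j ^ 2 - ∑ j, w j * (K 1 i j * K w i j) - ∑ j, K w i j * K 1 i j +
          ∑ j, K 1 i j ^ 2 := by
      rw [← Finset.sum_sub_distrib, ← Finset.sum_sub_distrib, ← Finset.sum_sub_distrib,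
        ← Finset.sum_add_distrib]
      exact Finset.sum_congr rfl fun j _ => by simp only [he]; ring
    rw [← sub_eq_zero, ← mul_sub, h2]
    linear_combination -a1 + a2 + a3 - a4
  have hQ : γ * ∑ j, e j ^ 2 ≤ 8 * ρ ^ 2 := by
    have b1 : ∑ j, (1 - w j) * (e j * K 1 i j) ≤
        1 / 4 * ∑ j, e j ^ 2 + ρ ^ 2 * ∑ j, K 1 i j ^ 2 := by
      rw [Finset.mul_sum, Finset.mul_sum, ← Finset.sum_add_distrib]
      refine Finset.sum_le_sum fun j _ => ?_
      have h2 : (1 - w j) ^ 2 ≤ ρ ^ 2 := by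
        rw [← sq_abs, abs_sub_comm]; exact pow_le_pow_left₀ (abs_nonneg _) (hw j) 2
      nlinarith [sq_nonneg (1 / 2 * e j - (1 - w j) * K 1 i j),
        mul_le_mul_of_nonneg_right h2 (sq_nonneg (K 1 i j))]
    have b2 : 1 / 2 * ∑ j, e j ^ 2 ≤ ∑ j, w j * e j ^ 2 := by
      rw [Finset.mul_sum]
      exact Finset.sum_le_sum fun j _ => mul_le_mul_of_nonneg_right (hw1 j) (sq_nonneg _)
    have b3 := hK.diag_eq h1 i
    simp only [Pi.one_apply, one_mul] at b3
    have b4 := mul_le_mul_of_nonneg_left b1 hγ.le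
    have b5 := mul_le_mul_of_nonneg_left b2 hγ.le
    have b6 : ρ ^ 2 * K 1 i i ≤ ρ ^ 2 * 2 := mul_le_mul_of_nonneg_left (hdiag i) (sq_nonneg _)
    rw [b3] at b6
    nlinarith
  have hJe : γ * ∑ j ∈ J, e j ^ 2 ≤ γ * ∑ j, e j ^ 2 :=
    mul_le_mul_of_nonneg_left (Finset.sum_le_univ_sum_of_nonneg fun _ => sq_nonneg _) hγ.le
  have hJ2 : 1 / 4 * ∑ j ∈ J, K 1 i j ^ 2 - 1 / 2 * ∑ j ∈ J, e j ^ 2 ≤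
      ∑ j ∈ J, w j * K w i j ^ 2 := by
    rw [Finset.mul_sum, Finset.mul_sum, ← Finset.sum_sub_distrib]
    refine Finset.sum_le_sum fun j _ => ?_
    have h2 : K w i j = K 1 i j + e j := by simp [he]
    rw [h2]
    nlinarith [mul_le_mul_of_nonneg_right (hw1 j) (sq_nonneg (K 1 i j + e j)),
      sq_nonneg (K 1 i j + 2 * e j)]
  have hJ3 := mul_le_mul_of_nonneg_left hJ2 hγ.le
  have hd := hK.ratio_le_of_le hw0 h1 (M := 2) (fun j => by
    rw [div_le_iff₀ (hw0 j)]; simp; linarith [hw1 j]) i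
  have hd' : K w i i ≤ 4 := by
    have := (div_le_iff₀ (hK.diag_pos 1 h1 i)).1 hd
    linarith [hdiag i]
  have hci := hc i J hJ
  have hc0 : 0 ≤ c₀ := le_trans (by positivity) hρc
  nlinarith

lemma coupled_of_ratio_le [Nonempty ι] (hK : GramSystem γ d K) {ρ c₀ : ℝ} (hρ0 : 0 ≤ ρ)
    (hρ : ρ ≤ 1 / 2)
    (hρc : 32 * ρ ^ 2 ≤ c₀) (hw : ∀ i, 0 < w i) (hwr : ∀ i k, w i ≤ (1 + ρ) * w k)
    (hdiag : ∀ i, K 1 i i ≤ 2)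
    (hc : ∀ i, ∀ J : Finset ι, Fintype.card ι ≤ 2 * J.card → c₀ ≤ γ * ∑ j ∈ J, K 1 i j ^ 2) :
    Coupled γ (c₀ / 32) (K w) w := by
  obtain ⟨k₀, hk₀⟩ := Finite.exists_min w
  have h0 := hw k₀
  refine hK.coupled_smul hw (inv_pos.2 h0) (hK.coupled_of_near_one hρ hρc (fun i => ?_) hdiag hc)
  have h1 : 1 ≤ (w k₀)⁻¹ * w i := by
    rw [inv_mul_eq_div, one_le_div h0]; exact hk₀ i
  have h2 : (w k₀)⁻¹ * w i ≤ 1 + ρ := by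
    rw [inv_mul_eq_div, div_le_iff₀ h0]; exact hwr i k₀
  rw [Pi.smul_apply, smul_eq_mul, abs_le]
  constructor <;> linarith

end GramSystem

/-! ### Weighted scatter matrices form a Gram system. -/

section WeightedScatter

open Matrix

variable {ι : Type*} [Fintype ι] {p : ℕ}

/-- The weighted scatter matrix `γ ∑ wⱼ yⱼ yⱼᵀ`. -/
noncomputable def weightedScatter (γ : ℝ) (y : ι → Fin p → ℝ) (w : ι → ℝ) :
    Matrix (Fin p) (Fin p) ℝ :=
  γ • ∑ j, w j • vecMulVec (y j) (y j)

/-- The matrix of the `yᵢ · S⁻¹ yⱼ`, where `S` is the weighted scatter matrix. -/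
noncomputable def scatterGram (γ : ℝ) (y : ι → Fin p → ℝ) (w : ι → ℝ) (i j : ι) : ℝ :=
  y i ⬝ᵥ (weightedScatter γ y w)⁻¹ *ᵥ y j

variable {γ : ℝ} {y : ι → Fin p → ℝ} {w : ι → ℝ}

lemma weightedScatter_mulVec (v : Fin p → ℝ) :
    weightedScatter γ y w *ᵥ v = γ • ∑ j, (w j * (y j ⬝ᵥ v)) • y j := by
  rw [weightedScatter, smul_mulVec, sum_mulVec]
  congr 1
  refine Finset.sum_congr rfl fun j _ => ?_
  rw [smul_mulVec, vecMulVec_mulVec, op_smul_eq_smul, smul_smul]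

lemma dotProduct_weightedScatter_mulVec (u v : Fin p → ℝ) :
    u ⬝ᵥ weightedScatter γ y w *ᵥ v = γ * ∑ j, w j * ((u ⬝ᵥ y j) * (v ⬝ᵥ y j)) := by
  rw [weightedScatter_mulVec, dotProduct_smul, dotProduct_sum, smul_eq_mul]
  congr 1
  refine Finset.sum_congr rfl fun j _ => ?_
  rw [dotProduct_smul, smul_eq_mul, dotProduct_comm v]
  ring

lemma weightedScatter_isHermitian : (weightedScatter γ y w).IsHermitian := by
  rw [IsHermitian, conjTranspose_eq_transpose_of_trivial, weightedScatter, transpose_smul,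
    transpose_sum]
  simp [transpose_smul, transpose_vecMulVec]

lemma weightedScatter_posDef (hγ : 0 < γ) (hw : ∀ i, 0 < w i)
    (hy : ∀ u : Fin p → ℝ, u ≠ 0 → ∃ j, u ⬝ᵥ y j ≠ 0) : (weightedScatter γ y w).PosDef := by
  refine PosDef.of_dotProduct_mulVec_pos weightedScatter_isHermitian fun {u} hu => ?_
  obtain ⟨j, hj⟩ := hy u hu
  rw [star_trivial, dotProduct_weightedScatter_mulVec]
  refine mul_pos hγ (Finset.sum_pos' (fun i _ => ?_) ⟨j, Finset.mem_univ j, ?_⟩)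
  · rw [← sq]; exact mul_nonneg (hw i).le (sq_nonneg _)
  · rw [← sq]; exact mul_pos (hw j) (by positivity)

lemma posDef_mulVec_inv_mulVec {S : Matrix (Fin p) (Fin p) ℝ} (hS : S.PosDef) (v : Fin p → ℝ) :
    S *ᵥ (S⁻¹ *ᵥ v) = v := by
  rw [mulVec_mulVec, mul_nonsing_inv _ (isUnit_iff_ne_zero.2 hS.det_pos.ne'), one_mulVec]

lemma dotProduct_mulVec_comm {S : Matrix (Fin p) (Fin p) ℝ} (hS : S.IsHermitian)
    (u v : Fin p → ℝ) : u ⬝ᵥ S *ᵥ v = v ⬝ᵥ S *ᵥ u := by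
  rw [IsHermitian, conjTranspose_eq_transpose_of_trivial] at hS
  rw [dotProduct_mulVec, ← mulVec_transpose, hS, dotProduct_comm]

lemma trace_mul_vecMulVec (A : Matrix (Fin p) (Fin p) ℝ) (u : Fin p → ℝ) :
    (A * vecMulVec u u).trace = u ⬝ᵥ A *ᵥ u := by
  rw [mul_vecMulVec, trace_vecMulVec, dotProduct_comm]

/-- The cross relation expands S(w')⁻¹ = S(w')⁻¹ S(w) S(w)⁻¹ between y_k and y_i; the trace relation
is tr(S⁻¹S) = p. -/
lemma gramSystem_scatterGram (hγ : 0 < γ) (hy : ∀ u : Fin p → ℝ, u ≠ 0 → ∃ j, u ⬝ᵥ y j ≠ 0)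
    (hy0 : ∀ i, y i ≠ 0) : GramSystem γ p (scatterGram γ y) where
  gamma_pos := hγ
  cross w w' hw hw' i k := by
    have hS := weightedScatter_posDef hγ hw hy
    have hS' := weightedScatter_posDef hγ hw' hy
    set u := (weightedScatter γ y w)⁻¹ *ᵥ y i with hu
    set u' := (weightedScatter γ y w')⁻¹ *ᵥ y k with hu'
    have h1 : ∀ j, scatterGram γ y w i j = u ⬝ᵥ y j := fun j => by
      rw [scatterGram, dotProduct_mulVec_comm hS.inv.isHermitian, dotProduct_comm]
    have h2 : ∀ j, scatterGram γ y w' k j = u' ⬝ᵥ y j := fun j => by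
      rw [scatterGram, dotProduct_mulVec_comm hS'.inv.isHermitian, dotProduct_comm]
    simp only [h1, h2]
    rw [← dotProduct_weightedScatter_mulVec, hu, posDef_mulVec_inv_mulVec hS]
  diag_pos w hw i := by
    have := (weightedScatter_posDef hγ hw hy).inv.dotProduct_mulVec_pos (hy0 i)
    simpa [scatterGram] using this
  trace w hw := by
    have hS := weightedScatter_posDef hγ hw hy
    have h1 : ((weightedScatter γ y w)⁻¹ * weightedScatter γ y w).trace = p := by
      rw [nonsing_inv_mul _ (isUnit_iff_ne_zero.2 hS.det_pos.ne'), trace_one, Fintype.card_fin]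
    rw [← h1]
    conv_rhs => rw [weightedScatter]
    rw [Matrix.mul_smul, trace_smul, Matrix.mul_sum, trace_sum, smul_eq_mul]
    congr 1
    refine Finset.sum_congr rfl fun j _ => ?_
    rw [Matrix.mul_smul, trace_smul, trace_mul_vecMulVec, smul_eq_mul]
    rfl
  cont i := by
    have hS : Continuous fun w : ι → ℝ => weightedScatter γ y w := by
      unfold weightedScatter; fun_prop
    have h1 : ∀ w : ι → ℝ, scatterGram γ y w i i = (weightedScatter γ y w).det⁻¹ *
        (y i ⬝ᵥ (weightedScatter γ y w).adjugate *ᵥ y i) := fun w => by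
      rw [scatterGram, inv_def, smul_mulVec, dotProduct_smul, Ring.inverse_eq_inv', smul_eq_mul]
    simp_rw [h1]
    refine ContinuousOn.mul (ContinuousOn.inv₀ hS.matrix_det.continuousOn fun w hw =>
      (weightedScatter_posDef hγ hw hy).det_pos.ne') (Continuous.continuousOn ?_)
    exact continuous_const.dotProduct (hS.matrix_adjugate.matrix_mulVec continuous_const)

end WeightedScatter

/-! ### Leave-one-out estimates at equal weights. -/

section LeaveOneOut

open Matrix

variable {n p : ℕ} {γ : ℝ} {y : Fin n → Fin p → ℝ}

/-- The scatter matrix of all the `yⱼ` but `yᵢ`. -/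
noncomputable def looScatter (γ : ℝ) (y : Fin n → Fin p → ℝ) (i : Fin n) :
    Matrix (Fin p) (Fin p) ℝ :=
  γ • ∑ j ∈ Finset.univ.erase i, vecMulVec (y j) (y j)

lemma looScatter_eq (i : Fin n) :
    looScatter γ y i = weightedScatter γ y fun j => if j ∈ Finset.univ.erase i then 1 else 0 := by
  rw [looScatter, weightedScatter]
  congr 1
  rw [← Finset.univ_inter (Finset.univ.erase i), ← Finset.sum_ite_mem]
  refine Finset.sum_congr rfl fun j _ => ?_
  by_cases h : j ∈ Finset.univ.erase i <;> simp [h]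

lemma looScatter_add (i : Fin n) :
    weightedScatter γ y 1 = looScatter γ y i + γ • vecMulVec (y i) (y i) := by
  rw [looScatter, weightedScatter, ← smul_add, Finset.sum_erase_add _ _ (Finset.mem_univ i)]
  simp

lemma looScatter_isHermitian (i : Fin n) : (looScatter γ y i).IsHermitian := by
  rw [looScatter_eq]; exact weightedScatter_isHermitian

lemma dotProduct_looScatter_mulVec (i : Fin n) (u v : Fin p → ℝ) :
    u ⬝ᵥ looScatter γ y i *ᵥ v =
      γ * ∑ j ∈ Finset.univ.erase i, ((u ⬝ᵥ y j) * (v ⬝ᵥ y j)) := by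
  rw [looScatter_eq, dotProduct_weightedScatter_mulVec]
  congr 1
  rw [← Finset.univ_inter (Finset.univ.erase i), ← Finset.sum_ite_mem]
  refine Finset.sum_congr rfl fun j _ => ?_
  by_cases h : j ∈ Finset.univ.erase i <;> simp [h]

lemma looScatter_posDef {c₁ : ℝ} (hc₁ : 0 < c₁) {i : Fin n}
    (hB : ∀ u : Fin p → ℝ, c₁ * (u ⬝ᵥ u) ≤ γ * ∑ j ∈ Finset.univ.erase i, (u ⬝ᵥ y j) ^ 2) :
    (looScatter γ y i).PosDef :=
  posDef_of_dotProduct_ge (looScatter_isHermitian i) hc₁ fun v => by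
    rw [dotProduct_looScatter_mulVec]
    simpa only [sq] using hB v

lemma sq_dotProduct_le_mul {u v : Fin p → ℝ} : (u ⬝ᵥ v) ^ 2 ≤ (u ⬝ᵥ u) * (v ⬝ᵥ v) := by
  have := Finset.sum_mul_sq_le_sq_mul_sq Finset.univ u v
  simpa only [dotProduct, ← sq] using this

/-- Upper and lower bounds for a positive definite matrix bound the inverse. -/
lemma dotProduct_inv_mulVec_le {S : Matrix (Fin p) (Fin p) ℝ} (hS : S.PosDef) {c : ℝ} (hc : 0 < c)
    (h : ∀ u : Fin p → ℝ, c * (u ⬝ᵥ u) ≤ u ⬝ᵥ S *ᵥ u) (v : Fin p → ℝ) :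
    v ⬝ᵥ S⁻¹ *ᵥ v ≤ c⁻¹ * (v ⬝ᵥ v) ∧
      c * ((S⁻¹ *ᵥ v) ⬝ᵥ (S⁻¹ *ᵥ v)) ≤ v ⬝ᵥ S⁻¹ *ᵥ v := by
  have h1 := h (S⁻¹ *ᵥ v)
  rw [posDef_mulVec_inv_mulVec hS, dotProduct_comm _ v] at h1
  have h2 := sq_dotProduct_le_mul (u := v) (v := S⁻¹ *ᵥ v)
  have h0 := dotProduct_self_nonneg' v
  set q := v ⬝ᵥ S⁻¹ *ᵥ v
  refine ⟨?_, h1⟩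
  rw [inv_mul_eq_div, le_div_iff₀ hc]
  by_contra hcon
  push Not at hcon
  have hq : 0 < q := by
    by_contra hq
    nlinarith
  have h3 : c * q ^ 2 ≤ (v ⬝ᵥ v) * q := by
    nlinarith [mul_le_mul_of_nonneg_left h1 h0]
  nlinarith

/-- Everything the randomness has to supply; the rest is deterministic. In `small` the index i is
excluded from J so that the remaining points are independent of y_i, and n/3 instead of n/2 makes up
for this removal. -/
structure LooBounds (γ : ℝ) (y : Fin n → Fin p → ℝ) (c₁ ε t : ℝ) : Prop where
  unit : ∀ i, y i ⬝ᵥ y i = 1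
  lower : ∀ i, ∀ u : Fin p → ℝ, c₁ * (u ⬝ᵥ u) ≤ γ * ∑ j ∈ Finset.univ.erase i, (u ⬝ᵥ y j) ^ 2
  conc : ∀ i, |y i ⬝ᵥ (looScatter γ y i)⁻¹ *ᵥ y i - (looScatter γ y i)⁻¹.trace / p| ≤ ε
  small : ∀ i, ∀ J : Finset (Fin n), i ∉ J → n ≤ 3 * J.card →
    t ≤ γ * ∑ j ∈ J, (y i ⬝ᵥ (looScatter γ y i)⁻¹ *ᵥ y j) ^ 2

namespace LooBounds

variable {c₁ ε t : ℝ}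

lemma quad_mem (hL : LooBounds γ y c₁ ε t) (hc₁ : 0 < c₁) (i : Fin n) :
    0 ≤ y i ⬝ᵥ (looScatter γ y i)⁻¹ *ᵥ y i ∧
      y i ⬝ᵥ (looScatter γ y i)⁻¹ *ᵥ y i ≤ c₁⁻¹ ∧
      c₁ * (((looScatter γ y i)⁻¹ *ᵥ y i) ⬝ᵥ ((looScatter γ y i)⁻¹ *ᵥ y i)) ≤
        y i ⬝ᵥ (looScatter γ y i)⁻¹ *ᵥ y i := by
  have hS := looScatter_posDef hc₁ (hL.lower i)
  have h := dotProduct_inv_mulVec_le hS hc₁ (fun u => by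
    rw [dotProduct_looScatter_mulVec]; simpa only [sq] using hL.lower i u) (y i)
  rw [hL.unit i, mul_one] at h
  refine ⟨?_, h⟩
  have := hS.inv.posSemidef.dotProduct_mulVec_nonneg (y i)
  simpa using this

lemma exists_dotProduct_ne_zero (hL : LooBounds γ y c₁ ε t) (hn : 1 ≤ n) (hc₁ : 0 < c₁) :
    ∀ u : Fin p → ℝ, u ≠ 0 → ∃ j, u ⬝ᵥ y j ≠ 0 := by
  intro u hu
  by_contra! hcon
  have h1 := hL.lower ⟨0, hn⟩ u
  have h2 : 0 < u ⬝ᵥ u := by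
    have := (dotProduct_star_self_pos_iff (v := u)).2 hu
    simpa using this
  simp only [hcon] at h1
  simp at h1
  nlinarith [mul_pos hc₁ h2]

lemma ne_zero (hL : LooBounds γ y c₁ ε t) (i : Fin n) : y i ≠ 0 := fun h => by
  have := hL.unit i
  rw [h] at this
  simp at this

lemma gramSystem (hL : LooBounds γ y c₁ ε t) (hγ : 0 < γ) (hn : 1 ≤ n) (hc₁ : 0 < c₁) :
    GramSystem γ p (scatterGram γ y) :=
  gramSystem_scatterGram hγ (hL.exists_dotProduct_ne_zero hn hc₁) hL.ne_zero

/-- Sherman–Morrison for the rank-one update by γ y_i y_iᵀ. -/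
lemma inv_mulVec_eq (hL : LooBounds γ y c₁ ε t) (hγ : 0 < γ) (hc₁ : 0 < c₁) (i : Fin n) :
    (weightedScatter γ y 1)⁻¹ *ᵥ y i =
      (1 + γ * (y i ⬝ᵥ (looScatter γ y i)⁻¹ *ᵥ y i))⁻¹ • ((looScatter γ y i)⁻¹ *ᵥ y i) := by
  have hM := weightedScatter_posDef hγ (w := 1) (fun _ => one_pos)
    (hL.exists_dotProduct_ne_zero (Nat.one_le_of_lt i.2) hc₁)
  have hS := looScatter_posDef hc₁ (hL.lower i)
  have hq := (hL.quad_mem hc₁ i).1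
  set q := y i ⬝ᵥ (looScatter γ y i)⁻¹ *ᵥ y i with hqd
  have h1 : weightedScatter γ y 1 *ᵥ ((looScatter γ y i)⁻¹ *ᵥ y i) = (1 + γ * q) • y i := by
    rw [looScatter_add i, add_mulVec, posDef_mulVec_inv_mulVec hS, smul_mulVec, vecMulVec_mulVec,
      op_smul_eq_smul, smul_smul, add_smul, one_smul]
  have h2 : (0 : ℝ) < 1 + γ * q := by positivity
  have h3 : y i = (1 + γ * q)⁻¹ • (weightedScatter γ y 1 *ᵥ ((looScatter γ y i)⁻¹ *ᵥ y i)) := by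
    rw [h1, smul_smul, inv_mul_cancel₀ h2.ne', one_smul]
  conv_lhs => rw [h3]
  rw [mulVec_smul, mulVec_mulVec, nonsing_inv_mul _ (isUnit_iff_ne_zero.2 hM.det_pos.ne'),
    one_mulVec]

lemma scatterGram_eq (hL : LooBounds γ y c₁ ε t) (hγ : 0 < γ) (hc₁ : 0 < c₁) (i j : Fin n) :
    scatterGram γ y 1 i j = (1 + γ * (y i ⬝ᵥ (looScatter γ y i)⁻¹ *ᵥ y i))⁻¹ *
      (y i ⬝ᵥ (looScatter γ y i)⁻¹ *ᵥ y j) := by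
  have hM := weightedScatter_posDef hγ (w := 1) (fun _ => one_pos)
    (hL.exists_dotProduct_ne_zero (Nat.one_le_of_lt i.2) hc₁)
  have hS := looScatter_posDef hc₁ (hL.lower i)
  rw [scatterGram, dotProduct_mulVec_comm hM.inv.isHermitian, hL.inv_mulVec_eq hγ hc₁,
    dotProduct_smul, smul_eq_mul, dotProduct_mulVec_comm hS.inv.isHermitian (y j)]

/-- The rank-one update changes the trace by γ|v|²/(1+γq) with v = S_i⁻¹y_i; since c₁|v|² ≤ q, this
is at most 1/c₁, independently of n and p. -/
lemma trace_inv_sub (hL : LooBounds γ y c₁ ε t) (hγ : 0 < γ) (hc₁ : 0 < c₁) (i : Fin n) :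
    |(looScatter γ y i)⁻¹.trace - (weightedScatter γ y 1)⁻¹.trace| ≤ c₁⁻¹ := by
  have hM := weightedScatter_posDef hγ (w := 1) (fun _ => one_pos)
    (hL.exists_dotProduct_ne_zero (Nat.one_le_of_lt i.2) hc₁)
  have hS := looScatter_posDef hc₁ (hL.lower i)
  obtain ⟨hq0, hq1, hq2⟩ := hL.quad_mem hc₁ i
  have hinv := hL.inv_mulVec_eq hγ hc₁ i
  set q := y i ⬝ᵥ (looScatter γ y i)⁻¹ *ᵥ y i with hqd
  set v := (looScatter γ y i)⁻¹ *ᵥ y i with hv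
  set M := weightedScatter γ y 1 with hMd
  set β := γ * (1 + γ * q)⁻¹ with hβ
  have hMu : M⁻¹ᵀ = M⁻¹ := by
    have := hM.inv.isHermitian
    rwa [IsHermitian, conjTranspose_eq_transpose_of_trivial] at this
  have h1 : looScatter γ y i * (M⁻¹ + β • vecMulVec v v) = 1 := by
    have h2 : looScatter γ y i = M - γ • vecMulVec (y i) (y i) := by
      rw [hMd, looScatter_add i, add_sub_cancel_right]
    have h3 : looScatter γ y i * vecMulVec v v = vecMulVec (y i) v := by
      rw [mul_vecMulVec, hv, posDef_mulVec_inv_mulVec hS]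
    have h4 : vecMulVec (y i) (y i) * M⁻¹ = (1 + γ * q)⁻¹ • vecMulVec (y i) v := by
      rw [vecMulVec_mul, ← mulVec_transpose, hMu, hinv, vecMulVec_smul]
    rw [Matrix.mul_add, Matrix.mul_smul, h3]
    conv_lhs => rw [h2]
    rw [Matrix.sub_mul, mul_nonsing_inv _ (isUnit_iff_ne_zero.2 hM.det_pos.ne'), Matrix.smul_mul,
      h4, smul_smul, ← hβ, sub_add_cancel]
  have h5 : (looScatter γ y i)⁻¹ = M⁻¹ + β • vecMulVec v v := inv_eq_right_inv h1
  have hqp : (0 : ℝ) < 1 + γ * q := by positivity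
  rw [h5, trace_add, add_sub_cancel_left, trace_smul, trace_vecMulVec, smul_eq_mul]
  have hvv := dotProduct_self_nonneg' v
  have hβ0 : 0 ≤ β := by positivity
  rw [abs_of_nonneg (mul_nonneg hβ0 hvv)]
  have h6 : v ⬝ᵥ v ≤ c₁⁻¹ * q := by rw [inv_mul_eq_div, le_div_iff₀ hc₁]; linarith
  calc β * (v ⬝ᵥ v) ≤ β * (c₁⁻¹ * q) := by gcongr
    _ = c₁⁻¹ * ((γ * q) / (1 + γ * q)) := by rw [hβ]; field_simp
    _ ≤ c₁⁻¹ * 1 := by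
      gcongr
      rw [div_le_one hqp]; linarith
    _ = c₁⁻¹ := mul_one _

/-- The map q ↦ q/(1+γq) is 1-Lipschitz on [0, ∞), so all diagonal entries are close to one number
f. Their average is exactly 1 by the trace relation, so f is close to 1 too, whence the factor 2. -/
lemma abs_scatterGram_diag_sub_one_le (hL : LooBounds γ y c₁ ε t) (hγ : 0 < γ) (hn : 1 ≤ n)
    (hp : 1 ≤ p) (hγn : γ * n = p) (hc₁ : 0 < c₁) (i : Fin n) :
    |scatterGram γ y 1 i i - 1| ≤ 2 * (ε + c₁⁻¹ / p) := by
  have hp0 : (0 : ℝ) < p := by exact_mod_cast hp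
  have hn0 : (0 : ℝ) < n := by exact_mod_cast hn
  have hM := weightedScatter_posDef hγ (w := 1) (fun _ => one_pos)
    (hL.exists_dotProduct_ne_zero hn hc₁)
  set τ := (weightedScatter γ y 1)⁻¹.trace / p with hτ
  have hτ0 : 0 ≤ τ := div_nonneg hM.inv.posSemidef.trace_nonneg hp0.le
  set f := τ / (1 + γ * τ) with hf
  have hdev : ∀ i, |scatterGram γ y 1 i i - f| ≤ ε + c₁⁻¹ / p := by
    intro i
    have hq0 := (hL.quad_mem hc₁ i).1
    have h1 := hL.conc i
    have h2 := hL.trace_inv_sub hγ hc₁ i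
    rw [hL.scatterGram_eq hγ hc₁ i i]
    set q := y i ⬝ᵥ (looScatter γ y i)⁻¹ *ᵥ y i with hqd
    have h3 : |q - τ| ≤ ε + c₁⁻¹ / p := by
      have h4 : |(looScatter γ y i)⁻¹.trace / p - τ| ≤ c₁⁻¹ / p := by
        rw [hτ, ← sub_div, abs_div, abs_of_pos hp0]
        gcongr
      have := abs_sub_le q ((looScatter γ y i)⁻¹.trace / p) τ
      linarith
    have ha : 0 < 1 + γ * q := by positivity
    have hb : 0 < 1 + γ * τ := by positivity
    have h5 : (1 + γ * q)⁻¹ * q - f = (q - τ) * ((1 + γ * q) * (1 + γ * τ))⁻¹ := by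
      rw [hf]; field_simp; ring
    rw [h5, abs_mul, abs_of_pos (by positivity : 0 < ((1 + γ * q) * (1 + γ * τ))⁻¹)]
    refine (mul_le_of_le_one_right (abs_nonneg _) (inv_le_one_of_one_le₀ ?_)).trans h3
    exact one_le_mul_of_one_le_of_one_le (by nlinarith) (by nlinarith)
  have havg : ∑ i, scatterGram γ y 1 i i = n := by
    have h1 := (hL.gramSystem hγ hn hc₁).trace 1 fun _ => one_pos
    simp only [Pi.one_apply, one_mul] at h1
    rw [← hγn] at h1
    exact mul_left_cancel₀ hγ.ne' h1
  have hf1 : |1 - f| ≤ ε + c₁⁻¹ / p := by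
    have h1 : n * (1 - f) = ∑ i, (scatterGram γ y 1 i i - f) := by
      rw [Finset.sum_sub_distrib, havg]; simp; ring
    have h2 : n * |1 - f| ≤ n * (ε + c₁⁻¹ / p) := by
      rw [← abs_of_pos hn0, ← abs_mul, abs_of_pos hn0, h1]
      refine (Finset.abs_sum_le_sum_abs _ _).trans ((Finset.sum_le_sum fun i _ => hdev i).trans ?_)
      simp [mul_add]
    exact le_of_mul_le_mul_left h2 hn0
  have := abs_sub_le (scatterGram γ y 1 i i) f 1
  rw [abs_sub_comm f 1] at this
  linarith [hdev i]

lemma sum_sq_scatterGram_ge (hL : LooBounds γ y c₁ ε t) (hγ : 0 < γ) (hγ1 : γ ≤ 1) (hn : 6 ≤ n)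
    (hc₁ : 0 < c₁) (i : Fin n) (J : Finset (Fin n)) (hJ : n ≤ 2 * J.card) :
    t / (1 + c₁⁻¹) ^ 2 ≤ γ * ∑ j ∈ J, scatterGram γ y 1 i j ^ 2 := by
  obtain ⟨hq0, hq1, -⟩ := hL.quad_mem hc₁ i
  -- From |J| ≥ n/2 and n ≥ 6: 3(|J| - 1) ≥ 3n/2 - 3 ≥ n.
  have hcard : n ≤ 3 * (J.erase i).card := by
    have := Finset.pred_card_le_card_erase (s := J) (a := i)
    omega
  have h1 := hL.small i (J.erase i) (Finset.notMem_erase i J) hcard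
  have h2 : ∑ j ∈ J.erase i, scatterGram γ y 1 i j ^ 2 ≤ ∑ j ∈ J, scatterGram γ y 1 i j ^ 2 :=
    Finset.sum_le_sum_of_subset_of_nonneg (Finset.erase_subset _ _) fun _ _ _ => sq_nonneg _
  refine le_trans ?_ (mul_le_mul_of_nonneg_left h2 hγ.le)
  simp only [hL.scatterGram_eq hγ hc₁, mul_pow]
  rw [← Finset.mul_sum, mul_left_comm, inv_pow, inv_mul_eq_div]
  have h3 : (0 : ℝ) < 1 + γ * (y i ⬝ᵥ (looScatter γ y i)⁻¹ *ᵥ y i) := by positivity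
  have h4 : γ * (y i ⬝ᵥ (looScatter γ y i)⁻¹ *ᵥ y i) ≤ c₁⁻¹ :=
    (mul_le_of_le_one_left hq0 hγ1).trans hq1
  gcongr

end LooBounds

end LeaveOneOut

/-! ### Tyler's equation: equivariance, existence and uniqueness. -/

section Transfer

open Matrix

variable {n p : ℕ}

/-- Tyler's equation, without the normalization of the trace. -/
def TylerFixed (γ : ℝ) (x : Fin n → Fin p → ℝ) (S : Matrix (Fin p) (Fin p) ℝ) : Prop :=
  S.PosDef ∧ S = weightedScatter γ x fun i => (x i ⬝ᵥ S⁻¹ *ᵥ x i)⁻¹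

variable {γ : ℝ} {x y : Fin n → Fin p → ℝ} {S : Matrix (Fin p) (Fin p) ℝ}

lemma TylerFixed.smul (h : TylerFixed γ x S) {k : ℝ} (hk : 0 < k) : TylerFixed γ x (k • S) := by
  refine ⟨h.1.smul hk, ?_⟩
  have hdet : IsUnit S.det := isUnit_iff_ne_zero.2 h.1.det_pos.ne'
  have hinv : (k • S)⁻¹ = k⁻¹ • S⁻¹ := by
    refine inv_eq_right_inv ?_
    rw [smul_mul_smul_comm, mul_inv_cancel₀ hk.ne', mul_nonsing_inv _ hdet, one_smul]
  conv_lhs => rw [h.2]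
  rw [weightedScatter, weightedScatter, smul_comm, Finset.smul_sum, hinv]
  congr 1
  refine Finset.sum_congr rfl fun i _ => ?_
  rw [smul_mulVec, dotProduct_smul, smul_eq_mul, mul_inv, inv_inv, smul_smul]

/-- A rescaling of x_i by b_i cancels between the numerator and the denominator of its term, so only
the linear map A acts on the solution. -/
lemma TylerFixed.conj {A : Matrix (Fin p) (Fin p) ℝ} (hA : A.det ≠ 0) (hAt : Aᵀ = A)
    {b : Fin n → ℝ} (hb : ∀ i, b i ≠ 0) (hy : ∀ i, y i = b i • (A *ᵥ x i))
    (h : TylerFixed γ x S) : TylerFixed γ y (A * S * A) := by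
  have hAu : IsUnit A.det := isUnit_iff_ne_zero.2 hA
  refine ⟨?_, ?_⟩
  · have h1 := h.1.mul_mul_conjTranspose_same (B := A) (by
      refine vecMul_injective_of_isUnit ?_
      exact (isUnit_iff_isUnit_det A).2 hAu)
    rwa [conjTranspose_eq_transpose_of_trivial, hAt] at h1
  · have hq : ∀ i, y i ⬝ᵥ (A * S * A)⁻¹ *ᵥ y i = b i ^ 2 * (x i ⬝ᵥ S⁻¹ *ᵥ x i) := fun i => by
      have h1 : A⁻¹ *ᵥ (A *ᵥ x i) = x i := by
        rw [mulVec_mulVec, nonsing_inv_mul _ hAu, one_mulVec]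
      have h2 : (A *ᵥ x i) ⬝ᵥ A⁻¹ *ᵥ (S⁻¹ *ᵥ x i) = x i ⬝ᵥ S⁻¹ *ᵥ x i := by
        rw [dotProduct_mulVec, ← mulVec_transpose, transpose_nonsing_inv, hAt, h1]
      rw [hy i, Matrix.mul_inv_rev, Matrix.mul_inv_rev, ← mulVec_mulVec, ← mulVec_mulVec, mulVec_smul, h1,
        mulVec_smul, mulVec_smul, smul_dotProduct, dotProduct_smul, h2]
      simp only [smul_eq_mul]
      ring
    conv_lhs => rw [h.2]
    rw [weightedScatter, weightedScatter, Matrix.mul_smul, Matrix.smul_mul, Matrix.mul_sum,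
      Matrix.sum_mul]
    congr 1
    refine Finset.sum_congr rfl fun i _ => ?_
    have h3 : A * vecMulVec (x i) (x i) * A = vecMulVec (A *ᵥ x i) (A *ᵥ x i) := by
      rw [mul_vecMulVec, vecMulVec_mul, ← mulVec_transpose, hAt]
    rw [Matrix.mul_smul, Matrix.smul_mul, h3, hq i, hy i, smul_vecMulVec, vecMulVec_smul,
      smul_smul, smul_smul, mul_inv]
    congr 1
    have := hb i
    field_simp

lemma solvesTyler_iff {z : Fin n → EuclideanSpace ℝ (Fin p)} :
    SolvesTyler z S ↔ TylerFixed ((p : ℝ) / n) (fun i => (z i).ofLp) S ∧ S.trace = 1 :=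
  ⟨fun h => ⟨⟨h.posDef, h.fixed⟩, h.trace_eq⟩, fun h => ⟨h.1.1, h.1.2, h.2⟩⟩

lemma opNorm_le_of_abs_dotProduct_le {A : Matrix (Fin p) (Fin p) ℝ} {C : ℝ} (hC : 0 ≤ C)
    (h : ∀ u v : Fin p → ℝ, (u ⬝ᵥ A *ᵥ v) ^ 2 ≤ C ^ 2 * ((u ⬝ᵥ u) * (v ⬝ᵥ v))) :
    opNorm A ≤ C := by
  refine ContinuousLinearMap.opNorm_le_bound _ hC fun v => ?_
  have h1 := h (A *ᵥ v.ofLp) v.ofLp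
  have h2 : ‖(Matrix.toEuclideanCLM (n := Fin p) (𝕜 := ℝ) A) v‖ ^ 2 =
      (A *ᵥ v.ofLp) ⬝ᵥ (A *ᵥ v.ofLp) := by
    rw [norm_sq_eq_dotProduct]; rfl
  rw [← h2, ← norm_sq_eq_dotProduct] at h1
  set a := ‖(Matrix.toEuclideanCLM (n := Fin p) (𝕜 := ℝ) A) v‖
  have ha : 0 ≤ a := norm_nonneg _
  rcases ha.eq_or_lt with h0 | h0
  · rw [← h0]; positivity
  · refine (pow_le_pow_iff_left₀ ha (by positivity) two_ne_zero).1 ?_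
    have h3 : a ^ 2 * a ^ 2 ≤ a ^ 2 * (C * ‖v‖) ^ 2 := by nlinarith
    exact le_of_mul_le_mul_left h3 (by positivity)

lemma opNorm_weightedScatter_sub_le {w : Fin n → ℝ} {ρ C : ℝ} (hγ : 0 ≤ γ) (hρ : 0 ≤ ρ)
    (hC : 0 ≤ C) (hA : ∀ u : Fin p → ℝ, γ * ∑ j, (u ⬝ᵥ y j) ^ 2 ≤ C * (u ⬝ᵥ u))
    (hw : ∀ j, |w j - 1| ≤ ρ) :
    opNorm (weightedScatter γ y w - weightedScatter γ y 1) ≤ ρ * C := by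
  refine opNorm_le_of_abs_dotProduct_le (by positivity) fun u v => ?_
  have h1 : u ⬝ᵥ (weightedScatter γ y w - weightedScatter γ y 1) *ᵥ v =
      γ * ∑ j, (w j - 1) * ((u ⬝ᵥ y j) * (v ⬝ᵥ y j)) := by
    rw [sub_mulVec, dotProduct_sub, dotProduct_weightedScatter_mulVec,
      dotProduct_weightedScatter_mulVec, ← mul_sub, ← Finset.sum_sub_distrib]
    simp [sub_mul]
  have h2 : (∑ j, (w j - 1) * ((u ⬝ᵥ y j) * (v ⬝ᵥ y j))) ^ 2 ≤
      (∑ j, ρ ^ 2 * (u ⬝ᵥ y j) ^ 2) * ∑ j, (v ⬝ᵥ y j) ^ 2 := by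
    refine Finset.sum_sq_le_sum_mul_sum_of_sq_le_mul _ (fun j _ => by positivity)
      (fun j _ => sq_nonneg _) fun j _ => ?_
    have : (w j - 1) ^ 2 ≤ ρ ^ 2 := by
      rw [← sq_abs]; exact pow_le_pow_left₀ (abs_nonneg _) (hw j) 2
    calc _ = (w j - 1) ^ 2 * ((u ⬝ᵥ y j) ^ 2 * (v ⬝ᵥ y j) ^ 2) := by ring
      _ ≤ ρ ^ 2 * ((u ⬝ᵥ y j) ^ 2 * (v ⬝ᵥ y j) ^ 2) := by gcongr
      _ = _ := by ring
  rw [← Finset.mul_sum] at h2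
  rw [h1, mul_pow]
  have hu := hA u
  have hv := hA v
  have hu0 := dotProduct_self_nonneg' u
  have h3 : 0 ≤ γ * ∑ j, (v ⬝ᵥ y j) ^ 2 := by positivity
  calc _ ≤ γ ^ 2 * (ρ ^ 2 * (∑ j, (u ⬝ᵥ y j) ^ 2) * ∑ j, (v ⬝ᵥ y j) ^ 2) := by gcongr
    _ = ρ ^ 2 * ((γ * ∑ j, (u ⬝ᵥ y j) ^ 2) * (γ * ∑ j, (v ⬝ᵥ y j) ^ 2)) := by ring
    _ ≤ ρ ^ 2 * ((C * (u ⬝ᵥ u)) * (C * (v ⬝ᵥ v))) := by gcongr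
    _ = _ := by ring

namespace LooBounds

variable {c₁ ε t : ℝ}

/-- Weights with ratios at most 1 + ρ and mean 1 lie within ρ of 1. Uniqueness needs coupling only
at the weights constructed here, so it holds against every solution. -/
lemma exists_tylerFixed (hL : LooBounds γ y c₁ ε t) (hγ : 0 < γ) (hγ1 : γ ≤ 1) (hn : 6 ≤ n)
    (hp : 1 ≤ p) (hγn : γ * n = p) (hc₁ : 0 < c₁) {c₀ ρ C : ℝ}
    (hc₀ : c₀ = t / (1 + c₁⁻¹) ^ 2) (hc₀0 : 0 < c₀)
    (hc₀1 : c₀ ≤ 1) (hρ0 : 0 < ρ) (hρ : ρ ≤ c₀ / 8)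
    (hε : 2 * (ε + c₁⁻¹ / p) ≤ c₀ * ρ / 512) (hC : 0 ≤ C)
    (hA : ∀ u : Fin p → ℝ, γ * ∑ j, (u ⬝ᵥ y j) ^ 2 ≤ C * (u ⬝ᵥ u)) :
    ∃ S, TylerFixed γ y S ∧ S.trace = p ∧ opNorm (S - weightedScatter γ y 1) ≤ ρ * C ∧
      ∀ S', TylerFixed γ y S' → ∃ b > (0 : ℝ), S' = b • S := by
  have hn1 : 1 ≤ n := by omega
  have : Nonempty (Fin n) := ⟨⟨0, hn1⟩⟩
  have hn0 : (0 : ℝ) < n := by exact_mod_cast hn1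
  have hK := hL.gramSystem hγ hn1 hc₁
  have hdev := hL.abs_scatterGram_diag_sub_one_le hγ hn1 hp hγn hc₁
  have hsum := fun i J (hJ : Fintype.card (Fin n) ≤ 2 * J.card) =>
    hL.sum_sq_scatterGram_ge hγ hγ1 hn hc₁ i J (by rwa [Fintype.card_fin] at hJ)
  rw [← hc₀] at hsum
  set ε₀ := 2 * (ε + c₁⁻¹ / p)
  have hε₀ : ε₀ ≤ 1 / 2 := hε.trans (by nlinarith)
  have hε₀0 : 0 ≤ ε₀ := (abs_nonneg _).trans (hdev ⟨0, hn1⟩)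
  have hdiag : ∀ i, scatterGram γ y 1 i i ≤ 2 := fun i => by
    have := (abs_le.1 (hdev i)).2
    linarith
  have hρ2 : ρ ≤ 1 / 2 := by linarith
  have hρc : 32 * ρ ^ 2 ≤ c₀ := by nlinarith
  have hcoup : ∀ w : Fin n → ℝ, (∀ i, 0 < w i) → (∀ i k, w i ≤ (1 + ρ) * w k) →
      Coupled γ (c₀ / 32) (scatterGram γ y w) w := fun w hw hwr =>
    hK.coupled_of_ratio_le hρ0.le hρ2 hρc hw hwr hdiag hsum
  -- Diagonal entries within ε₀ ≤ 1/2 of 1 have ratios at most 1 + 4ε₀, and 4ε₀ ≤ c₀ρ/128 is the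
  -- required c ρ/4 for c = c₀/32.
  obtain ⟨w₀, hw₀, hwr₀, hfix₀⟩ := hK.exists_fixed (by rw [Fintype.card_fin, hγn]) (c := c₀ / 32)
    (ρ := ρ) (η := 4 * ε₀) (by positivity) (by linarith) hρ0 (by linarith) (by linarith) hcoup
    fun i k => by
      have h1 := (abs_le.1 (hdev i)).2
      have h2 := (abs_le.1 (hdev k)).1
      nlinarith
  set s := ∑ i, w₀ i with hs
  have hs0 : 0 < s := Finset.sum_pos (fun i _ => hw₀ i) Finset.univ_nonempty
  -- Total weight n gives trace γn = p, as the y_i are unit vectors.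
  set w : Fin n → ℝ := ((n : ℝ) / s) • w₀ with hwd
  have hns : 0 < (n : ℝ) / s := by positivity
  have hw : ∀ i, 0 < w i := fun i => mul_pos hns (hw₀ i)
  have hwr : ∀ i k, w i ≤ (1 + ρ) * w k := fun i k => by
    have := mul_le_mul_of_nonneg_left (hwr₀ i k) hns.le
    simp only [hwd, Pi.smul_apply, smul_eq_mul]
    linarith
  have hfix : ∀ i, w i * scatterGram γ y w i i = 1 := fun i => by
    rw [hK.smul hw₀ hns, ← hfix₀ i]
    simp only [hwd, Pi.smul_apply, smul_eq_mul]
    field_simp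
  have hwsum : ∑ i, w i = n := by
    simp only [hwd, Pi.smul_apply, smul_eq_mul]
    rw [← Finset.mul_sum, ← hs]
    field_simp
  have hw1 : ∀ j, |w j - 1| ≤ ρ := fun j => by
    have h1 : n * w j ≤ n * (1 + ρ) := by
      calc n * w j = ∑ i : Fin n, w j := by simp
        _ ≤ ∑ i, (1 + ρ) * w i := Finset.sum_le_sum fun i _ => hwr j i
        _ = _ := by rw [← Finset.mul_sum, hwsum]; ring
    have h2 : (n : ℝ) * 1 ≤ n * ((1 + ρ) * w j) := by
      calc (n : ℝ) * 1 = ∑ i, w i := by rw [hwsum, mul_one]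
        _ ≤ ∑ i : Fin n, (1 + ρ) * w j := Finset.sum_le_sum fun i _ => hwr i j
        _ = _ := by simp
    have h3 := le_of_mul_le_mul_left h1 hn0
    have h4 := le_of_mul_le_mul_left h2 hn0
    rw [abs_le]
    constructor <;> nlinarith
  have hyne := hL.exists_dotProduct_ne_zero hn1 hc₁
  refine ⟨weightedScatter γ y w, ⟨weightedScatter_posDef hγ hw hyne, ?_⟩, ?_,
    opNorm_weightedScatter_sub_le hγ.le hρ0.le hC hA hw1, ?_⟩
  · congr 1
    exact funext fun i => eq_inv_of_mul_eq_one_left (hfix i)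
  · rw [weightedScatter, trace_smul, trace_sum]
    simp only [trace_smul, trace_vecMulVec, hL.unit, smul_eq_mul, mul_one]
    rw [hwsum, hγn]
  · rintro S' ⟨hS', hS'e⟩
    set w' : Fin n → ℝ := fun i => (y i ⬝ᵥ S'⁻¹ *ᵥ y i)⁻¹ with hw'd
    have hw' : ∀ i, 0 < w' i := fun i => inv_pos.2 (by
      have := hS'.inv.dotProduct_mulVec_pos (hL.ne_zero i)
      simpa using this)
    have hfix' : ∀ i, w' i * scatterGram γ y w' i i = 1 := fun i => by
      rw [scatterGram, ← hS'e]
      exact inv_mul_cancel₀ (inv_pos.1 (hw' i)).ne'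
    obtain ⟨b, hb, hbw⟩ := hK.eq_smul_of_fixed hw hw' (by positivity) (hcoup w hw hwr) hfix hfix'
    refine ⟨b, hb, ?_⟩
    rw [hS'e, hbw, weightedScatter, weightedScatter]
    simp only [Finset.smul_sum, smul_smul, Pi.smul_apply, smul_eq_mul]
    exact Finset.sum_congr rfl fun j _ => by rw [mul_left_comm]

end LooBounds

/-- Conjugation by A = `invSqrt T` and by its inverse exchanges solutions for the samples and for
the directions. The scalar k fixes trace 1, and since tr S₀ = p the whitened normalization returns
exactly S₀. -/
theorem exists_isTylerEstimator {T : Matrix (Fin p) (Fin p) ℝ} (hT : T.PosDef)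
    {z : Fin n → EuclideanSpace ℝ (Fin p)} {c₁ ε t : ℝ}
    (hL : LooBounds ((p : ℝ) / n) (fun i => (whitenedDirection T (z i)).ofLp) c₁ ε t)
    (hpn : p ≤ n) (hn : 6 ≤ n) (hp : 1 ≤ p) (hc₁ : 0 < c₁) {c₀ ρ C : ℝ}
    (hc₀ : c₀ = t / (1 + c₁⁻¹) ^ 2) (hc₀0 : 0 < c₀)
    (hc₀1 : c₀ ≤ 1) (hρ0 : 0 < ρ) (hρ : ρ ≤ c₀ / 8)
    (hε : 2 * (ε + c₁⁻¹ / p) ≤ c₀ * ρ / 512) (hC : 0 ≤ C)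
    (hA : ∀ u : Fin p → ℝ,
      (p : ℝ) / n * ∑ j, (u ⬝ᵥ (whitenedDirection T (z j)).ofLp) ^ 2 ≤ C * (u ⬝ᵥ u)) :
    ∃ S, IsTylerEstimator z S ∧ opNorm (whitenedNormalized T S -
      ((p : ℝ) / n) • ∑ i, outer (whitenedDirection T (z i))) ≤ ρ * C := by
  have hn0 : (0 : ℝ) < n := by have : 0 < n := by omega
                               exact_mod_cast this
  have hp0 : (0 : ℝ) < p := by exact_mod_cast hp
  obtain ⟨S₀, hS₀, htr, hop, huniq⟩ := hL.exists_tylerFixed (by positivity)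
    (by rw [div_le_one hn0]; exact_mod_cast hpn) hn hp (by field_simp) hc₁ hc₀ hc₀0 hc₀1 hρ0 hρ hε
    hC hA
  set A := invSqrt T with hAd
  have hA0 : A.det ≠ 0 := (invSqrt_det_pos hT).ne'
  have hAu : IsUnit A.det := isUnit_iff_ne_zero.2 hA0
  have hAt : Aᵀ = A := invSqrt_transpose
  set b : Fin n → ℝ := fun i =>
    ‖(WithLp.toLp 2 (A *ᵥ (z i).ofLp) : EuclideanSpace ℝ (Fin p))‖⁻¹ with hb
  have hy : ∀ i, (whitenedDirection T (z i)).ofLp = b i • (A *ᵥ (z i).ofLp) := fun i => rfl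
  have hb0 : ∀ i, b i ≠ 0 := fun i h => by
    have := hL.unit i
    simp only [hy i, h] at this
    simp at this
  have hfwd : ∀ S, TylerFixed ((p : ℝ) / n) (fun i => (z i).ofLp) S →
      TylerFixed ((p : ℝ) / n) (fun i => (whitenedDirection T (z i)).ofLp) (A * S * A) :=
    fun S hS => hS.conj hA0 hAt hb0 hy
  have hAi0 : A⁻¹.det ≠ 0 := by
    rw [det_nonsing_inv, Ring.inverse_eq_inv']; exact inv_ne_zero hA0
  have hS₁ : TylerFixed ((p : ℝ) / n) (fun i => (z i).ofLp) (A⁻¹ * S₀ * A⁻¹) :=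
    hS₀.conj hAi0 (by rw [transpose_nonsing_inv, hAt]) (fun i => inv_ne_zero (hb0 i)) fun i => by
      rw [hy i, mulVec_smul, mulVec_mulVec, nonsing_inv_mul _ hAu, one_mulVec, smul_smul,
        inv_mul_cancel₀ (hb0 i), one_smul]
  have : Nonempty (Fin p) := ⟨⟨0, hp⟩⟩
  have htr1 : 0 < (A⁻¹ * S₀ * A⁻¹).trace := hS₁.1.trace_pos
  set k := (A⁻¹ * S₀ * A⁻¹).trace⁻¹ with hk
  have hk0 : 0 < k := inv_pos.2 htr1
  have hconj : A * (k • (A⁻¹ * S₀ * A⁻¹)) * A = k • S₀ := by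
    rw [Matrix.mul_smul, Matrix.smul_mul, Matrix.mul_assoc A⁻¹, ← Matrix.mul_assoc A,
      mul_nonsing_inv _ hAu, Matrix.one_mul, Matrix.mul_assoc, nonsing_inv_mul _ hAu,
      Matrix.mul_one]
  refine ⟨k • (A⁻¹ * S₀ * A⁻¹), ⟨?_, ?_⟩, ?_⟩
  · refine solvesTyler_iff.2 ⟨hS₁.smul hk0, ?_⟩
    rw [trace_smul, smul_eq_mul, hk, inv_mul_cancel₀ htr1.ne']
  · intro S' hS'
    obtain ⟨hS'f, hS't⟩ := solvesTyler_iff.1 hS'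
    obtain ⟨c, hc, hcS⟩ := huniq _ (hfwd S' hS'f)
    have h1 : S' = c • (A⁻¹ * S₀ * A⁻¹) := by
      calc S' = A⁻¹ * (A * S' * A) * A⁻¹ := by
            rw [Matrix.mul_assoc A, ← Matrix.mul_assoc A⁻¹, nonsing_inv_mul _ hAu,
              Matrix.one_mul, Matrix.mul_assoc, mul_nonsing_inv _ hAu, Matrix.mul_one]
        _ = _ := by rw [hcS, Matrix.mul_smul, Matrix.smul_mul]
    rw [h1, trace_smul, smul_eq_mul] at hS't
    rw [h1, hk, eq_inv_of_mul_eq_one_left hS't]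
  · have h1 : whitenedNormalized T (k • (A⁻¹ * S₀ * A⁻¹)) = S₀ := by
      rw [whitenedNormalized, ← hAd, hconj, trace_smul, htr, smul_smul, smul_eq_mul]
      have : (p : ℝ) / (k * p) * k = 1 := by field_simp
      rw [this, one_smul]
    have h2 : ((p : ℝ) / n) • ∑ i, outer (whitenedDirection T (z i)) =
        weightedScatter ((p : ℝ) / n) (fun i => (whitenedDirection T (z i)).ofLp) 1 := by
      simp [weightedScatter, outer]
    rw [h1, h2]
    exact hop

end Transfer

/-! ### Conditioning on all points but one. -/

section Fubini

lemma pi_le_of_update_le {n : ℕ} {α : Type*} [MeasurableSpace α] (μ : Measure α)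
    [IsProbabilityMeasure μ] {A : Set (Fin n → α)} (hA : MeasurableSet A) (i : Fin n)
    {δ : ENNReal} (h : ∀ Y : Fin n → α, μ {x | Function.update Y i x ∈ A} ≤ δ) :
    (Measure.pi fun _ : Fin n => μ) A ≤ δ := by
  cases n with
  | zero => exact i.elim0
  | succ m =>
    have hmp := (measurePreserving_piFinSuccAbove (fun _ : Fin (m + 1) => μ) i).symm
    have : Nonempty α := nonempty_of_isProbabilityMeasure μ
    obtain ⟨x₀⟩ := this
    rw [← hmp.measure_preimage hA.nullMeasurableSet, Measure.prod_apply_symm (hmp.measurable hA)]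
    calc _ ≤ ∫⁻ _, δ ∂(Measure.pi fun _ : Fin m => μ) := by
          refine lintegral_mono fun Y => ?_
          refine (measure_mono fun x hx => ?_).trans (h (i.insertNth x₀ Y))
          have h1 : (i.insertNth x Y : Fin (m + 1) → α) ∈ A := hx
          change Function.update (i.insertNth x₀ Y : Fin (m + 1) → α) i x ∈ A
          rwa [Fin.update_insertNth]
      _ = δ := by simp

end Fubini

/-! ### Probabilities of the leave-one-out events. -/

section LooEvents

open Matrix

variable {n p : ℕ} {γ : ℝ}

lemma looScatter_congr {y y' : Fin n → Fin p → ℝ} (i : Fin n) (h : ∀ j, j ≠ i → y j = y' j) :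
    looScatter γ y i = looScatter γ y' i := by
  rw [looScatter, looScatter]
  congr 1
  exact Finset.sum_congr rfl fun j hj => by rw [h j (Finset.ne_of_mem_erase hj)]

lemma abs_dotProduct_looScatter_inv_le {y : Fin n → Fin p → ℝ} {c₁ : ℝ} (hc₁ : 0 < c₁) {i : Fin n}
    (hlow : ∀ u : Fin p → ℝ, c₁ * (u ⬝ᵥ u) ≤ γ * ∑ j ∈ Finset.univ.erase i, (u ⬝ᵥ y j) ^ 2)
    (v : Fin p → ℝ) :
    0 ≤ v ⬝ᵥ (looScatter γ y i)⁻¹ *ᵥ v ∧ v ⬝ᵥ (looScatter γ y i)⁻¹ *ᵥ v ≤ c₁⁻¹ * (v ⬝ᵥ v) := by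
  have hS := looScatter_posDef hc₁ hlow
  refine ⟨?_, (dotProduct_inv_mulVec_le hS hc₁ (fun u => ?_) v).1⟩
  · have := hS.inv.posSemidef.dotProduct_mulVec_nonneg v
    simpa using this
  · rw [dotProduct_looScatter_mulVec]; simpa only [sq] using hlow u

lemma uniformSphere_looScatter_conc_le (hp : 1 ≤ p) {y : Fin n → Fin p → ℝ} {c₁ ε : ℝ}
    (hc₁ : 0 < c₁) (hε : 0 < ε) (hε1 : ε ≤ c₁⁻¹) {i : Fin n}
    (hlow : ∀ u : Fin p → ℝ, c₁ * (u ⬝ᵥ u) ≤ γ * ∑ j ∈ Finset.univ.erase i, (u ⬝ᵥ y j) ^ 2) :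
    uniformSphere p {x | ε ≤ |x.ofLp ⬝ᵥ (looScatter γ y i)⁻¹ *ᵥ x.ofLp -
        (looScatter γ y i)⁻¹.trace / p|} ≤
      2 * ENNReal.ofReal (Real.exp (-(ε ^ 2 * p * c₁ ^ 2 / 144))) := by
  have h := uniformSphere_abs_quadForm_sub_ge_le hp
    (looScatter_posDef hc₁ hlow).inv.isHermitian (inv_pos.2 hc₁) hε hε1 fun v => by
      obtain ⟨h1, h2⟩ := abs_dotProduct_looScatter_inv_le hc₁ hlow v
      rwa [abs_of_nonneg h1]
  refine h.trans (le_of_eq ?_)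
  congr 4
  field_simp

/-- With z = S_i⁻¹v, Cauchy–Schwarz for the form S_i gives 1 = (v · S_i z)² ≤ (v · S_i v)(z · S_i
z). -/
lemma one_le_mul_dotProduct_inv_mulVec {y : Fin n → Fin p → ℝ} {c₁ C : ℝ} (hγ : 0 ≤ γ)
    (hc₁ : 0 < c₁) {i : Fin n}
    (hlow : ∀ u : Fin p → ℝ, c₁ * (u ⬝ᵥ u) ≤ γ * ∑ j ∈ Finset.univ.erase i, (u ⬝ᵥ y j) ^ 2)
    (hup : ∀ u : Fin p → ℝ, γ * ∑ j ∈ Finset.univ.erase i, (u ⬝ᵥ y j) ^ 2 ≤ C * (u ⬝ᵥ u))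
    {v : Fin p → ℝ} (hv : v ⬝ᵥ v = 1) :
    1 ≤ C ^ 2 * (((looScatter γ y i)⁻¹ *ᵥ v) ⬝ᵥ ((looScatter γ y i)⁻¹ *ᵥ v)) := by
  have hS := looScatter_posDef hc₁ hlow
  set z := (looScatter γ y i)⁻¹ *ᵥ v with hz
  have h1 : v ⬝ᵥ looScatter γ y i *ᵥ z = 1 := by
    rw [hz, posDef_mulVec_inv_mulVec hS, hv]
  rw [dotProduct_looScatter_mulVec] at h1
  have h2 : (∑ j ∈ Finset.univ.erase i, ((v ⬝ᵥ y j) * (z ⬝ᵥ y j))) ^ 2 ≤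
      (∑ j ∈ Finset.univ.erase i, (v ⬝ᵥ y j) ^ 2) * ∑ j ∈ Finset.univ.erase i, (z ⬝ᵥ y j) ^ 2 :=
    Finset.sum_mul_sq_le_sq_mul_sq _ _ _
  have hv' := hup v
  have hz' := hup z
  have h3 : 0 ≤ γ * ∑ j ∈ Finset.univ.erase i, (z ⬝ᵥ y j) ^ 2 := by positivity
  have h4 : 0 ≤ γ * ∑ j ∈ Finset.univ.erase i, (v ⬝ᵥ y j) ^ 2 := by positivity
  calc (1 : ℝ) = γ ^ 2 * (∑ j ∈ Finset.univ.erase i, ((v ⬝ᵥ y j) * (z ⬝ᵥ y j))) ^ 2 := by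
        rw [← mul_pow, h1, one_pow]
    _ ≤ γ ^ 2 * ((∑ j ∈ Finset.univ.erase i, (v ⬝ᵥ y j) ^ 2) *
          ∑ j ∈ Finset.univ.erase i, (z ⬝ᵥ y j) ^ 2) := by gcongr
    _ = (γ * ∑ j ∈ Finset.univ.erase i, (v ⬝ᵥ y j) ^ 2) *
          (γ * ∑ j ∈ Finset.univ.erase i, (z ⬝ᵥ y j) ^ 2) := by ring
    _ ≤ (C * (v ⬝ᵥ v)) * (C * (z ⬝ᵥ z)) :=
        mul_le_mul hv' hz' h3 (h4.trans hv')
    _ = _ := by rw [hv]; ring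

/-- The sum is a quadratic form B = γ ∑_J z_j z_jᵀ with z_j = S_i⁻¹y_j. Dropping terms gives B ≤
S_i⁻¹S_iS_i⁻¹ = S_i⁻¹ ≤ 1/c₁, while |z_j| ≥ 1/C gives tr B ≥ p/(3C²). A form that is bounded with
trace of order p has a small-ball estimate. -/
lemma uniformSphere_looScatter_small_le (hp : 1 ≤ p) {y : Fin n → Fin p → ℝ} {c₁ C t : ℝ}
    (hγ : 0 < γ) (hγn : γ * n = p) (hc₁ : 0 < c₁) (hC : 0 < C) (ht : 0 < t) {i : Fin n}
    (hlow : ∀ u : Fin p → ℝ, c₁ * (u ⬝ᵥ u) ≤ γ * ∑ j ∈ Finset.univ.erase i, (u ⬝ᵥ y j) ^ 2)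
    (hup : ∀ u : Fin p → ℝ, γ * ∑ j ∈ Finset.univ.erase i, (u ⬝ᵥ y j) ^ 2 ≤ C * (u ⬝ᵥ u))
    (hunit : ∀ j, j ≠ i → y j ⬝ᵥ y j = 1) {J : Finset (Fin n)} (hiJ : i ∉ J)
    (hJ : n ≤ 3 * J.card) :
    uniformSphere p {x | γ * ∑ j ∈ J, (x.ofLp ⬝ᵥ (looScatter γ y i)⁻¹ *ᵥ y j) ^ 2 ≤ t} ≤
      ENNReal.ofReal (Real.exp (-(p / 2 * (c₁ / (3 * C ^ 2) * Real.log (1 + 1 / (c₁ * t)) -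
        Real.log 2)))) := by
  have hS := looScatter_posDef hc₁ hlow
  set z : Fin n → Fin p → ℝ := fun j => (looScatter γ y i)⁻¹ *ᵥ y j with hz
  set B := weightedScatter γ z fun j => if j ∈ J then 1 else 0 with hB
  have hBv : ∀ v : Fin p → ℝ, v ⬝ᵥ B *ᵥ v = γ * ∑ j ∈ J, (v ⬝ᵥ z j) ^ 2 := fun v => by
    rw [hB, dotProduct_weightedScatter_mulVec, ← Finset.univ_inter J, ← Finset.sum_ite_mem]
    congr 1
    refine Finset.sum_congr rfl fun j _ => ?_
    by_cases h : j ∈ J <;> simp [h, sq]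
  have hJi : J ⊆ Finset.univ.erase i := fun j hj =>
    Finset.mem_erase.2 ⟨fun h => hiJ (h ▸ hj), Finset.mem_univ j⟩
  have hBup : ∀ v : Fin p → ℝ, v ⬝ᵥ B *ᵥ v ≤ c₁⁻¹ * (v ⬝ᵥ v) := fun v => by
    rw [hBv]
    refine le_trans ?_ (abs_dotProduct_looScatter_inv_le hc₁ hlow v).2
    have h1 : v ⬝ᵥ (looScatter γ y i)⁻¹ *ᵥ v = ((looScatter γ y i)⁻¹ *ᵥ v) ⬝ᵥ
        looScatter γ y i *ᵥ ((looScatter γ y i)⁻¹ *ᵥ v) := by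
      rw [posDef_mulVec_inv_mulVec hS, dotProduct_comm]
    rw [h1, dotProduct_looScatter_mulVec]
    refine mul_le_mul_of_nonneg_left ?_ hγ.le
    refine le_trans (le_of_eq (Finset.sum_congr rfl fun j _ => ?_))
      (Finset.sum_le_sum_of_subset_of_nonneg hJi fun j _ _ => mul_self_nonneg _)
    rw [hz]
    simp only
    rw [dotProduct_mulVec_comm hS.inv.isHermitian, dotProduct_comm (y j), sq]
  have htr : 1 / (3 * C ^ 2) * p ≤ B.trace := by
    have h1 : B.trace = γ * ∑ j ∈ J, z j ⬝ᵥ z j := by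
      rw [hB, weightedScatter, trace_smul, trace_sum, ← Finset.univ_inter J, ← Finset.sum_ite_mem,
        smul_eq_mul]
      congr 1
      refine Finset.sum_congr rfl fun j _ => ?_
      by_cases h : j ∈ J <;> simp [h, trace_vecMulVec]
    have h2 : ∀ j ∈ J, 1 / C ^ 2 ≤ z j ⬝ᵥ z j := fun j hj => by
      rw [div_le_iff₀' (by positivity)]
      exact one_le_mul_dotProduct_inv_mulVec hγ.le hc₁ hlow hup
        (hunit j (Finset.ne_of_mem_erase (hJi hj)))
    have h3 := Finset.card_nsmul_le_sum J _ _ h2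
    rw [nsmul_eq_mul] at h3
    have h4 : (n : ℝ) ≤ 3 * J.card := by exact_mod_cast hJ
    rw [h1]
    calc 1 / (3 * C ^ 2) * p = γ * (n / 3 * (1 / C ^ 2)) := by rw [← hγn]; field_simp
      _ ≤ γ * (J.card * (1 / C ^ 2)) := by
        have : (n : ℝ) / 3 ≤ J.card := by linarith
        gcongr
      _ ≤ _ := by gcongr
  have h := uniformSphere_quadForm_le_le hp (B := B) weightedScatter_isHermitian (inv_pos.2 hc₁) ht
    (fun v => by rw [hBv]; positivity) hBup htr
  have hset : {x : EuclideanSpace ℝ (Fin p) | quadForm B x ≤ t} =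
      {x | γ * ∑ j ∈ J, (x.ofLp ⬝ᵥ (looScatter γ y i)⁻¹ *ᵥ y j) ^ 2 ≤ t} := by
    ext x
    change quadForm B x ≤ t ↔ _ ≤ t
    rw [quadForm, hBv]
  rw [hset] at h
  refine h.trans (le_of_eq ?_)
  congr 5
  have h1 : 1 / (3 * C ^ 2) / c₁⁻¹ = c₁ / (3 * C ^ 2) := by field_simp
  have h2 : c₁⁻¹ / t = 1 / (c₁ * t) := by field_simp
  rw [h1, h2]

/-- The vectors of coordinates of the points `Y`. -/
def coords (Y : Fin n → EuclideanSpace ℝ (Fin p)) (j : Fin n) : Fin p → ℝ := (Y j).ofLp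

lemma continuous_coords (j : Fin n) :
    Continuous fun Y : Fin n → EuclideanSpace ℝ (Fin p) => coords Y j :=
  (PiLp.continuous_ofLp 2 _).comp (continuous_apply j)

lemma continuous_looScatter (i : Fin n) :
    Continuous fun Y : Fin n → EuclideanSpace ℝ (Fin p) => looScatter γ (coords Y) i := by
  have := continuous_coords (n := n) (p := p)
  unfold looScatter
  refine Continuous.const_smul (continuous_finsetSum _ fun j _ => ?_) γ
  exact (this j).matrix_vecMulVec (this j)

lemma coords_update_of_ne {Y : Fin n → EuclideanSpace ℝ (Fin p)} {i j : Fin n} (h : j ≠ i)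
    (x : EuclideanSpace ℝ (Fin p)) : coords (Function.update Y i x) j = coords Y j := by
  rw [coords, Function.update_of_ne h, coords]

lemma coords_update_self {Y : Fin n → EuclideanSpace ℝ (Fin p)} {i : Fin n}
    (x : EuclideanSpace ℝ (Fin p)) : coords (Function.update Y i x) i = x.ofLp := by
  rw [coords, Function.update_self]

lemma looScatter_coords_update (Y : Fin n → EuclideanSpace ℝ (Fin p)) (i : Fin n)
    (x : EuclideanSpace ℝ (Fin p)) :
    looScatter γ (coords (Function.update Y i x)) i = looScatter γ (coords Y) i :=
  looScatter_congr i fun _ hj => coords_update_of_ne hj x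

lemma inv_eq_smul_adjugate (A : Matrix (Fin p) (Fin p) ℝ) : A⁻¹ = A.det⁻¹ • A.adjugate := by
  rw [inv_def, Ring.inverse_eq_inv']

lemma measurable_dotProduct_looScatter_inv (i j k : Fin n) :
    Measurable fun Y : Fin n → EuclideanSpace ℝ (Fin p) =>
      coords Y k ⬝ᵥ (looScatter γ (coords Y) i)⁻¹ *ᵥ coords Y j := by
  have hL := continuous_looScatter (n := n) (p := p) (γ := γ) i
  have hc := continuous_coords (n := n) (p := p)
  simp only [inv_eq_smul_adjugate, smul_mulVec, dotProduct_smul, smul_eq_mul]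
  exact hL.matrix_det.measurable.inv.mul
    ((hc k).dotProduct (hL.matrix_adjugate.matrix_mulVec (hc j))).measurable

lemma measurable_trace_looScatter_inv (i : Fin n) :
    Measurable fun Y : Fin n → EuclideanSpace ℝ (Fin p) =>
      (looScatter γ (coords Y) i)⁻¹.trace := by
  have hL := continuous_looScatter (n := n) (p := p) (γ := γ) i
  simp only [inv_eq_smul_adjugate, trace_smul, smul_eq_mul]
  exact hL.matrix_det.measurable.inv.mul hL.matrix_adjugate.matrix_trace.measurable

/-- The leave-one-out scatter matrix is bounded below by `c₁`. -/
def LooLower (γ c₁ : ℝ) (i : Fin n) (Y : Fin n → EuclideanSpace ℝ (Fin p)) : Prop :=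
  ∀ u : Fin p → ℝ, c₁ * (u ⬝ᵥ u) ≤ γ * ∑ j ∈ Finset.univ.erase i, (u ⬝ᵥ coords Y j) ^ 2

/-- The leave-one-out scatter matrix is bounded above by `C`. -/
def LooUpper (γ C : ℝ) (i : Fin n) (Y : Fin n → EuclideanSpace ℝ (Fin p)) : Prop :=
  ∀ u : Fin p → ℝ, γ * ∑ j ∈ Finset.univ.erase i, (u ⬝ᵥ coords Y j) ^ 2 ≤ C * (u ⬝ᵥ u)

lemma continuous_sum_sq_dotProduct (u : Fin p → ℝ) (s : Finset (Fin n)) :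
    Continuous fun Y : Fin n → EuclideanSpace ℝ (Fin p) => γ * ∑ j ∈ s, (u ⬝ᵥ coords Y j) ^ 2 :=
  continuous_const.mul (continuous_finsetSum _ fun j _ =>
    (continuous_const.dotProduct (continuous_coords j)).pow 2)

/-- The intersection over u is uncountable; measurability comes from closedness. -/
lemma measurableSet_looLower (γ c₁ : ℝ) (i : Fin n) :
    MeasurableSet {Y : Fin n → EuclideanSpace ℝ (Fin p) | LooLower γ c₁ i Y} := by
  have : {Y : Fin n → EuclideanSpace ℝ (Fin p) | LooLower γ c₁ i Y} = ⋂ u : Fin p → ℝ,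
      {Y | c₁ * (u ⬝ᵥ u) ≤ γ * ∑ j ∈ Finset.univ.erase i, (u ⬝ᵥ coords Y j) ^ 2} := by
    ext Y; simp [LooLower]
  rw [this]
  exact (isClosed_iInter fun u =>
    isClosed_le continuous_const (continuous_sum_sq_dotProduct u _)).measurableSet

lemma measurableSet_looUpper (γ C : ℝ) (i : Fin n) :
    MeasurableSet {Y : Fin n → EuclideanSpace ℝ (Fin p) | LooUpper γ C i Y} := by
  have : {Y : Fin n → EuclideanSpace ℝ (Fin p) | LooUpper γ C i Y} = ⋂ u : Fin p → ℝ,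
      {Y | γ * ∑ j ∈ Finset.univ.erase i, (u ⬝ᵥ coords Y j) ^ 2 ≤ C * (u ⬝ᵥ u)} := by
    ext Y; simp [LooUpper]
  rw [this]
  exact (isClosed_iInter fun u =>
    isClosed_le (continuous_sum_sq_dotProduct u _) continuous_const).measurableSet

lemma looLower_update {c₁ : ℝ} {i : Fin n} {Y : Fin n → EuclideanSpace ℝ (Fin p)}
    {x : EuclideanSpace ℝ (Fin p)} (h : LooLower γ c₁ i (Function.update Y i x)) :
    LooLower γ c₁ i Y := fun u => (h u).trans (le_of_eq (by
  congr 1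
  exact Finset.sum_congr rfl fun j hj => by rw [coords_update_of_ne (Finset.ne_of_mem_erase hj)]))

lemma looUpper_update {C : ℝ} {i : Fin n} {Y : Fin n → EuclideanSpace ℝ (Fin p)}
    {x : EuclideanSpace ℝ (Fin p)} (h : LooUpper γ C i (Function.update Y i x)) :
    LooUpper γ C i Y := fun u => (le_of_eq (by
  congr 1
  exact Finset.sum_congr rfl fun j hj => by
    rw [coords_update_of_ne (Finset.ne_of_mem_erase hj)])).trans (h u)

lemma spherePi_conc_le (hp : 1 ≤ p) {c₁ ε : ℝ} (hc₁ : 0 < c₁) (hε : 0 < ε) (hε1 : ε ≤ c₁⁻¹)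
    (i : Fin n) :
    spherePi n p {Y | LooLower γ c₁ i Y ∧
      ε ≤ |coords Y i ⬝ᵥ (looScatter γ (coords Y) i)⁻¹ *ᵥ coords Y i -
        (looScatter γ (coords Y) i)⁻¹.trace / p|} ≤
      2 * ENNReal.ofReal (Real.exp (-(ε ^ 2 * p * c₁ ^ 2 / 144))) := by
  have := isProbabilityMeasure_uniformSphere hp
  refine pi_le_of_update_le _ ?_ i fun Y => ?_
  · have h2 : MeasurableSet {Y : Fin n → EuclideanSpace ℝ (Fin p) |
        ε ≤ |coords Y i ⬝ᵥ (looScatter γ (coords Y) i)⁻¹ *ᵥ coords Y i -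
          (looScatter γ (coords Y) i)⁻¹.trace / p|} :=
      measurableSet_le measurable_const ((measurable_dotProduct_looScatter_inv i i i).sub
        ((measurable_trace_looScatter_inv i).div_const _)).abs
    exact (measurableSet_looLower γ c₁ i).inter h2
  -- The lower bound involves only the points other than Y_i, so each slice is either contained in
  -- the conditional event or empty.
  · by_cases hlow : LooLower γ c₁ i Y
    · refine (measure_mono fun x hx => ?_).trans
        (uniformSphere_looScatter_conc_le hp hc₁ hε hε1 hlow)
      have h1 := hx.2
      rwa [looScatter_coords_update, coords_update_self] at h1
    · refine (measure_mono (t := ∅) fun x hx => hlow (looLower_update hx.1)).trans ?_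
      simp

lemma spherePi_small_le (hp : 1 ≤ p) {c₁ C t : ℝ} (hγ : 0 < γ) (hγn : γ * n = p) (hc₁ : 0 < c₁)
    (hC : 0 < C) (ht : 0 < t) (i : Fin n) {J : Finset (Fin n)} (hiJ : i ∉ J)
    (hJ : n ≤ 3 * J.card) :
    spherePi n p {Y | (LooLower γ c₁ i Y ∧ LooUpper γ C i Y ∧
        ∀ j, j ≠ i → coords Y j ⬝ᵥ coords Y j = 1) ∧
      γ * ∑ j ∈ J, (coords Y i ⬝ᵥ (looScatter γ (coords Y) i)⁻¹ *ᵥ coords Y j) ^ 2 ≤ t} ≤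
      ENNReal.ofReal (Real.exp (-(p / 2 * (c₁ / (3 * C ^ 2) * Real.log (1 + 1 / (c₁ * t)) -
        Real.log 2)))) := by
  have := isProbabilityMeasure_uniformSphere hp
  refine pi_le_of_update_le _ ?_ i fun Y => ?_
  · have h2 : MeasurableSet {Y : Fin n → EuclideanSpace ℝ (Fin p) |
        ∀ j, j ≠ i → coords Y j ⬝ᵥ coords Y j = 1} := by
      have : {Y : Fin n → EuclideanSpace ℝ (Fin p) | ∀ j, j ≠ i → coords Y j ⬝ᵥ coords Y j = 1} =
          ⋂ j, ⋂ _ : j ≠ i, {Y | coords Y j ⬝ᵥ coords Y j = 1} := by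
        ext Y; simp
      rw [this]
      exact (isClosed_iInter fun j => isClosed_iInter fun _ => isClosed_eq
        ((continuous_coords j).dotProduct (continuous_coords j)) continuous_const).measurableSet
    have h3 : MeasurableSet {Y : Fin n → EuclideanSpace ℝ (Fin p) | γ *
        ∑ j ∈ J, (coords Y i ⬝ᵥ (looScatter γ (coords Y) i)⁻¹ *ᵥ coords Y j) ^ 2 ≤ t} :=
      measurableSet_le (measurable_const.mul (Finset.measurable_sum _ fun j _ =>
        (measurable_dotProduct_looScatter_inv i j i).pow_const 2)) measurable_const
    exact ((measurableSet_looLower γ c₁ i).inter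
      ((measurableSet_looUpper γ C i).inter h2)).inter h3
  · by_cases hY : LooLower γ c₁ i Y ∧ LooUpper γ C i Y ∧
        ∀ j, j ≠ i → coords Y j ⬝ᵥ coords Y j = 1
    · refine (measure_mono fun x hx => ?_).trans
        (uniformSphere_looScatter_small_le hp hγ hγn hc₁ hC ht hY.1 hY.2.1 hY.2.2 hiJ hJ)
      have h1 := hx.2
      rw [looScatter_coords_update, coords_update_self] at h1
      refine le_trans (le_of_eq ?_) h1
      congr 1
      refine Finset.sum_congr rfl fun j hj => ?_
      have hji : j ≠ i := fun h => hiJ (h ▸ hj)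
      rw [coords_update_of_ne hji]
    · refine (measure_mono (t := ∅) fun x hx => hY ⟨looLower_update hx.1.1,
        looUpper_update hx.1.2.1, fun j hj => ?_⟩).trans ?_
      · have := hx.1.2.2 j hj
        rwa [coords_update_of_ne hj] at this
      · simp

end LooEvents

/-! ### Union bound over the bad events. -/

section LooProbability

open Matrix

variable {n p : ℕ}

lemma norm_toLp_sq (u : Fin p → ℝ) :
    ‖(WithLp.toLp 2 u : EuclideanSpace ℝ (Fin p))‖ ^ 2 = u ⬝ᵥ u :=
  norm_sq_eq_dotProduct _

lemma looUpper_of_forall {γ C : ℝ} (hγ : 0 ≤ γ) {Y : Fin n → EuclideanSpace ℝ (Fin p)}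
    (h : ∀ u : Fin p → ℝ, γ * ∑ j, (u ⬝ᵥ coords Y j) ^ 2 ≤ C * (u ⬝ᵥ u)) (i : Fin n) :
    LooUpper γ C i Y := fun u =>
  (mul_le_mul_of_nonneg_left (Finset.sum_le_sum_of_subset_of_nonneg (Finset.erase_subset _ _)
    fun _ _ _ => sq_nonneg _) hγ).trans (h u)

lemma scatterBounded.le (hn : 1 ≤ n) {Y : Fin n → EuclideanSpace ℝ (Fin p)}
    (h : scatterBounded Y) (u : Fin p → ℝ) :
    (p : ℝ) / n * ∑ j, (u ⬝ᵥ coords Y j) ^ 2 ≤ 320 * (u ⬝ᵥ u) := by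
  have h1 := h (WithLp.toLp 2 u)
  rw [norm_toLp_sq] at h1
  have hn' : (0 : ℝ) < n := by exact_mod_cast hn
  rw [div_mul_eq_mul_div, div_le_iff₀ hn']
  calc _ ≤ 320 * n * (u ⬝ᵥ u) := h1
    _ = _ := by ring

lemma looLower_of_not_exists (hn : 1 ≤ n) {c₁ : ℝ} {i : Fin n}
    {Y : Fin n → EuclideanSpace ℝ (Fin p)}
    (h : ¬ ∃ u : EuclideanSpace ℝ (Fin p),
      p * ∑ j ∈ Finset.univ.erase i, (u.ofLp ⬝ᵥ (Y j).ofLp) ^ 2 < c₁ * n * ‖u‖ ^ 2) :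
    LooLower ((p : ℝ) / n) c₁ i Y := fun u => by
  push Not at h
  have h1 := h (WithLp.toLp 2 u)
  rw [norm_toLp_sq] at h1
  have hn' : (0 : ℝ) < n := by exact_mod_cast hn
  rw [div_mul_eq_mul_div, le_div_iff₀ hn']
  calc c₁ * (u ⬝ᵥ u) * n = c₁ * n * (u ⬝ᵥ u) := by ring
    _ ≤ _ := h1

lemma spherePi_not_unit (hp : 1 ≤ p) :
    spherePi n p {Y | ¬ ∀ j, coords Y j ⬝ᵥ coords Y j = 1} = 0 := by
  have := isProbabilityMeasure_uniformSphere hp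
  refine ae_iff.1 (ae_all_iff.2 fun j => ?_)
  have h := (measurePreserving_eval (fun _ : Fin n => uniformSphere p) j).quasiMeasurePreserving.ae
    (ae_norm_eq_one_uniformSphere (p := p))
  filter_upwards [h] with Y hY
  rw [coords, ← norm_sq_eq_dotProduct]
  change ‖Y j‖ = 1 at hY
  rw [hY, one_pow]

/-- The sample points outside which the leave-one-out bounds hold. -/
def looBad (n p : ℕ) (c₁ ε t : ℝ) : Set (Fin n → EuclideanSpace ℝ (Fin p)) :=
  {Y | ¬ (LooBounds ((p : ℝ) / n) (coords Y) c₁ ε t ∧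
    ∀ u : Fin p → ℝ, (p : ℝ) / n * ∑ j, (u ⬝ᵥ coords Y j) ^ 2 ≤ 320 * (u ⬝ᵥ u))}

lemma looBad_subset (hn : 1 ≤ n) (c₁ ε t : ℝ) : looBad n p c₁ ε t ⊆
    ({Y | ¬ scatterBounded Y} ∪ {Y | ¬ ∀ j, coords Y j ⬝ᵥ coords Y j = 1}) ∪
    ⋃ i : Fin n, (({Y | scatterBounded Y ∧ ∃ u : EuclideanSpace ℝ (Fin p),
        p * ∑ j ∈ Finset.univ.erase i, (u.ofLp ⬝ᵥ (Y j).ofLp) ^ 2 < c₁ * n * ‖u‖ ^ 2} ∪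
      {Y | LooLower ((p : ℝ) / n) c₁ i Y ∧
        ε ≤ |coords Y i ⬝ᵥ (looScatter ((p : ℝ) / n) (coords Y) i)⁻¹ *ᵥ coords Y i -
          (looScatter ((p : ℝ) / n) (coords Y) i)⁻¹.trace / p|}) ∪
      ⋃ J ∈ Finset.univ.filter fun J : Finset (Fin n) => i ∉ J ∧ n ≤ 3 * J.card,
        {Y | (LooLower ((p : ℝ) / n) c₁ i Y ∧ LooUpper ((p : ℝ) / n) 320 i Y ∧
          ∀ j, j ≠ i → coords Y j ⬝ᵥ coords Y j = 1) ∧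
          (p : ℝ) / n * ∑ j ∈ J, (coords Y i ⬝ᵥ
            (looScatter ((p : ℝ) / n) (coords Y) i)⁻¹ *ᵥ coords Y j) ^ 2 ≤ t}) := by
  intro Y hY
  by_contra hgood
  simp only [Set.mem_union, Set.mem_iUnion, not_or, not_exists] at hgood
  obtain ⟨⟨h1, h2⟩, h3⟩ := hgood
  have hb : scatterBounded Y := not_not.1 h1
  have hu : ∀ j, coords Y j ⬝ᵥ coords Y j = 1 := not_not.1 h2
  have hlow : ∀ i, LooLower ((p : ℝ) / n) c₁ i Y := fun i =>
    looLower_of_not_exists hn fun h => (h3 i).1.1 ⟨hb, h⟩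
  refine hY ⟨⟨hu, hlow, fun i => ?_, fun i J hiJ hJ => ?_⟩, hb.le hn⟩
  · exact le_of_not_ge fun h => (h3 i).1.2 ⟨hlow i, h⟩
  · exact le_of_not_ge fun h => (h3 i).2 J (Finset.mem_filter.2 ⟨Finset.mem_univ _, hiJ, hJ⟩)
      ⟨⟨hlow i, looUpper_of_forall (by positivity) (hb.le hn) i, fun j _ => hu j⟩, h⟩

/-- The hypothesis `hexp` gives each set J probability at most e^{-2n}; at most 2^n ≤ e^n sets J
leave e^{-n}. The union over i produces the factor n. -/
lemma spherePi_looBad_le {c₁ ε t : ℝ} (hp : 1 ≤ p) (hpn : p ≤ n) (hc₁ : 0 < c₁) (hε : 0 < ε)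
    (hε1 : ε ≤ c₁⁻¹) (ht : 0 < t)
    (hlow : ∀ s : Finset (Fin n), n ≤ s.card + 1 →
      spherePi n p {Y | scatterBounded Y ∧ ∃ u : EuclideanSpace ℝ (Fin p),
        p * ∑ j ∈ s, (u.ofLp ⬝ᵥ (Y j).ofLp) ^ 2 < c₁ * n * ‖u‖ ^ 2} ≤
        ENNReal.ofReal (Real.exp (-n)))
    (hexp : 2 * (n : ℝ) ≤ p / 2 * (c₁ / (3 * 320 ^ 2) * Real.log (1 + 1 / (c₁ * t)) -
      Real.log 2)) :
    spherePi n p (looBad n p c₁ ε t) ≤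
      ENNReal.ofReal (n * (3 * Real.exp (-n) + 2 * Real.exp (-(ε ^ 2 * p * c₁ ^ 2 / 144)))) := by
  have hn : 1 ≤ n := hp.trans hpn
  have hn' : (0 : ℝ) < n := by exact_mod_cast hn
  have hp' : (0 : ℝ) < p := by exact_mod_cast hp
  have hn1 : (1 : ℝ) ≤ n := by exact_mod_cast hn
  have he := Real.exp_pos (-(n : ℝ))
  refine (measure_mono (looBad_subset hn c₁ ε t)).trans ?_
  refine (measure_union_le _ _).trans ?_
  have hA : spherePi n p ({Y | ¬ scatterBounded Y} ∪
      {Y | ¬ ∀ j, coords Y j ⬝ᵥ coords Y j = 1}) ≤ ENNReal.ofReal (Real.exp (-n)) := by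
    refine (measure_union_le _ _).trans ?_
    rw [spherePi_not_unit hp, add_zero]
    exact spherePi_not_scatterBounded_le hp hpn
  have h2e : (2 : ℝ) ^ n * Real.exp (-(2 * n)) ≤ Real.exp (-n) := by
    have h1 : (2 : ℝ) ≤ Real.exp 1 := by
      have := Real.add_one_le_exp (1 : ℝ); linarith
    calc (2 : ℝ) ^ n * Real.exp (-(2 * n)) ≤ Real.exp 1 ^ n * Real.exp (-(2 * n)) := by gcongr
      _ = Real.exp (-n) := by
        rw [← Real.exp_nat_mul, ← Real.exp_add]; congr 1; ring
  refine (add_le_add hA ((measure_iUnion_fintype_le _ _).trans (Finset.sum_le_card_nsmul _ _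
    (ENNReal.ofReal (2 * Real.exp (-n) + 2 * Real.exp (-(ε ^ 2 * p * c₁ ^ 2 / 144))))
    fun i _ => ?_))).trans ?_
  · have hs : n ≤ (Finset.univ.erase i).card + 1 := by
      rw [Finset.card_erase_add_one (Finset.mem_univ i), Finset.card_univ, Fintype.card_fin]
    have hJ : ∀ J ∈ Finset.univ.filter fun J : Finset (Fin n) => i ∉ J ∧ n ≤ 3 * J.card,
        spherePi n p {Y | (LooLower ((p : ℝ) / n) c₁ i Y ∧ LooUpper ((p : ℝ) / n) 320 i Y ∧
          ∀ j, j ≠ i → coords Y j ⬝ᵥ coords Y j = 1) ∧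
          (p : ℝ) / n * ∑ j ∈ J, (coords Y i ⬝ᵥ
            (looScatter ((p : ℝ) / n) (coords Y) i)⁻¹ *ᵥ coords Y j) ^ 2 ≤ t} ≤
          ENNReal.ofReal (Real.exp (-(2 * n))) := fun J hJ => by
      obtain ⟨-, hiJ, hcard⟩ := Finset.mem_filter.1 hJ
      refine (spherePi_small_le hp (by positivity) (by field_simp) hc₁ (by norm_num) ht i hiJ
        hcard).trans (ENNReal.ofReal_le_ofReal (Real.exp_le_exp.2 ?_))
      linarith
    have hsum : spherePi n p (⋃ J ∈ Finset.univ.filter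
        fun J : Finset (Fin n) => i ∉ J ∧ n ≤ 3 * J.card,
        {Y | (LooLower ((p : ℝ) / n) c₁ i Y ∧ LooUpper ((p : ℝ) / n) 320 i Y ∧
          ∀ j, j ≠ i → coords Y j ⬝ᵥ coords Y j = 1) ∧
          (p : ℝ) / n * ∑ j ∈ J, (coords Y i ⬝ᵥ
            (looScatter ((p : ℝ) / n) (coords Y) i)⁻¹ *ᵥ coords Y j) ^ 2 ≤ t}) ≤
        ENNReal.ofReal (Real.exp (-n)) := by
      refine (measure_biUnion_finset_le _ _).trans
        ((Finset.sum_le_card_nsmul _ _ _ hJ).trans ?_)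
      rw [nsmul_eq_mul, ← ENNReal.ofReal_natCast, ← ENNReal.ofReal_mul (by positivity)]
      refine ENNReal.ofReal_le_ofReal (le_trans ?_ h2e)
      refine mul_le_mul_of_nonneg_right ?_ (Real.exp_pos _).le
      have h1 := Finset.card_filter_le (Finset.univ : Finset (Finset (Fin n)))
        fun J : Finset (Fin n) => i ∉ J ∧ n ≤ 3 * J.card
      rw [Finset.card_univ, Fintype.card_finset, Fintype.card_fin] at h1
      exact_mod_cast h1
    refine (measure_union_le _ _).trans ((add_le_add ((measure_union_le _ _).trans (add_le_add
      (hlow _ hs) (spherePi_conc_le hp hc₁ hε hε1 i))) hsum).trans (le_of_eq ?_))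
    rw [← ENNReal.ofReal_ofNat, ← ENNReal.ofReal_mul (by norm_num),
      ← ENNReal.ofReal_add (by positivity) (by positivity),
      ← ENNReal.ofReal_add (by positivity) (by positivity)]
    congr 1; ring
  · rw [Finset.card_univ, Fintype.card_fin, nsmul_eq_mul, ← ENNReal.ofReal_natCast n,
      ← ENNReal.ofReal_mul (by positivity), ← ENNReal.ofReal_add (by positivity) (by positivity)]
    refine ENNReal.ofReal_le_ofReal ?_
    -- The single term e^{-n} of the event not depending on i is absorbed by n e^{-n}, which turns
    -- the coefficient 2 into 3.
    nlinarith

end LooProbability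

/-! ### Choice of the constants in the proportional regime. -/

section Proportional

lemma exists_forall_spherePi_looBad_le {y : ℝ} (hy0 : 0 < y) (hy1 : y < 1) :
    ∃ δ > (0 : ℝ), ∃ c₁ > (0 : ℝ), ∃ t > (0 : ℝ), t ≤ 1 ∧ ∃ n₀ : ℕ, 6 ≤ n₀ ∧ ∀ n p : ℕ,
      n₀ ≤ n → 1 ≤ p → |(p : ℝ) / n - y| ≤ δ → p ≤ n ∧ y * n / 2 ≤ p ∧
      ∀ ε : ℝ, 0 < ε → ε ≤ c₁⁻¹ → spherePi n p (looBad n p c₁ ε t) ≤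
        ENNReal.ofReal
          (n * (3 * Real.exp (-n) + 2 * Real.exp (-(ε ^ 2 * p * c₁ ^ 2 / 144)))) := by
  obtain ⟨c₁, hc₁, p₀, hlow⟩ := spherePi_exists_sum_sq_lt_le (κ := (1 - y) / 4) (by linarith)
  -- Chosen so that the rate equals 8/y when the logarithm is M; with p ≥ yn/2 the exponent p/2 ·
  -- 8/y is at least 2n.
  set M : ℝ := (8 / y + Real.log 2) / (c₁ / (3 * 320 ^ 2)) with hM
  -- This δ gives 3yn/4 ≤ p ≤ (y + (1-y)/4)n. With κ = (1-y)/4 and n ≥ 2/(1-y), room remains for the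
  -- extra 1 of the leave-one-out lower bound.
  refine ⟨min y (1 - y) / 4, by have := lt_min hy0 (sub_pos.2 hy1); linarith, c₁, hc₁,
    min 1 (Real.exp (-M) / c₁), lt_min one_pos (by positivity), min_le_left _ _,
    max 6 (max ⌈2 * p₀ / y⌉₊ ⌈2 / (1 - y)⌉₊), le_max_left _ _, fun n p hn hp hpy => ?_⟩
  set t := min 1 (Real.exp (-M) / c₁) with ht
  have ht0 : 0 < t := lt_min one_pos (by positivity)
  have hn6 : 6 ≤ n := (le_max_left _ _).trans hn
  have hn0 : (0 : ℝ) < n := by exact_mod_cast (by omega : 0 < n)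
  have hn1 : 2 * p₀ / y ≤ n :=
    Nat.ceil_le.1 (((le_max_left _ _).trans (le_max_right _ _)).trans hn)
  have hn2 : 2 / (1 - y) ≤ n :=
    Nat.ceil_le.1 (((le_max_right _ _).trans (le_max_right _ _)).trans hn)
  rw [div_le_iff₀ hy0] at hn1
  rw [div_le_iff₀ (by linarith)] at hn2
  obtain ⟨hl, hu⟩ := abs_le.1 hpy
  have hm1 := min_le_left y (1 - y)
  have hm2 := min_le_right y (1 - y)
  have hl' : y - y / 4 ≤ (p : ℝ) / n := by linarith
  have hu' : (p : ℝ) / n ≤ y + (1 - y) / 4 := by linarith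
  rw [le_div_iff₀ hn0] at hl'
  rw [div_le_iff₀ hn0] at hu'
  have hyn : 0 < y * n := by positivity
  have hp1 : y * n / 2 ≤ p := by linarith
  have hpp₀ : p₀ ≤ p := by
    have : (p₀ : ℝ) ≤ p := by linarith
    exact_mod_cast this
  have hκ : (p : ℝ) + 1 + (1 - y) / 4 * n ≤ n := by linarith
  have hpn : p ≤ n := by
    have : (p : ℝ) ≤ n := by
      have : 0 < (1 - y) * n := mul_pos (by linarith) hn0
      linarith
    exact_mod_cast this
  refine ⟨hpn, hp1, fun ε hε hε1 => spherePi_looBad_le hp hpn hc₁ hε hε1 ht0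
    (hlow n p hp hpp₀ hκ) ?_⟩
  have hlog : M ≤ Real.log (1 + 1 / (c₁ * t)) := by
    rw [Real.le_log_iff_exp_le (by positivity)]
    have h1 : c₁ * t ≤ Real.exp (-M) := by
      calc c₁ * t ≤ c₁ * (Real.exp (-M) / c₁) := by gcongr; exact min_le_right _ _
        _ = _ := by field_simp
    have h2 : Real.exp M ≤ 1 / (c₁ * t) := by
      rw [le_div_iff₀ (by positivity)]
      calc Real.exp M * (c₁ * t) ≤ Real.exp M * Real.exp (-M) := by gcongr
        _ = 1 := by rw [← Real.exp_add]; simp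
    linarith
  have h8 : 8 / y ≤ c₁ / (3 * 320 ^ 2) * Real.log (1 + 1 / (c₁ * t)) - Real.log 2 := by
    have : c₁ / (3 * 320 ^ 2) * M ≤ c₁ / (3 * 320 ^ 2) * Real.log (1 + 1 / (c₁ * t)) := by gcongr
    have h3 : c₁ / (3 * 320 ^ 2) * M = 8 / y + Real.log 2 := by rw [hM]; field_simp
    linarith
  calc 2 * (n : ℝ) = y * n / 2 / 2 * (8 / y) := by field_simp; norm_num
    _ ≤ p / 2 * (8 / y) := by gcongr
    _ ≤ _ := by gcongr

end Proportional

/-! ### From the sphere to the sample space. -/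

section Transfer

lemma map_whitenedDirection_eq_spherePi {n p : ℕ} {T : Matrix (Fin p) (Fin p) ℝ} {Ω : Type*}
    [MeasurableSpace Ω] {P : Measure Ω} [IsProbabilityMeasure P]
    {x : Fin n → Ω → EuclideanSpace ℝ (Fin p)} (hx : iIndepFun x P)
    (hlaw : ∀ i, HasLaw (fun ω => whitenedDirection T (x i ω)) (uniformSphere p) P) :
    P.map (fun ω i => whitenedDirection T (x i ω)) = spherePi n p := by
  have h := hx.comp (fun _ => whitenedDirection T) fun _ => measurable_whitenedDirection T
  have h2 := (iIndepFun_iff_map_fun_eq_pi_map fun i => (hlaw i).aemeasurable).1 h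
  refine h2.trans ?_
  rw [spherePi]
  congr 1
  funext i
  exact (hlaw i).map_eq

/-- Subadditivity suffices, so neither set has to be measurable; this matters for the event that an
estimator exists. -/
lemma one_sub_le_measureReal {Ω : Type*} [MeasurableSpace Ω] {P : Measure Ω}
    [IsProbabilityMeasure P] {A B : Set Ω} (h : Bᶜ ⊆ A) {b : ℝ} (hb : 0 ≤ b)
    (hB : P B ≤ ENNReal.ofReal b) : 1 - b ≤ P.real A := by
  have h1 : (1 : ℝ) ≤ P.real A + P.real B := by
    rw [← probReal_univ (μ := P)]
    refine (measureReal_mono fun ω _ => ?_).trans (measureReal_union_le A B)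
    by_cases hω : ω ∈ B
    · exact Or.inr hω
    · exact Or.inl (h hω)
  have h2 : P.real B ≤ b := ENNReal.toReal_le_of_le_ofReal hb hB
  linarith

end Transfer

theorem mainTheorem3 (y : ℝ) (hy0 : 0 < y) (hy1 : y < 1) :
    ∃ δ > (0 : ℝ), ∃ c > (0 : ℝ), ∃ C > (0 : ℝ), ∃ c' > (0 : ℝ),
      ∀ n p : ℕ, 1 ≤ n → 1 ≤ p → |(p : ℝ) / n - y| ≤ δ →
      ∀ T : Matrix (Fin p) (Fin p) ℝ, T.PosDef →
      ∀ g : ℝ → ℝ, IsRadialProfile p g →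
      ∀ (Ω : Type*) [MeasurableSpace Ω] (P : Measure Ω) [IsProbabilityMeasure P]
        (x : Fin n → Ω → EuclideanSpace ℝ (Fin p)),
        iIndepFun x P → (∀ i, HasLaw (x i) (ellipticalMeasure T g) P) →
        (∀ i, HasLaw (fun ω => whitenedDirection T (x i ω)) (uniformSphere p) P) ∧
        ∀ ε : ℝ, 0 < ε → ε < c' →
          P.real {ω | ∃ S, IsTylerEstimator (fun i => x i ω) S ∧
              opNorm (whitenedNormalized T S -
                ((p : ℝ) / n) • ∑ i, outer (whitenedDirection T (x i ω))) ≤ ε} ≥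
            1 - C * n * Real.exp (-c * ε ^ 2 * n) := by
  obtain ⟨δ, hδ, c₁, hc₁, t, ht, ht1, n₀, hn₀, hprob⟩ := exists_forall_spherePi_looBad_le hy0 hy1
  set c₀ : ℝ := t / (1 + c₁⁻¹) ^ 2 with hc₀
  have hc₀0 : 0 < c₀ := by positivity
  have hc₀1 : c₀ ≤ 1 := by
    rw [hc₀, div_le_one (by positivity)]
    have : 0 < c₁⁻¹ := by positivity
    nlinarith
  -- 655360 = 4 · 320 · 512. With ρ = ε/320 the allowance c₀ρ/512 is 4aε, shared equally by the
  -- concentration error aε and the trace error c₁⁻¹/p.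
  set a : ℝ := c₀ / 655360 with ha
  have ha0 : 0 < a := by positivity
  -- The second term comes from the exponent (aε)²pc₁²/144 with p ≥ yn/2, the first from e^{-n} with
  -- ε ≤ 1.
  set c : ℝ := min 1 (a ^ 2 * y * c₁ ^ 2 / 288) with hc
  have hc0 : 0 < c := lt_min one_pos (by positivity)
  have hc1 : c ≤ 1 := min_le_left _ _
  set K : ℝ := 2 * c₁⁻¹ / (y * a) with hK
  -- The 5 is 3 + 2 from the union bound; the two exponentials make the claim vacuous for n < n₀ and
  -- for aε < c₁⁻¹/p. In c', 40c₀ yields ρ = ε/320 ≤ c₀/8 and c₁⁻¹/a yields aε ≤ c₁⁻¹.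
  refine ⟨δ, hδ, c, hc0, 5 + Real.exp n₀ + Real.exp K, by positivity,
    min 1 (min (40 * c₀) (c₁⁻¹ / a)), lt_min one_pos (lt_min (by positivity) (by positivity)),
    fun n p hn hp hpy T hT g hg Ω _ P _ x hx hlaw => ?_⟩
  have hdir : ∀ i, HasLaw (fun ω => whitenedDirection T (x i ω)) (uniformSphere p) P := fun i =>
    (hasLaw_whitenedDirection hp hT hg).comp (hlaw i)
  refine ⟨hdir, fun ε hε hεc => ?_⟩
  have hε1 : ε ≤ 1 := (hεc.trans_le (min_le_left _ _)).le
  have hε2 : ε ≤ 40 * c₀ := (hεc.trans_le ((min_le_right _ _).trans (min_le_left _ _))).le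
  have hε3 : ε ≤ c₁⁻¹ / a := (hεc.trans_le ((min_le_right _ _).trans (min_le_right _ _))).le
  have hn' : (1 : ℝ) ≤ n := by exact_mod_cast hn
  -- If ε²n ≤ L and e^L is at most the constant, then, since c ≤ 1 and n ≥ 1, the claimed lower
  -- bound on the probability is at most 0.
  have htrivial : ∀ L : ℝ, ε ^ 2 * n ≤ L → 0 ≤ L →
      Real.exp L ≤ 5 + Real.exp n₀ + Real.exp K →
      ∀ r : ℝ, 0 ≤ r →
        r ≥ 1 - (5 + Real.exp n₀ + Real.exp K) * n * Real.exp (-c * ε ^ 2 * n) := by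
    intro L hL hL0 hC r hr
    have h1 : Real.exp (-L) ≤ Real.exp (-c * ε ^ 2 * n) := by
      refine Real.exp_le_exp.2 ?_
      have : c * (ε ^ 2 * n) ≤ 1 * (ε ^ 2 * n) := by gcongr
      linarith
    have h2 : 1 ≤ (5 + Real.exp n₀ + Real.exp K) * n * Real.exp (-c * ε ^ 2 * n) := by
      calc (1 : ℝ) = Real.exp L * 1 * Real.exp (-L) := by rw [mul_one, ← Real.exp_add]; simp
        _ ≤ _ := by gcongr
    linarith
  have hsq : ε ^ 2 ≤ 1 := pow_le_one₀ hε.le hε1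
  have hexp0 := Real.exp_pos (n₀ : ℝ)
  have hexpK := Real.exp_pos K
  rcases lt_or_ge n n₀ with hlt | hge
  · refine htrivial n₀ ?_ (by positivity) (by linarith) _ measureReal_nonneg
    have : (n : ℝ) ≤ n₀ := by exact_mod_cast hlt.le
    nlinarith
  obtain ⟨hpn, hyp, hbad⟩ := hprob n p hge hp hpy
  have hp' : (0 : ℝ) < p := by exact_mod_cast hp
  rcases lt_or_ge (a * ε) (c₁⁻¹ / p) with hlt | hsmall
  -- Here εp is bounded, hence so is εn, and ε ≤ 1 gives ε²n ≤ K.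
  · refine htrivial K ?_ (by positivity) (by linarith) _ measureReal_nonneg
    rw [lt_div_iff₀ hp'] at hlt
    have h1 : a * ε * (y * n / 2) ≤ c₁⁻¹ := (by gcongr : _ ≤ a * ε * p).trans hlt.le
    rw [hK, le_div_iff₀ (by positivity)]
    have h2 : ε ^ 2 * n * (y * a) = ε * (2 * (a * ε * (y * n / 2))) := by ring
    rw [h2]
    calc ε * (2 * (a * ε * (y * n / 2))) ≤ 1 * (2 * c₁⁻¹) := by gcongr
      _ = _ := one_mul _
  have hbad := hbad (a * ε) (by positivity) (by rwa [le_div_iff₀' ha0] at hε3)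
  set b : ℝ := n * (3 * Real.exp (-n) + 2 * Real.exp (-((a * ε) ^ 2 * p * c₁ ^ 2 / 144))) with hb
  have hb0 : 0 ≤ b := by positivity
  have hbC : b ≤ (5 + Real.exp n₀ + Real.exp K) * n * Real.exp (-c * ε ^ 2 * n) := by
    have h1 : Real.exp (-n) ≤ Real.exp (-c * ε ^ 2 * n) := by
      refine Real.exp_le_exp.2 ?_
      have : c * ε ^ 2 * n ≤ 1 * 1 * n := by gcongr
      linarith
    have h2 : Real.exp (-((a * ε) ^ 2 * p * c₁ ^ 2 / 144)) ≤ Real.exp (-c * ε ^ 2 * n) := by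
      refine Real.exp_le_exp.2 ?_
      have h3 : c * ε ^ 2 * n ≤ (a * ε) ^ 2 * p * c₁ ^ 2 / 144 := by
        calc c * ε ^ 2 * n ≤ a ^ 2 * y * c₁ ^ 2 / 288 * ε ^ 2 * n := by
              gcongr; exact min_le_right _ _
          _ = (a * ε) ^ 2 * (y * n / 2) * c₁ ^ 2 / 144 := by ring
          _ ≤ _ := by gcongr
      linarith
    calc b ≤ n * (3 * Real.exp (-c * ε ^ 2 * n) + 2 * Real.exp (-c * ε ^ 2 * n)) := by
          rw [hb]; gcongr
      _ = 5 * n * Real.exp (-c * ε ^ 2 * n) := by ring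
      _ ≤ _ := by gcongr; linarith
  refine ge_iff_le.2 ((sub_le_sub_left hbC 1).trans (one_sub_le_measureReal
    (B := (fun ω i => whitenedDirection T (x i ω)) ⁻¹' looBad n p c₁ (a * ε) t)
    (fun ω hω => ?_) hb0 ?_))
  · obtain ⟨hL, hA⟩ := not_not.1 hω
    have h := exists_isTylerEstimator (z := fun i => x i ω) (ρ := ε / 320) (C := 320) hT hL hpn
      (hn₀.trans hge) hp hc₁ hc₀ hc₀0 hc₀1 (by positivity) (by linarith) ?_ (by norm_num) hA
    · rwa [div_mul_cancel₀ ε (by norm_num)] at h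
    · have h1 : c₀ * (ε / 320) / 512 = 4 * (a * ε) := by rw [ha]; ring
      linarith
  -- This direction of the pushforward inequality holds for every set, so the bad set need not be
  -- measurable.
  · refine (Measure.le_map_apply (aemeasurable_pi_lambda _ fun i => (hdir i).aemeasurable)
      _).trans ?_
    rwa [map_whitenedDirection_eq_spherePi hx hdir]
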